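/- Let $n\ge 1$, $0<\lambda\le\Lambda$ and $p>2$. There exist constants $\varepsilon>0$, $c>0$ and $C>1$, depending only on $n,p,\lambda,\Lambda$, with the following property. Let $U\subset\mathbb R^n$ be open, $T\in\mathbb R$, and $U_T=U\times(0,T]$. Let $F$ be a real-valued function of a matrix $M\in\mathbb R^{n\times n}$, a vector $\xi\in\mathbb R^n$ and a point $(x,t)$, such that for every $(x,t)\in U_T$ and $\xi\in\mathbb R^n$ one has $F(0,\xi,x,t)=0$ and \[ \lambda|\xi|^{p-2}\operatorname{Tr}(N)\le F(M+N,\xi,x,t)-F(M,\xi,x,t)\le \Lambda|\xi|^{p-2}\operatorname{Tr}(N) \] for all symmetric $M$ and all symmetric positive semidefinite $N$. Let $u:U_T\to[0,\infty)$ be a viscosity supersolution of $\partial_t u-F(D^2u,Du,x,t)=0$ in $U_T$; that is, $u$ is lower semicontinuous on $U_T$, and whenever $\varphi\in C^2(U_T)$ and $(\bar x,\bar t)\in U_T$ satisfy $\varphi(\bar x,\bar t)=u(\bar x,\bar t)$ and $\varphi(x,t)\le u(x,t)$ for all $(x,t)\in U_T$ with $t\le\bar t$, then \[ \partial_t\varphi(\bar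 x,\bar t)-F\big(D^2\varphi(\bar x,\bar t),D\varphi(\bar x,\bar t),\bar x,\bar t\big)\ge 0 \] (here $D,D^2$ are the spatial gradient and Hessian, and $\partial_t$ is the one-sided derivative from the left if $\bar t=T$). For $\rho,\theta>0$ write $(x_0,t_0)+Q^-_\rho(\theta)=B_\rho(x_0)\times(t_0-\theta\rho^p,t_0]$. Let $(x_0,t_0)\in U_T$ with $u(x_0,t_0)>0$, let $\rho>0$, put \[ \theta=\left(\frac{c}{u(x_0,t_0)}\right)^{p-2}, \] and suppose that $(x_0,t_0)+Q^-_{3\rho}(\theta)\subset U_T$. Then, with $Q=(x_0,t_0-\theta\rho^p)+Q^-_\rho(\theta)$, the function $u^\varepsilon$ is integrable on $Q$ and \[ \left(\frac1{|Q|}\int_Q u(x,t)^\varepsilon\,dx\,dt\right)^{1/\varepsilon}\le C\,u(x_0,t_0). \] -/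

import Mathlib

open MeasureTheory Set

noncomputable section

/-- Points of `ℝⁿ`, with the Euclidean norm. -/
abbrev Space (n : ℕ) : Type := EuclideanSpace ℝ (Fin n)

/-- The cylindrical domain `U × (T₁, T₂]`. -/
def cylDomain {n : ℕ} (U : Set (Space n)) (T₁ T₂ : ℝ) : Set (Space n × ℝ) :=
  U ×ˢ Ioc T₁ T₂

/-- The backward homothetic cylinder
`(x₀, t₀) + Q⁻_ρ(θ) = B_ρ(x₀) × (t₀ - θ ρ ^ p, t₀]`. -/
def cylMinus {n : ℕ} (p : ℝ) (z₀ : Space n × ℝ) (ρ θ : ℝ) : Set (Space n × ℝ) :=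
  Metric.ball z₀.1 ρ ×ˢ Ioc (z₀.2 - θ * ρ ^ p) z₀.2

/-- The spatial gradient `Dφ(x, t)`. -/
def spaceGrad {n : ℕ} (φ : Space n × ℝ → ℝ) (z : Space n × ℝ) : Space n :=
  gradient (fun y => φ (y, z.2)) z.1

/-- The spatial Hessian `D²φ(x, t)`, as a matrix in the standard basis. -/
def spaceHess {n : ℕ} (φ : Space n × ℝ → ℝ) (z : Space n × ℝ) :
    Matrix (Fin n) (Fin n) ℝ :=
  Matrix.of fun i j =>
    fderiv ℝ (fun y => fderiv ℝ (fun y' => φ (y', z.2)) y) z.1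
      (EuclideanSpace.single i (1 : ℝ)) (EuclideanSpace.single j (1 : ℝ))

/-- The time derivative `∂ₜφ(x, t)` of a function on `U × (T₁, T₂]`. It is the ordinary derivative
for `T₁ < t < T₂` and the derivative from the left at the final time `t = T₂`. -/
def timeDeriv {n : ℕ} (T₁ T₂ : ℝ) (φ : Space n × ℝ → ℝ) (z : Space n × ℝ) : ℝ :=
  derivWithin (fun t => φ (z.1, t)) (Ioc T₁ T₂) z.2

/-- `φ` touches `u` from below at `z₀`, relative to `Ω` and to times `t ≤ t₀`. -/
def TouchesFromBelow {n : ℕ} (Ω : Set (Space n × ℝ)) (φ u : Space n × ℝ → ℝ)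
    (z₀ : Space n × ℝ) : Prop :=
  (∀ z ∈ Ω, z.2 ≤ z₀.2 → φ z ≤ u z) ∧ φ z₀ = u z₀

/-- `u` is a viscosity supersolution of `∂ₜu - F(D²u, Du, x, t) = 0` in `U × (T₁, T₂]`. -/
def IsViscositySupersolution {n : ℕ}
    (F : Matrix (Fin n) (Fin n) ℝ → Space n → Space n → ℝ → ℝ)
    (U : Set (Space n)) (T₁ T₂ : ℝ) (u : Space n × ℝ → ℝ) : Prop :=
  LowerSemicontinuousOn u (cylDomain U T₁ T₂) ∧
  ∀ φ : Space n × ℝ → ℝ, ContDiffOn ℝ 2 φ (cylDomain U T₁ T₂) →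
    ∀ z₀ ∈ cylDomain U T₁ T₂, TouchesFromBelow (cylDomain U T₁ T₂) φ u z₀ →
      0 ≤ timeDeriv T₁ T₂ φ z₀ - F (spaceHess φ z₀) (spaceGrad φ z₀) z₀.1 z₀.2

/-- The structure condition on `F` over `Ω`: uniform ellipticity in the Hessian, degenerate with
power `p - 2` in the gradient, and `F(0, ξ, x, t) = 0`. -/
def IsDegenerateElliptic {n : ℕ} (lam Lam p : ℝ)
    (F : Matrix (Fin n) (Fin n) ℝ → Space n → Space n → ℝ → ℝ)
    (Ω : Set (Space n × ℝ)) : Prop :=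
  ∀ z ∈ Ω, ∀ ξ : Space n,
    F 0 ξ z.1 z.2 = 0 ∧
    ∀ M N : Matrix (Fin n) (Fin n) ℝ, M.IsSymm → N.PosSemidef →
      lam * ‖ξ‖ ^ (p - 2) * N.trace ≤ F (M + N) ξ z.1 z.2 - F M ξ z.1 z.2 ∧
      F (M + N) ξ z.1 z.2 - F M ξ z.1 z.2 ≤ Lam * ‖ξ‖ ^ (p - 2) * N.trace

end

noncomputable section

/-! ### Supersolutions of the extremal equation -/

namespace WeakHarnack

open Filter Topology

/-! Of the equation only the extremal inequality is kept: a quadratic polynomial with Hessian `2 B e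
⊗ e - 2 A I` touching from below must satisfy one scalar inequality (`IsSuper`). This class is
invariant under `v ↦ k v(x₀ + ρ x, t₀ + k^(p-2) ρ^p t)`. The prescribed `θ` is exactly this scaling,
so the value at the base point can be normalized to a fixed small constant, and the task becomes to
show that the measure of `{v > H}` decays like a power of `H`.

Measure estimate (`exists_measure_estimate`). The role of the Aleksandrov-Bakelman-Pucci argument is
played by sliding cusps `-|x - y|^q` with `q = p/(p-1)`, whose degenerate second-order term stays
bounded up to the vertex. If `v(0,0)` is small, every cusp from a set of vertices and heights of
fixed measure, raised in time, first touches `v` at a point where `v ≤ 1`. The relation from contact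
points to (vertex, height) must not expand volume by more than a constant factor. No second
derivative of `v` is available; instead, if the cusps at two nearby contact points had very
different gradients, a convex kink would lie below `v`, and ellipticity would lift `v` strictly
above its contact value (`IsSuper.kink`). Hence gradients, and by duality vertices, vary in a
Lipschitz way at intrinsic scale (`exists_contact_estimate`), and a Vitali covering replaces the
area formula (`volume_le_of_contact`). The estimate is uniform in the distance `d` between contact
point and vertex, so dyadic shells of `d` can be summed.

Expansion. A Barenblatt-type self-similar strict subsolution (`BarrierParam`) spreads positivity
forward in time. With the measure estimate it gives the growth lemma (`exists_growth`): if `v > H`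
on most of an intrinsic cylinder, then `v ≥ H/4` on a ball at an early time, and later `v > H/M` on
a larger ball for as long as prescribed. Run all the way to the origin it gives the core bound
(`exists_core_bound`): large values cannot occupy a ball of radius comparable to `H^(-γ)` if
`v(0,0)` is small.

Covering by ink spots. Around each point of `{v > H}` the intrinsic radius is doubled until the
density of that set drops; the core bound makes this stop at a tiny radius. The stopped cylinders
have a union `E` of which `{v > H}` misses a definite fraction, while their futures lie in `{v >
H/M}` on a slightly larger domain. The one-dimensional shadow estimate (`volume_iUnion_shadow_le`)
bounds `|E|` by nearly `|{v > H/M}|`. This yields geometric decay (`exists_superLevel_decay`), and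
summing layers bounds the integral of `v^ε` for small `ε`. -/

/-- Nonnegative lower semicontinuous supersolutions of the extremal equation
`∂ₜv = |Dv|^(p-2) M⁻(D²v)` on `S`. They are tested only with quadratic polynomials whose Hessian is
`2 B e ⊗ e - 2 A I`, that touch `v` from below in a backward neighbourhood of a point of `S`. -/
structure IsSuper {n : ℕ} (lam Lam p : ℝ) (S : Set (Space n × ℝ)) (v : Space n × ℝ → ℝ) :
    Prop where
  lsc : LowerSemicontinuousOn v S
  nonneg : ∀ z ∈ S, 0 ≤ v z
  test : ∀ x t, (x, t) ∈ S → ∀ (τ : ℝ) (ξ e : Space n) (A B η : ℝ), 0 ≤ A → 0 ≤ B → 0 < η →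
    (∀ (h : Space n) (s : ℝ), ‖h‖ < η → 0 ≤ s → s < η →
      v (x, t) + inner ℝ ξ h - τ * s - A * ‖h‖ ^ 2 + B * inner ℝ e h ^ 2 ≤ v (x + h, t - s)) →
    ‖ξ‖ ^ (p - 2) * (2 * lam * B * ‖e‖ ^ 2 - 2 * n * Lam * A) ≤ τ

theorem IsSuper.mono {n : ℕ} {lam Lam p : ℝ} {S S' : Set (Space n × ℝ)} {v : Space n × ℝ → ℝ}
    (hv : IsSuper lam Lam p S v) (h : S' ⊆ S) : IsSuper lam Lam p S' v :=
  ⟨hv.lsc.mono h, fun z hz => hv.nonneg z (h hz), fun x t hx => hv.test x t (h hx)⟩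

/-- The test remains valid if the polynomial touches only up to errors of higher order. -/
theorem IsSuper.test_approx {n : ℕ} {lam Lam p : ℝ} {S : Set (Space n × ℝ)}
    {v : Space n × ℝ → ℝ} (hv : IsSuper lam Lam p S v) {x : Space n} {t : ℝ} (hx : (x, t) ∈ S)
    {τ : ℝ} {ξ e : Space n} {A B : ℝ} (hA : 0 ≤ A) (hB : 0 ≤ B)
    (H : ∀ δ > 0, ∃ η > 0, ∀ (h : Space n) (s : ℝ), ‖h‖ < η → 0 ≤ s → s < η →
      v (x, t) + inner ℝ ξ h - τ * s - A * ‖h‖ ^ 2 + B * inner ℝ e h ^ 2 - δ * (‖h‖ ^ 2 + s)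
        ≤ v (x + h, t - s)) :
    ‖ξ‖ ^ (p - 2) * (2 * lam * B * ‖e‖ ^ 2 - 2 * n * Lam * A) ≤ τ := by
  have key : ∀ δ > 0,
      ‖ξ‖ ^ (p - 2) * (2 * lam * B * ‖e‖ ^ 2 - 2 * n * Lam * (A + δ)) ≤ τ + δ := by
    intro δ hδ
    obtain ⟨η, hη, H'⟩ := H δ hδ
    -- The error is absorbed by enlarging `A` and `τ` by `δ`; both enter the conclusion
    -- continuously.
    refine hv.test x t hx (τ + δ) ξ e (A + δ) B η (by positivity) hB hη ?_
    intro h s h1 h2 h3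
    have := H' h s h1 h2 h3
    linarith
  have h1 : Tendsto (fun δ : ℝ => ‖ξ‖ ^ (p - 2) *
      (2 * lam * B * ‖e‖ ^ 2 - 2 * n * Lam * (A + δ))) (𝓝[>] 0)
      (𝓝 (‖ξ‖ ^ (p - 2) * (2 * lam * B * ‖e‖ ^ 2 - 2 * n * Lam * (A + 0)))) := by
    apply Tendsto.mono_left _ nhdsWithin_le_nhds
    apply Continuous.tendsto
    fun_prop
  have h2 : Tendsto (fun δ : ℝ => τ + δ) (𝓝[>] 0) (𝓝 (τ + 0)) := by
    apply Tendsto.mono_left _ nhdsWithin_le_nhds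
    apply Continuous.tendsto
    fun_prop
  have := le_of_tendsto_of_tendsto h1 h2
    (by filter_upwards [self_mem_nhdsWithin] with δ hδ using key δ hδ)
  simpa using this

/-! ### Quadratic test functions and their derivatives -/

section Quadratic

variable {n : ℕ} (a τ A B t₀ : ℝ) (x₀ ξ e : Space n)

/-- A quadratic polynomial in space, affine in time. -/
def quad (z : Space n × ℝ) : ℝ :=
  a + inner ℝ ξ (z.1 - x₀) + τ * (z.2 - t₀) - A * ‖z.1 - x₀‖ ^ 2 + B * inner ℝ e (z.1 - x₀) ^ 2

theorem contDiff_quad : ContDiff ℝ 2 (quad a τ A B t₀ x₀ ξ e) := by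
  unfold quad
  have h1 : ContDiff ℝ 2 (fun z : Space n × ℝ => z.1 - x₀) := contDiff_fst.sub contDiff_const
  have h2 : ContDiff ℝ 2 (fun z : Space n × ℝ => ‖z.1 - x₀‖ ^ 2) := h1.norm_sq ℝ
  have h3 : ContDiff ℝ 2 (fun z : Space n × ℝ => inner ℝ ξ (z.1 - x₀)) := contDiff_const.inner ℝ h1
  have h4 : ContDiff ℝ 2 (fun z : Space n × ℝ => inner ℝ e (z.1 - x₀)) := contDiff_const.inner ℝ h1
  have h5 : ContDiff ℝ 2 (fun z : Space n × ℝ => τ * (z.2 - t₀)) :=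
    contDiff_const.mul (contDiff_snd.sub contDiff_const)
  exact (((contDiff_const.add h3).add h5).sub (contDiff_const.mul h2)).add
    (contDiff_const.mul (h4.pow 2))

theorem hasFDerivAt_quad (y : Space n) :
    HasFDerivAt (fun y => quad a τ A B t₀ x₀ ξ e (y, t₀))
      (innerSL ℝ ξ - (2 * A) • innerSL ℝ (y - x₀)
        + (2 * B) • (inner ℝ e (y - x₀) • innerSL ℝ e)) y := by
  unfold quad
  have h1 : HasFDerivAt (fun y : Space n => y - x₀) (ContinuousLinearMap.id ℝ _) y :=
    (hasFDerivAt_id y).sub_const x₀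
  have h2 := h1.norm_sq
  have h3 : HasFDerivAt (fun y : Space n => inner ℝ ξ (y - x₀)) (innerSL ℝ ξ) y :=
    ((innerSL ℝ ξ).hasFDerivAt).comp y h1
  have h4 : HasFDerivAt (fun y : Space n => inner ℝ e (y - x₀)) (innerSL ℝ e) y :=
    ((innerSL ℝ e).hasFDerivAt).comp y h1
  have := ((((hasFDerivAt_const a y).add h3).add (hasFDerivAt_const (τ * (t₀ - t₀)) y)).sub
    (h2.const_mul A)).add ((h4.pow 2).const_mul B)
  refine this.congr_fderiv ?_
  ext w
  simp
  ring

theorem spaceGrad_quad : spaceGrad (quad a τ A B t₀ x₀ ξ e) (x₀, t₀) = ξ := by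
  unfold spaceGrad
  apply HasGradientAt.gradient
  rw [hasGradientAt_iff_hasFDerivAt]
  refine (hasFDerivAt_quad a τ A B t₀ x₀ ξ e x₀).congr_fderiv ?_
  ext w
  simp

theorem spaceHess_quad : spaceHess (quad a τ A B t₀ x₀ ξ e) (x₀, t₀) =
    (2 * B) • Matrix.vecMulVec e.ofLp (star e.ofLp)
      - (2 * A) • (1 : Matrix (Fin n) (Fin n) ℝ) := by
  have h0 : (fun y => fderiv ℝ (fun y' => quad a τ A B t₀ x₀ ξ e (y', t₀)) y) =
      fun y => innerSL ℝ ξ - (2 * A) • innerSL ℝ (y - x₀)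
        + (2 * B) • (inner ℝ e (y - x₀) • innerSL ℝ e) :=
    funext fun y => (hasFDerivAt_quad a τ A B t₀ x₀ ξ e y).fderiv
  have h1 : HasFDerivAt (fun y : Space n => y - x₀) (ContinuousLinearMap.id ℝ _) x₀ :=
    (hasFDerivAt_id x₀).sub_const x₀
  have h2 : HasFDerivAt (fun y : Space n => innerSL ℝ (y - x₀)) (innerSL ℝ) x₀ :=
    ((innerSL ℝ).hasFDerivAt).comp x₀ h1
  have h4 : HasFDerivAt (fun y : Space n => inner ℝ e (y - x₀)) (innerSL ℝ e) x₀ :=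
    ((innerSL ℝ e).hasFDerivAt).comp x₀ h1
  have h5 := ((hasFDerivAt_const (innerSL ℝ ξ) x₀).sub (h2.const_smul (2 * A))).add
    ((h4.smul_const (innerSL ℝ e)).const_smul (2 * B))
  ext i j
  simp only [spaceHess, Matrix.of_apply]
  have h6 := HasFDerivAt.fderiv h5
  rw [h0]
  refine (congrArg (fun L => L (EuclideanSpace.single i (1 : ℝ)) (EuclideanSpace.single j (1 : ℝ)))
    h6).trans ?_
  have h7 : (innerSL ℝ) (EuclideanSpace.single i (1 : ℝ)) (EuclideanSpace.single j (1 : ℝ)) =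
      if i = j then 1 else 0 := by
    rw [innerSL_apply_apply, EuclideanSpace.inner_single_left]
    simp
  simp only [add_apply, sub_apply,
    smul_apply, h7, ContinuousLinearMap.smulRight_apply, innerSL_apply_apply,
    EuclideanSpace.inner_single_right, Matrix.sub_apply, Matrix.smul_apply, Matrix.one_apply,
    Matrix.vecMulVec_apply]
  simp
  ring

theorem timeDeriv_quad {T₁ T₂ : ℝ} (ht : t₀ ∈ Ioc T₁ T₂) :
    timeDeriv T₁ T₂ (quad a τ A B t₀ x₀ ξ e) (x₀, t₀) = τ := by
  unfold timeDeriv quad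
  have : HasDerivAt (fun t : ℝ => a + inner ℝ ξ (x₀ - x₀) + τ * (t - t₀) - A * ‖x₀ - x₀‖ ^ 2
      + B * inner ℝ e (x₀ - x₀) ^ 2) τ t₀ := by
    have := (((((hasDerivAt_id t₀).sub_const t₀).const_mul τ).const_add
      (a + inner ℝ ξ (x₀ - x₀))).sub_const (A * ‖x₀ - x₀‖ ^ 2)).add_const
      (B * inner ℝ e (x₀ - x₀) ^ 2)
    simpa using this
  exact this.hasDerivWithinAt.derivWithin (uniqueDiffOn_Ioc _ _ _ ht)

end Quadratic

/-! ### Localization and reduction to the extremal class -/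

section Congr

variable {n : ℕ} {φ ψ : Space n × ℝ → ℝ} {z : Space n × ℝ}

theorem eventuallyEq_space (h : φ =ᶠ[𝓝 z] ψ) :
    (fun y => φ (y, z.2)) =ᶠ[𝓝 z.1] fun y => ψ (y, z.2) := by
  have : Tendsto (fun y : Space n => (y, z.2)) (𝓝 z.1) (𝓝 z) := by
    apply Continuous.tendsto' (by fun_prop)
    rfl
  exact this.eventually h

theorem spaceGrad_congr (h : φ =ᶠ[𝓝 z] ψ) : spaceGrad φ z = spaceGrad ψ z := by
  unfold spaceGrad gradient
  rw [(eventuallyEq_space h).fderiv_eq]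

theorem spaceHess_congr (h : φ =ᶠ[𝓝 z] ψ) : spaceHess φ z = spaceHess ψ z := by
  unfold spaceHess
  rw [Filter.EventuallyEq.fderiv_eq (eventuallyEq_space h).fderiv]

theorem timeDeriv_congr {T₁ T₂ : ℝ} (h : φ =ᶠ[𝓝 z] ψ) :
    timeDeriv T₁ T₂ φ z = timeDeriv T₁ T₂ ψ z := by
  unfold timeDeriv
  have : Tendsto (fun t : ℝ => (z.1, t)) (𝓝 z.2) (𝓝 z) := by
    apply Continuous.tendsto' (by fun_prop)
    rfl
  have h' : (fun t => φ (z.1, t)) =ᶠ[𝓝 z.2] fun t => ψ (z.1, t) := this.eventually h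
  exact Filter.EventuallyEq.derivWithin_eq (h'.filter_mono nhdsWithin_le_nhds) h'.eq_of_nhds

end Congr

/-- The degenerate ellipticity bounds `F` from below by the extremal operator. -/
theorem le_of_isDegenerateElliptic {n : ℕ} {lam Lam p : ℝ}
    {F : Matrix (Fin n) (Fin n) ℝ → Space n → Space n → ℝ → ℝ} {Ω : Set (Space n × ℝ)}
    (hF : IsDegenerateElliptic lam Lam p F Ω) {z : Space n × ℝ} (hz : z ∈ Ω) (ξ e : Space n)
    {A B : ℝ} (hA : 0 ≤ A) (hB : 0 ≤ B) :
    ‖ξ‖ ^ (p - 2) * (2 * lam * B * ‖e‖ ^ 2 - 2 * n * Lam * A) ≤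
      F ((2 * B) • Matrix.vecMulVec e.ofLp (star e.ofLp)
        - (2 * A) • (1 : Matrix (Fin n) (Fin n) ℝ)) ξ z.1 z.2 := by
  obtain ⟨h0, h1⟩ := hF z hz ξ
  set P : Matrix (Fin n) (Fin n) ℝ := (2 * B) • Matrix.vecMulVec e.ofLp (star e.ofLp) with hP
  set N : Matrix (Fin n) (Fin n) ℝ := (2 * A) • (1 : Matrix (Fin n) (Fin n) ℝ) with hN
  have hPp : P.PosSemidef := (Matrix.posSemidef_vecMulVec_self_star _).smul (by positivity)
  have hNp : N.PosSemidef := Matrix.PosSemidef.one.smul (by positivity)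
  have hPt : P.trace = 2 * B * ‖e‖ ^ 2 := by
    rw [hP, Matrix.trace_smul, Matrix.trace_vecMulVec, EuclideanSpace.norm_sq_eq]
    simp [dotProduct, pow_two]
  have hNt : N.trace = 2 * A * n := by
    rw [hN, Matrix.trace_smul, Matrix.trace_one]
    simp
  have hPs : P.IsSymm := by
    ext i j
    simp [hP, Matrix.vecMulVec_apply, mul_comm]
  have hNs : N.IsSymm := by
    rw [hN]
    exact Matrix.isSymm_one.smul _
  -- `P` is added to `0` at the rate `lam`, and then `N` is added to `P - N` at the rate `Lam`;
  -- subtracting bounds `F (P - N)` from below.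
  have e1 := (h1 0 P Matrix.isSymm_zero hPp).1
  have e2 := (h1 (P - N) N (hPs.sub hNs) hNp).2
  rw [zero_add, h0, hPt] at e1
  rw [sub_add_cancel, hNt] at e2
  nlinarith [e1, e2]

/-- A polynomial that touches only locally becomes a global test function after multiplication by a
bump. Nonnegativity of `u` is what makes this work: where the polynomial is positive the cutoff
lowers it, and elsewhere the product is at most `0 ≤ u`. -/
theorem IsViscositySupersolution.isSuper {n : ℕ} {lam Lam p : ℝ}
    {F : Matrix (Fin n) (Fin n) ℝ → Space n → Space n → ℝ → ℝ} {U : Set (Space n)} {T₁ T₂ : ℝ}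
    {u : Space n × ℝ → ℝ}
    (hF : IsDegenerateElliptic lam Lam p F (cylDomain U T₁ T₂))
    (hu : IsViscositySupersolution F U T₁ T₂ u) (hpos : ∀ z ∈ cylDomain U T₁ T₂, 0 ≤ u z) :
    IsSuper lam Lam p (cylDomain U T₁ T₂) u := by
  refine ⟨hu.1, hpos, ?_⟩
  intro x t hx τ ξ e A B η hA hB hη H
  let χ : ContDiffBump ((x, t) : Space n × ℝ) := ⟨η / 2, η, by positivity, by linarith⟩
  set Φ := quad (u (x, t)) τ A B t x ξ e with hΦ
  have heq : (fun z => χ z * Φ z) =ᶠ[𝓝 (x, t)] Φ := by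
    filter_upwards [χ.eventuallyEq_one] with z hz
    rw [hz]
    simp
  have hsm : ContDiff ℝ 2 (fun z => χ z * Φ z) :=
    χ.contDiff.mul (contDiff_quad _ _ _ _ _ _ _ _)
  have key := hu.2 (fun z => χ z * Φ z) hsm.contDiffOn (x, t) hx ⟨?_, ?_⟩
  · rw [timeDeriv_congr heq, spaceGrad_congr heq, spaceHess_congr heq, hΦ, spaceGrad_quad,
      spaceHess_quad, timeDeriv_quad _ _ _ _ _ _ _ _ hx.2] at key
    have := le_of_isDegenerateElliptic hF hx ξ e hA hB
    simp only at this
    linarith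
  · intro z hz hzt
    simp only at hzt
    by_cases hd : dist z (x, t) < η
    · rw [Prod.dist_eq, max_lt_iff, dist_eq_norm, Real.dist_eq] at hd
      have hs : t - z.2 < η := by
        have := neg_abs_le (z.2 - t)
        have := hd.2
        simp only at this
        linarith
      have := H (z.1 - x) (t - z.2) hd.1 (by linarith) hs
      have hq : Φ z ≤ u z := by
        have e1 : (x + (z.1 - x), t - (t - z.2)) = z := by
          ext <;> simp
        rw [e1] at this
        rw [hΦ, quad]
        linarith
      rcases le_total 0 (Φ z) with h0 | h0
      · calc χ z * Φ z ≤ 1 * Φ z := by gcongr; exact χ.le_one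
          _ ≤ u z := by linarith
      · calc χ z * Φ z ≤ 0 := mul_nonpos_of_nonneg_of_nonpos χ.nonneg h0
          _ ≤ u z := hpos z hz
    · have : χ z = 0 := χ.zero_of_le_dist (not_lt.1 hd)
      simp only [this, zero_mul]
      exact hpos z hz
  · refine heq.eq_of_nhds.trans ?_
    simp [hΦ, quad]

/-- The intrinsic scaling of the equation. -/
theorem IsSuper.comp_scale {n : ℕ} {lam Lam p : ℝ} {S S' : Set (Space n × ℝ)}
    {v : Space n × ℝ → ℝ} (hv : IsSuper lam Lam p S v) (x₀ : Space n) (t₀ : ℝ) {k ρ σ : ℝ}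
    (hk : 0 < k) (hρ : 0 < ρ) (hσ : σ = k ^ (p - 2) * ρ ^ p)
    (hS : ∀ z ∈ S', (x₀ + ρ • z.1, t₀ + σ * z.2) ∈ S) :
    IsSuper lam Lam p S' (fun z => k * v (x₀ + ρ • z.1, t₀ + σ * z.2)) := by
  have hσ0 : 0 < σ := by rw [hσ]; positivity
  refine ⟨?_, fun z hz => mul_nonneg hk.le (hv.nonneg _ (hS z hz)), ?_⟩
  · intro z hz y hy
    have hy' : y / k < v (x₀ + ρ • z.1, t₀ + σ * z.2) := by
      rw [div_lt_iff₀ hk]; linarith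
    have h1 := hv.lsc _ (hS z hz) _ hy'
    have h2 : Tendsto (fun z : Space n × ℝ => (x₀ + ρ • z.1, t₀ + σ * z.2)) (𝓝[S'] z)
        (𝓝[S] (x₀ + ρ • z.1, t₀ + σ * z.2)) := by
      apply tendsto_nhdsWithin_of_tendsto_nhds_of_eventually_within
      · apply Tendsto.mono_left _ nhdsWithin_le_nhds
        exact Continuous.tendsto (by fun_prop) z
      · filter_upwards [self_mem_nhdsWithin] with w hw using hS w hw
    filter_upwards [h2.eventually h1] with w hw
    have := (div_lt_iff₀ hk).1 hw
    change y < _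
    linarith
  · intro x t hx τ ξ e A B η hA hB hη H
    have hη' : 0 < min (ρ * η) (σ * η) := by positivity
    -- These are the coefficients of the polynomial in the original variables. The powers of `k` and
    -- `ρ` produced by them cancel precisely because `σ = k ^ (p - 2) * ρ ^ p`.
    have key := hv.test _ _ (hS _ hx) (τ / (k * σ)) ((1 / (k * ρ)) • ξ) ((1 / ρ) • e) (A / (k * ρ ^ 2))
      (B / k) _ (by positivity) (by positivity) hη' ?_
    · simp only [norm_smul, Real.norm_eq_abs, abs_of_pos hk, abs_of_pos hρ, abs_mul, abs_div,
        abs_one] at key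
      rw [le_div_iff₀ (by positivity)] at key
      refine le_trans (le_of_eq ?_) key
      rw [Real.mul_rpow (by positivity) (norm_nonneg _), Real.div_rpow zero_le_one (by positivity),
        Real.one_rpow, Real.mul_rpow hk.le hρ.le, hσ]
      have e1 : ρ ^ p = ρ ^ (p - 2) * ρ ^ 2 := by
        rw [← Real.rpow_natCast, ← Real.rpow_add hρ]; norm_num
      have e2 : k ^ (p - 2) ≠ 0 := (Real.rpow_pos_of_pos hk _).ne'
      have e3 : ρ ^ (p - 2) ≠ 0 := (Real.rpow_pos_of_pos hρ _).ne'
      rw [e1]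
      field_simp
    · intro h s hh hs0 hs
      have := H ((1 / ρ) • h) (s / σ) ?_ (by positivity) ?_
      · have e1 : x₀ + ρ • (x + (1 / ρ) • h) = x₀ + ρ • x + h := by
          rw [smul_add, smul_smul, mul_one_div_cancel hρ.ne', one_smul, add_assoc]
        have e2 : t₀ + σ * (t - s / σ) = t₀ + σ * t - s := by
          field_simp; ring
        simp only [e1, e2, inner_smul_right, norm_smul, Real.norm_eq_abs, abs_div, abs_one,
          abs_of_pos hρ] at this
        simp only [inner_smul_left]
        simp only [RCLike.conj_to_real]
        have h3 := div_le_div_of_nonneg_right this hk.le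
        rw [mul_div_cancel_left₀ _ hk.ne'] at h3
        refine le_trans (le_of_eq ?_) h3
        field_simp
      · rw [norm_smul, Real.norm_eq_abs, abs_div, abs_one, abs_of_pos hρ, one_div,
          inv_mul_lt_iff₀ hρ]
        exact lt_of_lt_of_le hh (min_le_left _ _)
      · rw [div_lt_iff₀ hσ0, mul_comm]
        exact lt_of_lt_of_le hs (min_le_right _ _)

/-- On a compact set, the difference of `v` and a continuous function attains its minimum. -/
theorem exists_min_sub {n : ℕ} {K : Set (Space n × ℝ)} {v ψ : Space n × ℝ → ℝ}
    (hK : IsCompact K) (hne : K.Nonempty) (hv : LowerSemicontinuousOn v K) (hψ : ContinuousOn ψ K) :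
    ∃ z ∈ K, ∀ w ∈ K, v z - ψ z ≤ v w - ψ w := by
  have h1 : LowerSemicontinuousOn (fun z => v z + (-ψ) z) K :=
    hv.add hψ.neg.lowerSemicontinuousOn
  obtain ⟨z, hz, hmin⟩ := h1.exists_isMinOn hne hK
  refine ⟨z, hz, fun w hw => ?_⟩
  have := hmin hw
  simpa [sub_eq_add_neg] using this

/-! ### Convexity and concavity of powers of the norm -/

section PowerInequalities

theorem rpow_le_tangent {θ a s : ℝ} (h0 : 0 ≤ θ) (h1 : θ ≤ 1) (ha : 0 < a) (hs : 0 ≤ s) :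
    s ^ θ ≤ a ^ θ + θ * a ^ (θ - 1) * (s - a) := by
  have h := rpow_one_add_le_one_add_mul_self (s := s / a - 1)
    (by have : 0 ≤ s / a := by positivity
        linarith) h0 h1
  rw [add_sub_cancel, Real.div_rpow hs ha.le] at h
  have ha' : 0 < a ^ θ := Real.rpow_pos_of_pos ha θ
  rw [div_le_iff₀ ha'] at h
  refine h.trans (le_of_eq ?_)
  rw [Real.rpow_sub_one ha.ne']
  field_simp

theorem tangent_le_rpow {θ a s : ℝ} (h1 : 1 ≤ θ) (ha : 0 < a) (hs : 0 ≤ s) :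
    a ^ θ + θ * a ^ (θ - 1) * (s - a) ≤ s ^ θ := by
  have h := one_add_mul_self_le_rpow_one_add (s := s / a - 1)
    (by have : 0 ≤ s / a := by positivity
        linarith) h1
  rw [add_sub_cancel, Real.div_rpow hs ha.le] at h
  have ha' : 0 < a ^ θ := Real.rpow_pos_of_pos ha θ
  rw [le_div_iff₀ ha'] at h
  refine (le_of_eq ?_).trans h
  rw [Real.rpow_sub_one ha.ne']
  field_simp

theorem norm_rpow_eq {E : Type*} [NormedAddCommGroup E] (q : ℝ) (w : E) : ‖w‖ ^ q = (‖w‖ ^ 2) ^ (q / 2) := by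
  rw [← Real.rpow_natCast, ← Real.rpow_mul (norm_nonneg _)]
  congr 1
  push_cast
  ring

variable {E : Type*} [NormedAddCommGroup E] [InnerProductSpace ℝ E]

/-- Concavity of `s ↦ s^(q/2)`, applied to the squared norm, gives an upper bound that is exactly
quadratic in `h` and holds for all `h`. A negative cusp is therefore touched from below by a
paraboloid with no remainder. The shift by `δ` includes the vertex. -/
theorem norm_add_sq_rpow_le {q δ : ℝ} (h0 : 0 ≤ q) (h2 : q ≤ 2) (hδ : 0 ≤ δ) (w h : E)
    (hw : 0 < ‖w‖ ^ 2 + δ) :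
    (‖w + h‖ ^ 2 + δ) ^ (q / 2) ≤ (‖w‖ ^ 2 + δ) ^ (q / 2)
      + q / 2 * (‖w‖ ^ 2 + δ) ^ (q / 2 - 1) * (2 * inner ℝ w h + ‖h‖ ^ 2) := by
  refine (rpow_le_tangent (θ := q / 2) (by linarith) (by linarith) hw
    (by positivity)).trans (le_of_eq ?_)
  rw [norm_add_sq_real]
  ring

theorem norm_add_rpow_le {q : ℝ} (h0 : 0 ≤ q) (h2 : q ≤ 2) {w : E} (hw : w ≠ 0) (h : E) :
    ‖w + h‖ ^ q ≤ ‖w‖ ^ q + q * ‖w‖ ^ (q - 2) * inner ℝ w h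
      + q / 2 * ‖w‖ ^ (q - 2) * ‖h‖ ^ 2 := by
  have hw' : 0 < ‖w‖ := norm_pos_iff.2 hw
  have := norm_add_sq_rpow_le h0 h2 le_rfl w h (by positivity)
  rw [norm_rpow_eq q (w + h), norm_rpow_eq q w, norm_rpow_eq (q - 2) w]
  simp only [add_zero] at this
  rw [show (q - 2) / 2 = q / 2 - 1 by ring]
  linarith

/-- The tangent inequality for `t ↦ t^q` is combined with Cauchy-Schwarz, which bounds the increment
of the norm from below. -/
theorem le_norm_add_rpow {q : ℝ} (h1 : 1 ≤ q) {w : E} (hw : w ≠ 0) (h : E) :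
    ‖w‖ ^ q + q * ‖w‖ ^ (q - 2) * inner ℝ w h ≤ ‖w + h‖ ^ q := by
  have hw' : 0 < ‖w‖ := norm_pos_iff.2 hw
  refine le_trans ?_ (tangent_le_rpow h1 hw' (norm_nonneg (w + h)))
  have h3 : inner ℝ w h ≤ ‖w‖ * (‖w + h‖ - ‖w‖) := by
    have := real_inner_le_norm w (w + h)
    rw [inner_add_right, real_inner_self_eq_norm_sq] at this
    nlinarith
  have h4 : ‖w‖ ^ (q - 1) = ‖w‖ ^ (q - 2) * ‖w‖ := by
    rw [← Real.rpow_add_one hw'.ne']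
    congr 1
    ring
  rw [h4]
  have h5 : 0 < ‖w‖ ^ (q - 2) := Real.rpow_pos_of_pos hw' _
  have h6 := mul_le_mul_of_nonneg_left h3 (by positivity : 0 ≤ q * ‖w‖ ^ (q - 2))
  nlinarith

end PowerInequalities

/-! ### Cusps: propagation in time and lifting by a kink -/

/-- The exponent dual to `p`: the profile `-|x|^(p/(p-1))` has a bounded `p`-Laplacian. -/
def dualExp (p : ℝ) : ℝ := p / (p - 1)

section DualExp

variable {p : ℝ}

theorem one_lt_dualExp (hp : 2 < p) : 1 < dualExp p := by
  rw [dualExp, one_lt_div (by linarith)]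
  linarith

theorem dualExp_lt_two (hp : 2 < p) : dualExp p < 2 := by
  rw [dualExp, div_lt_iff₀ (by linarith)]
  linarith

/-- At distance `ρ` from its vertex a cusp has gradient of order `ρ^(q-1)` and curvature of order
`ρ^(q-2)`. This identity makes the product of the curvature with the `(p-2)`-th power of the
gradient independent of `ρ`. -/
theorem dualExp_mul (hp : 2 < p) : (dualExp p - 1) * (p - 2) = 2 - dualExp p := by
  rw [dualExp]
  have : p - 1 ≠ 0 := by linarith
  field_simp
  ring

end DualExp

/-- The Lipschitz constant in time of the contact profiles. -/
def timeConst (n : ℕ) (Lam p : ℝ) : ℝ := n * Lam * dualExp p ^ (p - 1) + 1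

theorem one_le_timeConst {n : ℕ} {Lam p : ℝ} (hp : 2 < p) (hLam : 0 ≤ Lam) :
    1 ≤ timeConst n Lam p := by
  have := one_lt_dualExp hp
  have : 0 ≤ n * Lam * dualExp p ^ (p - 1) := by positivity
  unfold timeConst
  linarith

/-- A cusp below `v` at some time stays below `v` when it is lowered at a fixed speed. -/
theorem IsSuper.propagate_cusp {n : ℕ} {lam Lam p : ℝ} (hp : 2 < p) (hLam : 0 ≤ Lam)
    {S : Set (Space n × ℝ)} {v : Space n × ℝ → ℝ} (hv : IsSuper lam Lam p S v)
    {y : Space n} {b t₁ t₂ : ℝ} (hS : Metric.closedBall 0 1 ×ˢ Icc t₁ t₂ ⊆ S)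
    (h1 : ∀ x ∈ Metric.closedBall 0 1, b - ‖x - y‖ ^ dualExp p ≤ v (x, t₁))
    (hb : ∀ x : Space n, ‖x‖ = 1 → b ≤ ‖x - y‖ ^ dualExp p)
    {x : Space n} (hx : x ∈ Metric.closedBall 0 1) {t : ℝ} (ht : t ∈ Icc t₁ t₂) :
    b - ‖x - y‖ ^ dualExp p - timeConst n Lam p * (t - t₁) ≤ v (x, t) := by
  set q := dualExp p with hq
  set C := timeConst n Lam p with hC
  have hq1 : 1 < q := one_lt_dualExp hp
  have hq2 : q < 2 := dualExp_lt_two hp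
  have hC1 : 1 ≤ C := one_le_timeConst hp hLam
  have mono : ∀ δ > 0, ∀ w : Space n, ‖w‖ ^ q ≤ (‖w‖ ^ 2 + δ) ^ (q / 2) := by
    intro δ hδ w
    rw [norm_rpow_eq]
    exact Real.rpow_le_rpow (by positivity) (by linarith) (by linarith)
  -- Regularization smooths the vertex and only lowers the cusp. If the claim fails, `v` minus the
  -- descending cusp has a negative minimum. It is not on the lateral boundary, where the cusp is
  -- nonpositive and `v ≥ 0`, nor at the initial time, so the test applies there.
  have key : ∀ δ > 0, b - (‖x - y‖ ^ 2 + δ) ^ (q / 2) - C * (t - t₁) ≤ v (x, t) := by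
    intro δ hδ
    by_contra hcon
    push Not at hcon
    set K : Set (Space n × ℝ) := Metric.closedBall 0 1 ×ˢ Icc t₁ t₂ with hK
    set ψ : Space n × ℝ → ℝ := fun z => b - (‖z.1 - y‖ ^ 2 + δ) ^ (q / 2) - C * (z.2 - t₁) with hψ
    have hψc : Continuous ψ := by
      have : Continuous fun z : Space n × ℝ => (‖z.1 - y‖ ^ 2 + δ) ^ (q / 2) := by
        apply Continuous.rpow_const (by fun_prop)
        intro z
        left
        positivity
      exact (continuous_const.sub this).sub (by fun_prop)
    have hKc : IsCompact K := (isCompact_closedBall _ _).prod isCompact_Icc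
    obtain ⟨⟨x', t'⟩, hz, hmin⟩ := exists_min_sub hKc ⟨(x, t), hx, ht⟩ (hv.lsc.mono hS)
      hψc.continuousOn
    have hneg : v (x', t') < ψ (x', t') := by
      have := hmin (x, t) ⟨hx, ht⟩
      have h2 : v (x, t) < ψ (x, t) := hcon
      linarith
    have hx1 : ‖x'‖ < 1 := by
      have : ‖x'‖ ≤ 1 := by simpa using hz.1
      refine lt_of_le_of_ne this fun h => ?_
      have h2 := hb x' h
      have h3 := mono δ hδ (x' - y)
      have h4 := hv.nonneg _ (hS hz)
      have h5 : 0 ≤ C * (t' - t₁) := mul_nonneg (by linarith) (by linarith [hz.2.1])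
      simp only [hψ] at hneg
      linarith
    have ht1 : t₁ < t' := by
      refine lt_of_le_of_ne hz.2.1 fun h => ?_
      have h2 := h1 x' hz.1
      have h3 := mono δ hδ (x' - y)
      simp only [hψ, ← h] at hneg
      simp only [sub_self, mul_zero] at hneg
      linarith
    set w := x' - y with hw
    set s := ‖w‖ ^ 2 + δ with hs
    have hs0 : 0 < s := by positivity
    have test := hv.test x' t' (hS hz) (-C) (-(q * s ^ (q / 2 - 1)) • w) 0
      (q / 2 * s ^ (q / 2 - 1)) 0 (min (1 - ‖x'‖) (t' - t₁)) (by positivity) le_rfl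
      (lt_min (by linarith) (by linarith)) ?_
    · have h6 : ‖-(q * s ^ (q / 2 - 1)) • w‖ ≤ q * s ^ ((q - 1) / 2) := by
        rw [norm_smul, Real.norm_eq_abs, abs_neg, abs_of_pos (by positivity)]
        have h7 : ‖w‖ ≤ s ^ ((1 : ℝ) / 2) := by
          rw [← Real.sqrt_eq_rpow]
          apply Real.le_sqrt_of_sq_le
          linarith
        calc q * s ^ (q / 2 - 1) * ‖w‖ ≤ q * s ^ (q / 2 - 1) * s ^ ((1 : ℝ) / 2) := by gcongr
          _ = q * s ^ ((q - 1) / 2) := by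
            rw [mul_assoc, ← Real.rpow_add hs0]
            congr 2
            ring
      have h8 : ‖-(q * s ^ (q / 2 - 1)) • w‖ ^ (p - 2) ≤ q ^ (p - 2) * s ^ (1 - q / 2) := by
        calc _ ≤ (q * s ^ ((q - 1) / 2)) ^ (p - 2) :=
              Real.rpow_le_rpow (norm_nonneg _) h6 (by linarith)
          _ = _ := by
            rw [Real.mul_rpow (by positivity) (by positivity), ← Real.rpow_mul hs0.le]
            congr 2
            have := dualExp_mul hp
            rw [← hq] at this
            linarith
      have h9 : ‖-(q * s ^ (q / 2 - 1)) • w‖ ^ (p - 2) * s ^ (q / 2 - 1) ≤ q ^ (p - 2) := by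
        calc _ ≤ q ^ (p - 2) * s ^ (1 - q / 2) * s ^ (q / 2 - 1) := by gcongr
          _ = q ^ (p - 2) := by
            rw [mul_assoc, ← Real.rpow_add hs0]
            simp
      have h10 : q ^ (p - 1) = q ^ (p - 2) * q := by
        rw [← Real.rpow_add_one (by positivity)]
        congr 1
        ring
      have h11 : ‖-(q * s ^ (q / 2 - 1)) • w‖ ^ (p - 2) * s ^ (q / 2 - 1) * (n * Lam * q)
          ≤ q ^ (p - 2) * (n * Lam * q) := mul_le_mul_of_nonneg_right h9 (by positivity)
      have h12 : C = n * Lam * (q ^ (p - 2) * q) + 1 := by rw [hC, timeConst, ← hq, h10]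
      -- The cusp uses up all of `timeConst` except the summand `1`, which makes the contradiction
      -- strict.
      rw [h12] at test
      simp only [norm_zero] at test
      nlinarith
    · intro h r hh hr0 hr
      have hmem : (x' + h, t' - r) ∈ K := by
        refine ⟨?_, ?_, ?_⟩
        · rw [mem_closedBall_zero_iff]
          have := lt_of_lt_of_le hh (min_le_left _ _)
          have := norm_add_le x' h
          linarith
        · have := lt_of_lt_of_le hr (min_le_right _ _)
          linarith
        · have := hz.2.2
          simp only at this
          linarith
      have h2 := hmin _ hmem
      have h3 := norm_add_sq_rpow_le (by linarith : 0 ≤ q) hq2.le hδ.le w h hs0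
      simp only [hψ] at h2
      have e1 : x' + h - y = w + h := by rw [hw]; abel
      rw [e1] at h2
      simp only [inner_smul_left, inner_zero_left, RCLike.conj_to_real]
      nlinarith
  have hlim : Tendsto (fun δ : ℝ => b - (‖x - y‖ ^ 2 + δ) ^ (q / 2) - C * (t - t₁)) (𝓝[>] 0)
      (𝓝 (b - (‖x - y‖ ^ 2 + 0) ^ (q / 2) - C * (t - t₁))) := by
    apply Tendsto.mono_left _ nhdsWithin_le_nhds
    have hc : Continuous fun δ : ℝ => (‖x - y‖ ^ 2 + δ) ^ (q / 2) :=
      Continuous.rpow_const (by fun_prop) fun _ => Or.inr (by linarith)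
    exact ((continuous_const.sub hc).sub continuous_const).tendsto 0
  have := le_of_tendsto hlim (by filter_upwards [self_mem_nhdsWithin] with δ hδ using key δ hδ)
  rwa [add_zero, ← norm_rpow_eq] at this

set_option maxHeartbeats 1000000 in
/-- A supersolution that lies above a cusp with a convex kink of slope `s` lies strictly above the
cusp at the centre after the diffusion time of the kink. -/
theorem IsSuper.kink {n : ℕ} {lam Lam p : ℝ} (hn : 1 ≤ n) (hp : 2 < p) (hlam : 0 < lam)
    (hLam : lam ≤ Lam) {S : Set (Space n × ℝ)} {v : Space n × ℝ → ℝ}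
    (hv : IsSuper lam Lam p S v) {x₁ y₁ e : Space n} {t₁ b s R N τ d : ℝ} (he : ‖e‖ = 1)
    (hd : d = ‖x₁ - y₁‖) (hd0 : 0 < d) (hR : 0 < R) (hN0 : 0 < N)
    (hN : N ^ 2 = 4 * n * Lam / lam) (hNR : N * R ≤ d / 4)
    (hs1 : 32 * n * Lam / lam * R * d ^ (dualExp p - 2) ≤ s)
    (hs2 : s ≤ d ^ (dualExp p - 1) / 8)
    (hτ : τ = 2 ^ (p - 1) * R ^ 2 * d ^ (dualExp p - 2) / lam)
    (hS : Metric.closedBall x₁ (N * R) ×ˢ Icc (t₁ - τ) t₁ ⊆ S)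
    (hlow : ∀ x ∈ Metric.closedBall x₁ (N * R), ∀ t ∈ Icc (t₁ - τ) t₁,
      b - ‖x - y₁‖ ^ dualExp p + s * max 0 (inner ℝ e (x - x₁)) - s * R / 8 ≤ v (x, t)) :
    b - ‖x₁ - y₁‖ ^ dualExp p + s * R / 8 ≤ v (x₁, t₁) := by
  set q := dualExp p with hq
  have hq1 : 1 < q := one_lt_dualExp hp
  have hq2 : q < 2 := dualExp_lt_two hp
  have hLam0 : 0 < Lam := by linarith
  have hn0 : (1 : ℝ) ≤ n := by exact_mod_cast hn
  have hdq : 0 < d ^ (q - 2) := Real.rpow_pos_of_pos hd0 _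
  have hs0 : 0 < s := lt_of_lt_of_le (by positivity) hs1
  have hτ0 : 0 < τ := by rw [hτ]; positivity
  have hN2 : 2 ≤ N := by
    have h4 : 4 ≤ N ^ 2 := by
      rw [hN, le_div_iff₀ hlam]
      nlinarith
    nlinarith
  -- The isotropic correction then costs one quarter of the gain `2 * lam * (s / (4 * R))` from the
  -- convex direction, while `ε * N ^ 2 = 1 / 4` is just enough to close the lateral boundary `‖x -
  -- x₁‖ = N * R`.
  set ε := lam / (16 * n * Lam) with hε
  have hε0 : 0 < ε := by positivity
  have hεN : ε * N ^ 2 = 1 / 4 := by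
    rw [hε, hN]
    field_simp
    norm_num
  by_contra hcon
  push Not at hcon
  -- The kink `max 0 σ` is replaced on `|σ| ≤ R` by the parabola `(σ + R)² / (4R)`, which agrees
  -- with it at `σ = ±R` and exceeds it by at most `R / 4`. Each penalty equals `R / 4` on its own
  -- part of the boundary, so `v ≥ ψ` there. At the centre `ψ` exceeds the cusp by `s * R / 8`, and
  -- a failure forces an interior negative minimum of `v - ψ`.
  set ψ : Space n × ℝ → ℝ := fun z => b - ‖z.1 - y₁‖ ^ q
    + s * ((inner ℝ e (z.1 - x₁) + R) ^ 2 / (4 * R) - ε * ‖z.1 - x₁‖ ^ 2 / R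
      - R / 4 * (t₁ - z.2) / τ - R / 8) with hψ
  set K : Set (Space n × ℝ) :=
    (Metric.closedBall x₁ (N * R) ∩ {x | |inner ℝ e (x - x₁)| ≤ R}) ×ˢ Icc (t₁ - τ) t₁ with hK
  have hKS : K ⊆ Metric.closedBall x₁ (N * R) ×ˢ Icc (t₁ - τ) t₁ :=
    prod_mono inter_subset_left le_rfl
  have hKc : IsCompact K := by
    refine IsCompact.prod (IsCompact.inter_right (isCompact_closedBall _ _) ?_) isCompact_Icc
    exact isClosed_le (by fun_prop) continuous_const
  have hψc : Continuous ψ := by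
    have : Continuous fun z : Space n × ℝ => ‖z.1 - y₁‖ ^ q :=
      Continuous.rpow_const (by fun_prop) fun _ => Or.inr (by linarith)
    refine (continuous_const.sub this).add ?_
    fun_prop
  have hx₁K : (x₁, t₁) ∈ K := by
    refine ⟨⟨Metric.mem_closedBall_self (by positivity), ?_⟩, by linarith, le_rfl⟩
    simp [hR.le]
  obtain ⟨⟨x', t'⟩, hz, hmin⟩ := exists_min_sub hKc ⟨_, hx₁K⟩ (hv.lsc.mono (hKS.trans hS))
    hψc.continuousOn
  have hneg : v (x', t') < ψ (x', t') := by
    have h1 := hmin _ hx₁K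
    have h2 : ψ (x₁, t₁) = b - ‖x₁ - y₁‖ ^ q + s * R / 8 := by
      simp only [hψ, sub_self, inner_zero_right, norm_zero]
      field_simp
      ring
    linarith
  have hlow' := hlow x' (hKS hz).1 t' hz.2
  set k := x' - x₁ with hk
  set σ := inner ℝ e k with hσ
  have hσR : |σ| ≤ R := hz.1.2
  obtain ⟨hσ1, hσ2⟩ := abs_le.1 hσR
  have hlt : max 0 σ < (σ + R) ^ 2 / (4 * R) - ε * ‖k‖ ^ 2 / R - R / 4 * (t₁ - t') / τ := by
    have h1 : s * max 0 σ < s * ((σ + R) ^ 2 / (4 * R) - ε * ‖k‖ ^ 2 / R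
        - R / 4 * (t₁ - t') / τ) := by
      simp only [hψ] at hneg
      linarith
    exact lt_of_mul_lt_mul_left h1 hs0.le
  have hp1 : 0 ≤ ε * ‖k‖ ^ 2 / R := by positivity
  have hp2 : 0 ≤ R / 4 * (t₁ - t') / τ := by
    have : 0 ≤ t₁ - t' := by linarith [hz.2.2]
    positivity
  have hsq : (σ + R) ^ 2 / (4 * R) ≤ max 0 σ + R / 4 := by
    rw [div_le_iff₀ (by positivity)]
    rcases le_total 0 σ with h | h
    · rw [max_eq_right h]; nlinarith
    · rw [max_eq_left h]; nlinarith
  have hσlt : |σ| < R := by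
    refine lt_of_le_of_ne hσR fun h => ?_
    have : (σ + R) ^ 2 / (4 * R) = max 0 σ := by
      rcases abs_eq hR.le |>.1 h with h | h
      · rw [h, max_eq_right hR.le]; field_simp; norm_num
      · rw [h, max_eq_left (by linarith)]; simp
    linarith
  have hkN : ‖k‖ < N * R := by
    have h1 : ‖k‖ ≤ N * R := by
      have := (hKS hz).1
      rwa [Metric.mem_closedBall, dist_eq_norm] at this
    refine lt_of_le_of_ne h1 fun h => ?_
    have : ε * ‖k‖ ^ 2 / R = R / 4 := by
      rw [h, mul_pow, ← mul_assoc, hεN]; field_simp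
    linarith
  have htlt : t₁ - τ < t' := by
    refine lt_of_le_of_ne hz.2.1 fun h => ?_
    have : R / 4 * (t₁ - t') / τ = R / 4 := by
      rw [← h]; simp only [sub_sub_cancel]; field_simp
    linarith
  set w := x' - y₁ with hw
  set ρ := ‖w‖ with hρ
  have hwk : w = (x₁ - y₁) + k := by rw [hw, hk]; abel
  have hρ1 : 3 / 4 * d ≤ ρ := by
    have : d ≤ ρ + ‖k‖ := by
      rw [hd, hρ, show x₁ - y₁ = w - k by rw [hwk]; abel]
      exact norm_sub_le _ _
    linarith
  have hρ0 : 0 < ρ := by linarith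
  have hw0 : w ≠ 0 := norm_pos_iff.1 hρ0
  set A := q / 2 * ρ ^ (q - 2) + s * ε / R with hA
  set ξ : Space n := -(q * ρ ^ (q - 2)) • w + (s * ((σ + R) / (2 * R))) • e
    - (2 * s * ε / R) • k with hξ
  set η := min (N * R - ‖k‖) (min (R - |σ|) (t' - (t₁ - τ))) with hη
  have hη0 : 0 < η := lt_min (by linarith) (lt_min (by linarith) (by linarith))
  have test := hv.test x' t' (hS (hKS hz)) (s * R / (4 * τ)) ξ e A (s / (4 * R)) η
    (by positivity) (by positivity) hη0 ?_
  · have hρq : ρ ^ (q - 2) ≤ 2 * d ^ (q - 2) := by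
      calc ρ ^ (q - 2) ≤ (3 / 4 * d) ^ (q - 2) :=
            Real.rpow_le_rpow_of_nonpos (by positivity) hρ1 (by linarith)
        _ = (3 / 4) ^ (q - 2) * d ^ (q - 2) := Real.mul_rpow (by norm_num) hd0.le
        _ ≤ 2 * d ^ (q - 2) := by
          gcongr
          calc (3 / 4 : ℝ) ^ (q - 2) ≤ (3 / 4 : ℝ) ^ (-1 : ℝ) :=
                Real.rpow_le_rpow_of_exponent_ge (by norm_num) (by norm_num) (by linarith)
            _ ≤ 2 := by rw [Real.rpow_neg_one]; norm_num
    have hρq1 : 3 / 4 * d ^ (q - 1) ≤ ρ ^ (q - 1) := by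
      calc 3 / 4 * d ^ (q - 1) ≤ (3 / 4) ^ (q - 1) * d ^ (q - 1) := by
            gcongr
            calc (3 / 4 : ℝ) = (3 / 4 : ℝ) ^ (1 : ℝ) := (Real.rpow_one _).symm
              _ ≤ _ := Real.rpow_le_rpow_of_exponent_ge (by norm_num) (by norm_num) (by linarith)
        _ = (3 / 4 * d) ^ (q - 1) := (Real.mul_rpow (by norm_num) hd0.le).symm
        _ ≤ ρ ^ (q - 1) := Real.rpow_le_rpow (by positivity) hρ1 (by linarith)
    -- The cusp contributes slope at least `3/4 * d^(q-1)`. The parabola and the lateral penalty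
    -- contribute at most `s ≤ d^(q-1) / 8` each, so the equation stays nondegenerate.
    have hnorm : d ^ (q - 1) / 2 ≤ ‖ξ‖ := by
      have h1 : ‖-(q * ρ ^ (q - 2)) • w‖ = q * ρ ^ (q - 1) := by
        rw [norm_smul, Real.norm_eq_abs, abs_neg, abs_of_pos (by positivity), ← hρ, mul_assoc,
          ← Real.rpow_add_one hρ0.ne']
        congr 2
        ring
      have h2 : ‖(s * ((σ + R) / (2 * R))) • e‖ ≤ s := by
        rw [norm_smul, he, mul_one, Real.norm_eq_abs, abs_of_nonneg]
        · calc s * ((σ + R) / (2 * R)) ≤ s * 1 := by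
                gcongr
                rw [div_le_one (by positivity)]
                linarith
            _ = s := mul_one s
        · have : 0 ≤ σ + R := by linarith
          positivity
      have h3 : ‖(2 * s * ε / R) • k‖ ≤ s := by
        rw [norm_smul, Real.norm_eq_abs, abs_of_pos (by positivity)]
        have hεN' : ε * N ≤ 1 / 8 := by nlinarith
        calc 2 * s * ε / R * ‖k‖ ≤ 2 * s * ε / R * (N * R) := by gcongr
          _ = 2 * s * (ε * N) := by field_simp
          _ ≤ 2 * s * (1 / 8) := by gcongr
          _ ≤ s := by linarith
      have h4 : -(q * ρ ^ (q - 2)) • w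
          = ξ - (s * ((σ + R) / (2 * R))) • e + (2 * s * ε / R) • k := by
        rw [hξ]; abel
      have h5 : q * ρ ^ (q - 1) ≤ ‖ξ‖ + s + s := by
        rw [← h1, h4]
        refine (norm_add_le _ _).trans (add_le_add ((norm_sub_le _ _).trans ?_) h3)
        linarith
      have h6 : ρ ^ (q - 1) ≤ q * ρ ^ (q - 1) := le_mul_of_one_le_left (by positivity) hq1.le
      linarith
    have hpow : d ^ (2 - q) / 2 ^ (p - 2) ≤ ‖ξ‖ ^ (p - 2) := by
      calc d ^ (2 - q) / 2 ^ (p - 2) = (d ^ (q - 1) / 2) ^ (p - 2) := by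
            rw [Real.div_rpow (by positivity) (by norm_num), ← Real.rpow_mul hd0.le,
              dualExp_mul hp]
        _ ≤ _ := Real.rpow_le_rpow (by positivity) hnorm (by linarith)
    have hbr : lam * s / (4 * R) ≤ 2 * lam * (s / (4 * R)) * ‖e‖ ^ 2 - 2 * n * Lam * A := by
      have h1 : 2 * n * Lam * (s * ε / R) = lam * s / (8 * R) := by
        rw [hε]; field_simp; norm_num
      have h2 : 2 * n * Lam * (q / 2 * ρ ^ (q - 2)) ≤ lam * s / (8 * R) := by
        rw [le_div_iff₀ (by positivity)]
        have h3 : 32 * n * Lam * R * d ^ (q - 2) ≤ lam * s := by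
          have := mul_le_mul_of_nonneg_left hs1 hlam.le
          refine le_trans (le_of_eq ?_) this
          field_simp
        calc 2 * n * Lam * (q / 2 * ρ ^ (q - 2)) * (8 * R)
            ≤ 2 * n * Lam * (2 / 2 * (2 * d ^ (q - 2))) * (8 * R) := by gcongr
          _ = 32 * n * Lam * R * d ^ (q - 2) := by ring
          _ ≤ lam * s := h3
      rw [he, hA]
      have h4 : 2 * lam * (s / (4 * R)) * 1 ^ 2 = lam * s / (8 * R) * 4 := by field_simp; norm_num
      have h5 : lam * s / (4 * R) = lam * s / (8 * R) * 2 := by field_simp; norm_num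
      rw [h4, h5, mul_add, h1]
      linarith
    have hfin : d ^ (2 - q) / 2 ^ (p - 2) * (lam * s / (4 * R)) ≤ s * R / (4 * τ) :=
      (mul_le_mul hpow hbr (by positivity) (by positivity)).trans test
    have h2p : (2 : ℝ) ^ (p - 1) = 2 ^ (p - 2) * 2 := by
      rw [← Real.rpow_add_one (by norm_num)]
      congr 1
      ring
    have hdd : d ^ (2 - q) = (d ^ (q - 2))⁻¹ := by
      rw [← Real.rpow_neg hd0.le]
      congr 1
      ring
    have h2p0 : (0 : ℝ) < 2 ^ (p - 2) := by positivity
    -- `τ` is twice the time at which diffusion and the time penalty would balance, whence the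
    -- contradictory factor `2`.
    have hval : d ^ (2 - q) / 2 ^ (p - 2) * (lam * s / (4 * R)) = 2 * (s * R / (4 * τ)) := by
      rw [hτ, h2p, hdd]
      field_simp
    have : 0 < s * R / (4 * τ) := by positivity
    linarith
  · intro h r hh hr0 hr
    have hb1 := lt_of_lt_of_le hh (min_le_left _ _)
    have hb2 := lt_of_lt_of_le hh ((min_le_right _ _).trans (min_le_left _ _))
    have hb3 := lt_of_lt_of_le hr ((min_le_right _ _).trans (min_le_right _ _))
    have e2 : x' + h - x₁ = k + h := by rw [hk]; abel
    have hmem : (x' + h, t' - r) ∈ K := by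
      refine ⟨⟨?_, ?_⟩, ?_, ?_⟩
      · rw [Metric.mem_closedBall, dist_eq_norm, e2]
        have := norm_add_le k h
        linarith
      · have h1 : |inner ℝ e h| ≤ ‖h‖ := by
          have := abs_real_inner_le_norm e h
          rwa [he, one_mul] at this
        have h2 := abs_add_le σ (inner ℝ e h)
        change |inner ℝ e (x' + h - x₁)| ≤ R
        rw [e2, inner_add_right]
        linarith
      · simp only; linarith
      · have := hz.2.2
        simp only at this ⊢
        linarith
    have h2 := hmin _ hmem
    have h3 := norm_add_rpow_le (by linarith : 0 ≤ q) hq2.le hw0 h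
    have e1 : x' + h - y₁ = w + h := by rw [hw]; abel
    simp only [hψ, e1, e2, inner_add_right, ← hk, ← hw, ← hσ] at h2
    have e3 : ‖k + h‖ ^ 2 = ‖k‖ ^ 2 + 2 * inner ℝ k h + ‖h‖ ^ 2 := norm_add_sq_real k h
    have e4 : inner ℝ ξ h = -(q * ρ ^ (q - 2) * inner ℝ w h)
        + s * ((σ + R) / (2 * R)) * inner ℝ e h - 2 * s * ε / R * inner ℝ k h := by
      rw [hξ]
      simp only [inner_sub_left, inner_add_left, inner_smul_left, RCLike.conj_to_real]
      ring
    rw [e3] at h2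
    have e5 : s * ((σ + inner ℝ e h + R) ^ 2 / (4 * R)
          - ε * (‖k‖ ^ 2 + 2 * inner ℝ k h + ‖h‖ ^ 2) / R - R / 4 * (t₁ - (t' - r)) / τ - R / 8)
        - s * ((σ + R) ^ 2 / (4 * R) - ε * ‖k‖ ^ 2 / R - R / 4 * (t₁ - t') / τ - R / 8)
        = s * ((σ + R) / (2 * R)) * inner ℝ e h - 2 * s * ε / R * inner ℝ k h
          + s / (4 * R) * inner ℝ e h ^ 2 - s * ε / R * ‖h‖ ^ 2 - s * R / (4 * τ) * r := by
      field_simp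
      ring
    rw [e4, hA]
    linarith

/-! ### The gradient map of a cusp and its inverse -/

section Duality

variable {E : Type*} [NormedAddCommGroup E] [NormedSpace ℝ E]

theorem abs_rpow_sub_rpow_le {m a b D : ℝ} (hm : 0 ≤ m) (ha : 0 ≤ a) (hb : 0 ≤ b) (haD : a ≤ D)
    (hbD : b ≤ D) : |a ^ (m + 1) - b ^ (m + 1)| ≤ (m + 1) * D ^ m * |a - b| := by
  wlog hab : b ≤ a generalizing a b
  · rw [abs_sub_comm, abs_sub_comm a]
    exact this hb ha hbD haD (by linarith)
  rcases ha.eq_or_lt with h | h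
  · have : b = 0 := by linarith
    rw [this, ← h]
    simp
  · have h1 := tangent_le_rpow (θ := m + 1) (by linarith) h hb
    have h2 : b ^ (m + 1) ≤ a ^ (m + 1) := Real.rpow_le_rpow hb hab (by linarith)
    rw [abs_of_nonneg (by linarith), abs_of_nonneg (by linarith)]
    rw [add_sub_cancel_right] at h1
    have h3 : a ^ m ≤ D ^ m := Real.rpow_le_rpow ha haD hm
    have h4 : (m + 1) * a ^ m * (a - b) ≤ (m + 1) * D ^ m * (a - b) := by
      have : 0 ≤ a - b := by linarith
      gcongr
    nlinarith

/-- For `m < 1` the power `t^m` is not Lipschitz at `0`. Hence the difference of the powers is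
estimated only after multiplication by the norm, through `t^(m+1)`. -/
theorem norm_rpow_smul_sub_le {m D : ℝ} (hm : 0 ≤ m) {a b : E} (ha : ‖a‖ ≤ D) (hb : ‖b‖ ≤ D) :
    ‖‖a‖ ^ m • a - ‖b‖ ^ m • b‖ ≤ (m + 3) * D ^ m * ‖a - b‖ := by
  have hD : 0 ≤ D := (norm_nonneg a).trans ha
  have h0 : ‖a‖ ^ m • a - ‖b‖ ^ m • b = ‖a‖ ^ m • (a - b) + (‖a‖ ^ m - ‖b‖ ^ m) • b := by
    rw [smul_sub, sub_smul]; abel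
  have h1 : ‖a‖ ^ m ≤ D ^ m := Real.rpow_le_rpow (norm_nonneg _) ha hm
  have h2 : |‖a‖ - ‖b‖| ≤ ‖a - b‖ := abs_norm_sub_norm_le a b
  have h3 : ∀ c : ℝ, 0 ≤ c → c ^ (m + 1) = c ^ m * c := fun c hc =>
    Real.rpow_add_one' hc (by linarith)
  have h4 : |‖a‖ ^ m - ‖b‖ ^ m| * ‖b‖ ≤ (m + 2) * D ^ m * ‖a - b‖ := by
    have h5 := abs_rpow_sub_rpow_le hm (norm_nonneg a) (norm_nonneg b) ha hb
    have h6 : (‖a‖ ^ m - ‖b‖ ^ m) * ‖b‖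
        = ‖a‖ ^ m * (‖b‖ - ‖a‖) + (‖a‖ ^ (m + 1) - ‖b‖ ^ (m + 1)) := by
      rw [h3 _ (norm_nonneg a), h3 _ (norm_nonneg b)]; ring
    rw [← abs_of_nonneg (norm_nonneg b), ← abs_mul, abs_of_nonneg (norm_nonneg b), h6]
    refine (abs_add_le _ _).trans ?_
    rw [abs_mul, abs_of_nonneg (by positivity : 0 ≤ ‖a‖ ^ m), abs_sub_comm ‖b‖]
    have h7 : ‖a‖ ^ m * |‖a‖ - ‖b‖| ≤ D ^ m * ‖a - b‖ := by gcongr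
    have h8 : (m + 1) * D ^ m * |‖a‖ - ‖b‖| ≤ (m + 1) * D ^ m * ‖a - b‖ := by gcongr
    linarith
  rw [h0]
  refine (norm_add_le _ _).trans ?_
  rw [norm_smul, norm_smul, Real.norm_eq_abs, Real.norm_eq_abs,
    abs_of_nonneg (by positivity : 0 ≤ ‖a‖ ^ m)]
  have h9 : ‖a‖ ^ m * ‖a - b‖ ≤ D ^ m * ‖a - b‖ := by gcongr
  linarith

/-- The gradient of `|w|^q / q`. -/
def dualMap (p : ℝ) (w : E) : E := ‖w‖ ^ (dualExp p - 2) • w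

theorem norm_dualMap {p : ℝ} (hp : 2 < p) (w : E) : ‖dualMap p w‖ = ‖w‖ ^ (dualExp p - 1) := by
  have hq := one_lt_dualExp hp
  rcases eq_or_ne w 0 with h | h
  · rw [h, dualMap]
    simp only [smul_zero, norm_zero]
    rw [Real.zero_rpow (by linarith)]
  · rw [dualMap, norm_smul, Real.norm_eq_abs, abs_of_nonneg (by positivity),
      ← Real.rpow_add_one (norm_ne_zero_iff.2 h)]
    congr 1
    ring

theorem dualMap_inverse {p : ℝ} (hp : 2 < p) (w : E) :
    ‖dualMap p w‖ ^ (p - 2) • dualMap p w = w := by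
  rcases eq_or_ne w 0 with h | h
  · rw [h, dualMap]; simp
  · have hw : 0 < ‖w‖ := norm_pos_iff.2 h
    rw [norm_dualMap hp, dualMap, smul_smul, ← Real.rpow_mul hw.le, dualExp_mul hp,
      ← Real.rpow_add hw]
    simp

/-- The inverse of the cusp gradient is `ξ ↦ |ξ|^(p-2) ξ`, which is Lipschitz on bounded sets
because `p > 2`. Closeness of gradients thus passes to closeness of vertices. -/
theorem norm_sub_le_dualMap {p D : ℝ} (hp : 2 < p) {a b : E} (ha : ‖a‖ ≤ D) (hb : ‖b‖ ≤ D) :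
    ‖a - b‖ ≤ (p + 1) * D ^ (2 - dualExp p) * ‖dualMap p a - dualMap p b‖ := by
  have hq := one_lt_dualExp hp
  have hD : 0 ≤ D := (norm_nonneg a).trans ha
  have h1 : ∀ c : E, ‖c‖ ≤ D → ‖dualMap p c‖ ≤ D ^ (dualExp p - 1) := fun c hc => by
    rw [norm_dualMap hp]
    exact Real.rpow_le_rpow (norm_nonneg _) hc (by linarith)
  have := norm_rpow_smul_sub_le (m := p - 2) (by linarith) (h1 a ha) (h1 b hb)
  rwa [dualMap_inverse hp, dualMap_inverse hp, ← Real.rpow_mul hD, dualExp_mul hp,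
    show p - 2 + 3 = p + 1 by ring] at this

theorem inner_dualMap {F : Type*} [NormedAddCommGroup F] [InnerProductSpace ℝ F] (p : ℝ)
    (w h : F) : inner ℝ (dualMap p w) h = ‖w‖ ^ (dualExp p - 2) * inner ℝ w h := by
  rw [dualMap, inner_smul_left]
  simp

end Duality

/-! ### Contact with cusps and uniqueness of the vertex -/

/-- The closed unit cylinder. -/
def unitCyl (n : ℕ) : Set (Space n × ℝ) := Metric.closedBall 0 1 ×ˢ Icc (-1) 0

theorem isCompact_unitCyl (n : ℕ) : IsCompact (unitCyl n) :=
  (isCompact_closedBall _ _).prod isCompact_Icc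

/-- `v` is touched from below at `z`, over the unit cylinder, by a cusp with vertex `y`, which is
Lipschitz in time. -/
def Contact {n : ℕ} (Lam p : ℝ) (v : Space n × ℝ → ℝ) (z : Space n × ℝ) (y : Space n) : Prop :=
  ∀ z' ∈ unitCyl n, v z + ‖z.1 - y‖ ^ dualExp p
    ≤ v z' + ‖z'.1 - y‖ ^ dualExp p + timeConst n Lam p * |z'.2 - z.2|

section Estimates

variable {n : ℕ} {lam Lam p : ℝ} {v : Space n × ℝ → ℝ}

theorem exists_kink_width (hn : 1 ≤ n) (hlam : 0 < lam) (hLam : lam ≤ Lam) :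
    ∃ N : ℝ, 2 ≤ N ∧ N ^ 2 = 4 * n * Lam / lam := by
  have h : 4 ≤ 4 * n * Lam / lam := by
    rw [le_div_iff₀ hlam]
    have : (1 : ℝ) ≤ n := by exact_mod_cast hn
    nlinarith
  refine ⟨√(4 * n * Lam / lam), ?_, Real.sq_sqrt (by linarith)⟩
  apply Real.le_sqrt_of_sq_le
  linarith

/-- The vertex of a contact point is unique. -/
theorem Contact.unique (hn : 1 ≤ n) (hp : 2 < p) (hlam : 0 < lam) (hLam : lam ≤ Lam)
    (hv : IsSuper lam Lam p (unitCyl n) v) {x : Space n} {t : ℝ} (hx : ‖x‖ < 1) (ht : -1 < t)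
    (ht0 : t ≤ 0) {y₁ y₂ : Space n} (h1 : Contact Lam p v (x, t) y₁)
    (h2 : Contact Lam p v (x, t) y₂) : y₁ = y₂ := by
  by_contra hne
  -- The kink argument needs a nonzero gradient for one of the two cusps; two distinct vertices
  -- cannot both equal `x`.
  wlog hy₁ : x ≠ y₁ generalizing y₁ y₂
  · push Not at hy₁
    exact this h2 h1 (Ne.symm hne) (fun h => hne (hy₁.symm.trans h))
  obtain ⟨N, hN2, hN⟩ := exists_kink_width hn hlam hLam
  set q := dualExp p with hq
  have hq1 : 1 < q := one_lt_dualExp hp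
  have hq2 : q < 2 := dualExp_lt_two hp
  set C := timeConst n Lam p with hC
  have hC1 : 1 ≤ C := one_le_timeConst hp (by linarith)
  set w₁ := x - y₁ with hw₁
  set w₂ := x - y₂ with hw₂
  have hw0 : w₁ ≠ 0 := sub_ne_zero.2 hy₁
  set d := ‖w₁‖ with hd
  have hd0 : 0 < d := norm_pos_iff.2 hw0
  set ζ := q • dualMap p w₁ - q • dualMap p w₂ with hζ
  have hζ0 : 0 < ‖ζ‖ := by
    rw [norm_pos_iff]
    intro h
    rw [hζ, ← smul_sub, smul_eq_zero] at h
    have h3 : dualMap p w₁ - dualMap p w₂ = 0 := h.resolve_left (by linarith)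
    have h4 := norm_sub_le_dualMap hp (le_max_left ‖w₁‖ ‖w₂‖) (le_max_right ‖w₁‖ ‖w₂‖)
    rw [h3, norm_zero, mul_zero, norm_le_zero_iff, hw₁, hw₂, sub_sub_sub_cancel_left,
      sub_eq_zero] at h4
    exact hne h4.symm
  -- The convex combination of the two cusps with weights `1 - θ` and `θ` replaces the gradient jump
  -- `ζ` by a jump of length `s`, small enough for `IsSuper.kink`.
  set s := min ‖ζ‖ (d ^ (q - 1) / 8) with hs
  have hs0 : 0 < s := lt_min hζ0 (by positivity)
  set θ := s / ‖ζ‖ with hθ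
  have hθ0 : 0 ≤ θ := by positivity
  have hθ1 : θ ≤ 1 := by
    rw [hθ, div_le_one hζ0]
    exact min_le_left _ _
  set e := (1 / ‖ζ‖) • ζ with he
  have he1 : ‖e‖ = 1 := by
    rw [he, norm_smul, Real.norm_eq_abs, abs_of_pos (by positivity)]
    field_simp
  -- The second cusp may have its vertex at the contact point, so its error is only of order
  -- `‖h‖^q`. Since `q > 1` this is still negligible against the kink `s * R` for small `R`.
  obtain ⟨M, hM0, hM⟩ : ∃ M, 0 ≤ M ∧ ∀ h : Space n, ‖h‖ ≤ 1 →
      ‖w₂ + h‖ ^ q ≤ ‖w₂‖ ^ q + q * inner ℝ (dualMap p w₂) h + M * ‖h‖ ^ q := by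
    by_cases h0 : w₂ = 0
    · refine ⟨1, zero_le_one, fun h _ => ?_⟩
      rw [h0, dualMap]
      have : (0 : ℝ) ^ q = 0 := Real.zero_rpow (by linarith)
      simp [this]
    · refine ⟨q / 2 * ‖w₂‖ ^ (q - 2), by positivity, fun h hh => ?_⟩
      have h3 := norm_add_rpow_le (by linarith : 0 ≤ q) hq2.le h0 h
      have h4 : ‖h‖ ^ 2 ≤ ‖h‖ ^ q := by
        rcases (norm_nonneg h).eq_or_lt with h5 | h5
        · rw [← h5, Real.zero_rpow (by linarith)]
          simp
        · rw [← Real.rpow_natCast]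
          exact Real.rpow_le_rpow_of_exponent_ge h5 hh (by push_cast; linarith)
      rw [inner_dualMap]
      have h5 : q / 2 * ‖w₂‖ ^ (q - 2) * ‖h‖ ^ 2 ≤ q / 2 * ‖w₂‖ ^ (q - 2) * ‖h‖ ^ q := by gcongr
      linarith
  set T : ℝ → ℝ := fun R => 2 ^ (p - 1) * R ^ 2 * d ^ (q - 2) / lam with hT
  have small : ∀ f : ℝ → ℝ, Continuous f → f 0 = 0 → ∀ c > 0, ∀ᶠ R in 𝓝[>] (0 : ℝ), f R ≤ c := by
    intro f hf hf0 c hc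
    have : Tendsto f (𝓝[>] 0) (𝓝 0) := by
      apply Tendsto.mono_left _ nhdsWithin_le_nhds
      simpa [hf0] using hf.tendsto 0
    filter_upwards [this.eventually (gt_mem_nhds hc)] with R hR using hR.le
  have hTc : Continuous T := by
    rw [hT]
    fun_prop
  have hT0 : T 0 = 0 := by simp [hT]
  have hgc : Continuous fun R : ℝ => C * (2 ^ (p - 1) * R * d ^ (q - 2) / lam)
      + M * (N ^ q * R ^ (q - 1)) := by
    have : Continuous fun R : ℝ => R ^ (q - 1) :=
      Continuous.rpow_const continuous_id fun _ => Or.inr (by linarith)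
    fun_prop
  have ev := (((((small (fun R => N * R) (by fun_prop) (by simp) (d / 4) (by positivity)).and
    (small (fun R => N * R) (by fun_prop) (by simp) 1 one_pos)).and
    (small (fun R => N * R) (by fun_prop) (by simp) (1 - ‖x‖) (by linarith))).and
    (small (fun R => 32 * n * Lam / lam * R * d ^ (q - 2)) (by fun_prop) (by simp) s hs0)).and
    (small T hTc hT0 (t + 1) (by linarith))).and
    (small _ hgc (by simp [Real.zero_rpow (by linarith : q - 1 ≠ 0)]) (s / 8) (by positivity))
  obtain ⟨R, ⟨⟨⟨⟨⟨hR1, hR2⟩, hR3⟩, hR4⟩, hR5⟩, hR6⟩, hR0⟩ := (ev.and self_mem_nhdsWithin).exists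
  have hR0 : 0 < R := hR0
  have hτ0 : 0 ≤ T R := by simp only [hT]; positivity
  -- Both errors, from motion in time (`T R` is quadratic in `R`) and from the second cusp, fit into
  -- the loss that `IsSuper.kink` tolerates. It then lifts `v` above its own value at the contact
  -- point.
  have herr : C * T R + M * (N * R) ^ q ≤ s * R / 8 := by
    have h3 := mul_le_mul_of_nonneg_right hR6 hR0.le
    have h4 : (N * R) ^ q = N ^ q * R ^ (q - 1) * R := by
      rw [Real.mul_rpow (by linarith) hR0.le, mul_assoc, ← Real.rpow_add_one hR0.ne']
      congr 2
      ring
    rw [h4]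
    refine le_trans (le_of_eq ?_) (h3.trans (le_of_eq ?_))
    · simp only [hT]; ring
    · ring
  have hsub : Metric.closedBall x (N * R) ×ˢ Icc (t - T R) t ⊆ unitCyl n := by
    rintro ⟨x', t'⟩ ⟨hx', ht'⟩
    refine ⟨?_, ?_, ?_⟩
    · rw [mem_closedBall_zero_iff]
      simp only [Metric.mem_closedBall, dist_eq_norm] at hx'
      have := norm_le_norm_add_norm_sub' x' x
      linarith
    · simp only [mem_Icc] at ht' ⊢; linarith
    · simp only [mem_Icc] at ht' ⊢; linarith
  have hk := hv.kink hn hp hlam hLam (x₁ := x) (y₁ := y₁) (t₁ := t) (b := v (x, t) + d ^ q) he1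
    hd hd0 hR0 (by linarith) hN hR1 hR4 (min_le_right _ _) rfl hsub ?_
  · rw [← hw₁, ← hd] at hk
    have : 0 < s * R / 8 := by positivity
    linarith
  · intro x' hx' t' ht'
    have hmem := hsub (mk_mem_prod hx' ht')
    have c1 := h1 _ hmem
    have c2 := h2 _ hmem
    simp only [← hw₁, ← hw₂, ← hd] at c1 c2
    have htd : |t' - t| ≤ T R := by
      rw [abs_le]
      constructor <;> linarith [ht'.1, ht'.2]
    have hCt : C * |t' - t| ≤ C * T R := by gcongr
    set h := x' - x with hh
    have hhN : ‖h‖ ≤ N * R := by rwa [Metric.mem_closedBall, dist_eq_norm] at hx'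
    have hMh : M * ‖h‖ ^ q ≤ M * (N * R) ^ q := by
      gcongr
    have e1 : x' - y₁ = w₁ + h := by rw [hh, hw₁]; abel
    have e2 : x' - y₂ = w₂ + h := by rw [hh, hw₂]; abel
    simp only [e1, e2] at c1 c2 ⊢
    have l1 := le_norm_add_rpow hq1.le hw0 h
    have l2 := hM h (hhN.trans hR2)
    have e3 : s * inner ℝ e h = θ * (q * ‖w₁‖ ^ (q - 2) * inner ℝ w₁ h
        - q * inner ℝ (dualMap p w₂) h) := by
      have eζ : inner ℝ ζ h = q * ‖w₁‖ ^ (q - 2) * inner ℝ w₁ h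
          - q * inner ℝ (dualMap p w₂) h := by
        rw [hζ]
        simp only [inner_smul_left, inner_sub_left, RCLike.conj_to_real, inner_dualMap, ← hq]
        ring
      rw [he, inner_smul_left, eζ, hθ]
      simp only [RCLike.conj_to_real]
      ring
    have hθM : θ * (M * ‖h‖ ^ q) ≤ 1 * (M * ‖h‖ ^ q) := by gcongr
    rcases le_total 0 (inner ℝ e h) with h0 | h0
    · rw [max_eq_right h0]
      have c1' := mul_le_mul_of_nonneg_left c1 (by linarith : 0 ≤ 1 - θ)
      have c2' := mul_le_mul_of_nonneg_left c2 hθ0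
      have l1' := mul_le_mul_of_nonneg_left l1 hθ0
      have l2' := mul_le_mul_of_nonneg_left l2 hθ0
      have e4 : (1 - θ) * (v (x', t') + ‖w₁ + h‖ ^ q + C * |t' - t|)
        + θ * (v (x', t') + ‖w₂ + h‖ ^ q + C * |t' - t|)
        = v (x', t') + C * |t' - t| + (1 - θ) * ‖w₁ + h‖ ^ q + θ * ‖w₂ + h‖ ^ q := by ring
      rw [e3]
      linarith
    · rw [max_eq_left h0]
      have : 0 ≤ M * (N * R) ^ q := by positivity
      linarith

end Estimates

/-! ### Quantitative comparison of two contact points -/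

section PairEstimate

variable {n : ℕ} {lam Lam p : ℝ}

set_option maxHeartbeats 1000000 in
/-- Contact points at comparable distance `d` from their vertices: the vertices and the heights of
the cusps are controlled in intrinsic parabolic cylinders. -/
theorem exists_contact_estimate (hn : 1 ≤ n) (hp : 2 < p) (hlam : 0 < lam) (hLam : lam ≤ Lam) :
    ∃ K : ℝ, 1 ≤ K ∧ ∀ v : Space n × ℝ → ℝ, IsSuper lam Lam p (unitCyl n) v →
      ∀ d r : ℝ, 0 < d → 0 < r → K * r ≤ d →
      ∀ (x₁ x₂ y₁ y₂ : Space n) (t₁ t₂ : ℝ),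
        Contact Lam p v (x₁, t₁) y₁ → Contact Lam p v (x₂, t₂) y₂ → (x₂, t₂) ∈ unitCyl n →
        d ≤ ‖x₁ - y₁‖ → ‖x₁ - y₁‖ ≤ 2 * d → d ≤ ‖x₂ - y₂‖ → ‖x₂ - y₂‖ ≤ 2 * d →
        ‖x₂ - x₁‖ ≤ r → |t₂ - t₁| ≤ d ^ (dualExp p - 2) * r ^ 2 →
        Metric.closedBall x₁ (K * r) ×ˢ Icc (t₁ - K * (d ^ (dualExp p - 2) * r ^ 2)) t₁
          ⊆ unitCyl n →
        ‖y₂ - y₁‖ ≤ K * r ∧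
        |v (x₂, t₂) + ‖x₂ - y₂‖ ^ dualExp p - ‖x₁ - y₂‖ ^ dualExp p - v (x₁, t₁)|
          ≤ K * (d ^ (dualExp p - 2) * r ^ 2) := by
  obtain ⟨N, hN2, hN⟩ := exists_kink_width hn hlam hLam
  set q := dualExp p with hq
  have hq1 : 1 < q := one_lt_dualExp hp
  have hq2 : q < 2 := dualExp_lt_two hp
  set C := timeConst n Lam p with hC
  have hC1 : 1 ≤ C := one_le_timeConst hp (by linarith)
  have hLam0 : 0 < Lam := by linarith
  set c₁ : ℝ := 2 ^ (p - 1) * 1024 / lam with hc₁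
  have hc₁0 : 0 < c₁ := by positivity
  set C₀ : ℝ := (C + 1) + 2048 * N ^ 2 + C * (c₁ + 1) + 32 * n * Lam / lam with hC₀
  have hnn : 0 ≤ 32 * n * Lam / lam := by positivity
  have hCc : c₁ ≤ C * c₁ := by nlinarith
  have hNN : N ≤ N ^ 2 := by nlinarith
  have hC₀1 : 1 ≤ C₀ := by nlinarith
  have hC₀N : 2048 * N ≤ C₀ := by nlinarith
  have hC₀c : c₁ ≤ C₀ := by nlinarith
  have hC₀C : C + 1 ≤ C₀ := by nlinarith
  have hC₀n : 32 * n * Lam / lam ≤ C₀ := by nlinarith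
  refine ⟨96 * (p + 1) * C₀, by nlinarith, ?_⟩
  intro v hv d r hd hr hrd x₁ x₂ y₁ y₂ t₁ t₂ h1 h2 hz₂ hd1 hd1' hd2 hd2' hx ht hsub
  have hK : 288 * C₀ ≤ 96 * (p + 1) * C₀ := by nlinarith
  have hKr : 288 * C₀ * r ≤ d := (mul_le_mul_of_nonneg_right hK hr.le).trans hrd
  set L := d ^ (q - 2) with hL
  have hL0 : 0 < L := Real.rpow_pos_of_pos hd _
  have hLr : 0 < L * r ^ 2 := by positivity
  set w₁ := x₁ - y₁ with hw₁
  set w₂ := x₁ - y₂ with hw₂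
  set k := x₂ - x₁ with hk
  set d₁ := ‖w₁‖ with hd₁
  have hd₁0 : 0 < d₁ := by linarith
  have hw₁0 : w₁ ≠ 0 := norm_pos_iff.1 hd₁0
  have hCr : r ≤ C₀ * r := le_mul_of_one_le_left hr.le hC₀1
  have hrd2 : r ≤ d / 2 := by linarith
  have ek : x₂ - y₂ = w₂ + k := by rw [hw₂, hk]; abel
  have ek1 : x₂ - y₁ = w₁ + k := by rw [hw₁, hk]; abel
  rw [ek] at hd2 hd2' ⊢
  have hw₂l : d / 2 ≤ ‖w₂‖ := by
    have := norm_add_le w₂ k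
    linarith
  have hw₂u : ‖w₂‖ ≤ 3 * d := by
    have h3 := norm_sub_le (w₂ + k) k
    rw [add_sub_cancel_right] at h3
    linarith
  have hw₂0 : w₂ ≠ 0 := norm_pos_iff.1 (by linarith)
  have hd₁q : d₁ ^ (q - 2) ≤ L := Real.rpow_le_rpow_of_nonpos hd hd1 (by linarith)
  have hw₂q : ‖w₂‖ ^ (q - 2) ≤ 2 * L := by
    calc ‖w₂‖ ^ (q - 2) ≤ (d / 2) ^ (q - 2) :=
          Real.rpow_le_rpow_of_nonpos (by positivity) hw₂l (by linarith)
      _ = d ^ (q - 2) / 2 ^ (q - 2) := Real.div_rpow hd.le (by norm_num) _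
      _ ≤ 2 * L := by
        rw [div_le_iff₀ (by positivity)]
        have : (2 : ℝ) ^ (-1 : ℝ) ≤ 2 ^ (q - 2) :=
          Real.rpow_le_rpow_of_exponent_le (by norm_num) (by linarith)
        rw [Real.rpow_neg_one] at this
        nlinarith
  set ζ := q • dualMap p w₁ - q • dualMap p w₂ with hζ
  have eζ : ∀ h, inner ℝ ζ h = q * ‖w₁‖ ^ (q - 2) * inner ℝ w₁ h
      - q * ‖w₂‖ ^ (q - 2) * inner ℝ w₂ h := by
    intro h
    rw [hζ]
    simp only [inner_smul_left, inner_sub_left, RCLike.conj_to_real, inner_dualMap, ← hq]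
    ring
  -- `g` is the difference of the two cusps at `x₁`
  set g := v (x₂, t₂) + ‖w₂ + k‖ ^ q - ‖w₂‖ ^ q - v (x₁, t₁) with hg
  have hz₁ : (x₁, t₁) ∈ unitCyl n := by
    apply hsub
    have hp1 : 0 < p + 1 := by linarith
    refine ⟨Metric.mem_closedBall_self (by positivity), ?_, le_rfl⟩
    have : 0 ≤ 96 * (p + 1) * C₀ * (L * r ^ 2) := by positivity
    linarith
  -- The two contact inequalities are tested against each other's contact point. One bounds `g` from
  -- above; the other bounds it from below up to the gradient gap `‖ζ‖ * r`.
  have hg1 : g ≤ C * (L * r ^ 2) := by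
    have := h2 _ hz₁
    simp only [ek, ← hw₂] at this
    rw [abs_sub_comm] at this
    have h3 : C * |t₂ - t₁| ≤ C * (L * r ^ 2) := by gcongr
    linarith
  have hg2 : -g ≤ (C + 1) * (L * r ^ 2) + ‖ζ‖ * r := by
    have h0 := h1 _ hz₂
    simp only [ek1, ← hw₁] at h0
    have h3 : C * |t₂ - t₁| ≤ C * (L * r ^ 2) := by gcongr
    have h4 := norm_add_rpow_le (by linarith : 0 ≤ q) hq2.le hw₁0 k
    have h5 := le_norm_add_rpow hq1.le hw₂0 k
    have h6 := real_inner_le_norm ζ k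
    have h7 : ‖ζ‖ * ‖k‖ ≤ ‖ζ‖ * r := by gcongr
    have h8 : q / 2 * ‖w₁‖ ^ (q - 2) * ‖k‖ ^ 2 ≤ 2 / 2 * L * r ^ 2 := by gcongr
    rw [eζ] at h6
    linarith
  -- A larger gap would create a kink at scale `R = 32 * r`. After scaling by `θ`, the mismatch of
  -- heights costs `θ * ‖ζ‖ * r = s * r = s * R / 32`, well below the admissible `s * R / 8`; the
  -- other errors are multiples of `L * r ^ 2` collected in `C₀`.
  have hζs : ‖ζ‖ < C₀ * L * (32 * r) := by
    by_contra hcon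
    push Not at hcon
    set R := 32 * r with hR
    have hR0 : 0 < R := by positivity
    set s := C₀ * L * R with hs
    have hs0 : 0 < s := by positivity
    have hζ0 : 0 < ‖ζ‖ := by linarith
    set θ := s / ‖ζ‖ with hθ
    have hθ0 : 0 ≤ θ := by positivity
    have hθ1 : θ ≤ 1 := by rwa [hθ, div_le_one hζ0]
    have hθζ : θ * ‖ζ‖ = s := by rw [hθ]; field_simp
    set e := (1 / ‖ζ‖) • ζ with he
    have he1 : ‖e‖ = 1 := by
      rw [he, norm_smul, Real.norm_eq_abs, abs_of_pos (by positivity)]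
      field_simp
    set τ := 2 ^ (p - 1) * R ^ 2 * d₁ ^ (q - 2) / lam with hτ
    have hτ0 : 0 ≤ τ := by positivity
    have hτ1 : τ ≤ c₁ * (L * r ^ 2) := by
      calc τ ≤ 2 ^ (p - 1) * R ^ 2 * L / lam := by rw [hτ]; gcongr
        _ = c₁ * (L * r ^ 2) := by rw [hc₁, hR]; ring
    have hNR : N * R ≤ 96 * (p + 1) * C₀ * r := by
      calc N * R = 32 * N * r := by rw [hR]; ring
        _ ≤ 288 * C₀ * r := mul_le_mul_of_nonneg_right (by linarith) hr.le
        _ ≤ _ := by gcongr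
    have hbox : Metric.closedBall x₁ (N * R) ×ˢ Icc (t₁ - τ) t₁ ⊆ unitCyl n := by
      refine Subset.trans ?_ hsub
      apply Set.prod_mono (Metric.closedBall_subset_closedBall hNR)
      apply Icc_subset_Icc_left
      have : c₁ * (L * r ^ 2) ≤ 96 * (p + 1) * C₀ * (L * r ^ 2) := by
        gcongr
        linarith
      linarith
    have hk := hv.kink hn hp hlam hLam (x₁ := x₁) (y₁ := y₁) (t₁ := t₁)
      (b := v (x₁, t₁) + d₁ ^ q) (s := s) he1 hd₁ hd₁0 hR0 (by linarith) hN ?_ ?_ ?_ rfl hbox ?_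
    · rw [← hw₁, ← hd₁] at hk
      have : 0 < s * R / 8 := by positivity
      linarith
    · have h3 := mul_le_mul_of_nonneg_right hC₀N hr.le
      rw [hR]
      linarith
    · calc 32 * n * Lam / lam * R * d₁ ^ (dualExp p - 2) ≤ C₀ * R * L := by gcongr
        _ = s := by rw [hs]; ring
    · have h3 : d ^ (q - 1) = L * d := by
        rw [hL, ← Real.rpow_add_one hd.ne']
        congr 1
        ring
      have h4 : d ^ (q - 1) ≤ d₁ ^ (q - 1) := Real.rpow_le_rpow hd.le hd1 (by linarith)
      have h5 : s ≤ d ^ (q - 1) / 8 := by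
        rw [h3, hs, hR, le_div_iff₀ (by norm_num)]
        have : 256 * C₀ * r ≤ d := by linarith
        calc C₀ * L * (32 * r) * 8 = L * (256 * C₀ * r) := by ring
          _ ≤ L * d := by gcongr
      linarith
    · intro x' hx' t' ht'
      have hmem := hbox (mk_mem_prod hx' ht')
      have c1 := h1 _ hmem
      have c2 := h2 _ hmem
      simp only [← hw₁, ek, ← hd₁] at c1 c2
      have htd : |t' - t₁| ≤ τ := by
        rw [abs_le]
        constructor <;> linarith [ht'.1, ht'.2]
      have htd2 : |t' - t₂| ≤ τ + L * r ^ 2 := by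
        have h3 := abs_sub_le t' t₁ t₂
        rw [abs_sub_comm t₁ t₂] at h3
        linarith
      have hCt1 : C * |t' - t₁| ≤ C * (c₁ * (L * r ^ 2)) := by gcongr; linarith
      have hCt2 : C * |t' - t₂| ≤ C * (c₁ * (L * r ^ 2) + L * r ^ 2) := by gcongr; linarith
      set h := x' - x₁ with hh
      have hhN : ‖h‖ ≤ N * R := by rwa [Metric.mem_closedBall, dist_eq_norm] at hx'
      have e1 : x' - y₁ = w₁ + h := by rw [hh, hw₁]; abel
      have e2 : x' - y₂ = w₂ + h := by rw [hh, hw₂]; abel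
      simp only [e1, e2] at c1 c2 ⊢
      have l1 := le_norm_add_rpow hq1.le hw₁0 h
      have l2 := norm_add_rpow_le (by linarith : 0 ≤ q) hq2.le hw₂0 h
      have l3 : q / 2 * ‖w₂‖ ^ (q - 2) * ‖h‖ ^ 2 ≤ 2 * N ^ 2 * 1024 * (L * r ^ 2) := by
        calc q / 2 * ‖w₂‖ ^ (q - 2) * ‖h‖ ^ 2 ≤ 2 / 2 * (2 * L) * (N * R) ^ 2 := by gcongr
          _ = _ := by rw [hR]; ring
      have e3 : s * inner ℝ e h = θ * (q * ‖w₁‖ ^ (q - 2) * inner ℝ w₁ h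
          - q * ‖w₂‖ ^ (q - 2) * inner ℝ w₂ h) := by
        rw [he, inner_smul_left, eζ, hθ]
        simp only [RCLike.conj_to_real]
        ring
      have hsR : s * R / 8 = 128 * C₀ * (L * r ^ 2) := by rw [hs, hR]; ring
      have hsr : s * r = 32 * C₀ * (L * r ^ 2) := by rw [hs, hR]; ring
      have hC₀' : ((C + 1) + 2048 * N ^ 2 + C * (c₁ + 1)) * (L * r ^ 2) ≤ C₀ * (L * r ^ 2) := by
        gcongr
        linarith
      have hCL : 0 ≤ C * (L * r ^ 2) := by positivity
      have hCcL : 0 ≤ C * c₁ * (L * r ^ 2) := by positivity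
      have hNL : 0 ≤ N ^ 2 * (L * r ^ 2) := by positivity
      have hC₀L : 0 ≤ C₀ * (L * r ^ 2) := by positivity
      rcases le_total 0 (inner ℝ e h) with h0 | h0
      · rw [max_eq_right h0]
        have c1' := mul_le_mul_of_nonneg_left c1 (by linarith : 0 ≤ 1 - θ)
        have c2' := mul_le_mul_of_nonneg_left c2 hθ0
        have l1' := mul_le_mul_of_nonneg_left l1 hθ0
        have l2' := mul_le_mul_of_nonneg_left l2 hθ0
        have hg2' := mul_le_mul_of_nonneg_left hg2 hθ0
        have hθ3 : θ * (q / 2 * ‖w₂‖ ^ (q - 2) * ‖h‖ ^ 2) ≤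
            1 * (q / 2 * ‖w₂‖ ^ (q - 2) * ‖h‖ ^ 2) := by gcongr
        have hθ4 : θ * ((C + 1) * (L * r ^ 2)) ≤ 1 * ((C + 1) * (L * r ^ 2)) := by gcongr
        have hθ5 : (1 - θ) * (C * |t' - t₁|) ≤ (1 - θ) * (C * (c₁ * (L * r ^ 2) + L * r ^ 2)) := by
          apply mul_le_mul_of_nonneg_left _ (by linarith)
          linarith
        have hθ6 : θ * (C * |t' - t₂|) ≤ θ * (C * (c₁ * (L * r ^ 2) + L * r ^ 2)) := by gcongr
        have hθ7 : θ * ((C + 1) * (L * r ^ 2) + ‖ζ‖ * r)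
            = θ * ((C + 1) * (L * r ^ 2)) + s * r := by rw [← hθζ]; ring
        have hθ8 : θ * -g = -(θ * (v (x₂, t₂) + ‖w₂ + k‖ ^ q)) + θ * ‖w₂‖ ^ q
            + θ * v (x₁, t₁) := by rw [hg]; ring
        rw [e3]
        linarith
      · rw [max_eq_left h0]
        linarith
  refine ⟨?_, ?_⟩
  -- The factor `d^(2-q)` lost in inverting the gradient map cancels the `L = d^(q-2)` in the bound
  -- for `ζ`; the resulting constant does not depend on `d`.
  · have h3 := norm_sub_le_dualMap hp (a := w₁) (b := w₂) (D := 3 * d) (by linarith) hw₂u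
    have h4 : w₁ - w₂ = y₂ - y₁ := by rw [hw₁, hw₂]; abel
    have h5 : ‖dualMap p w₁ - dualMap p w₂‖ ≤ ‖ζ‖ := by
      rw [hζ, ← smul_sub, norm_smul, Real.norm_eq_abs, abs_of_pos (by linarith)]
      exact le_mul_of_one_le_left (norm_nonneg _) hq1.le
    have h6 : (3 * d) ^ (2 - q) ≤ 3 * d ^ (2 - q) := by
      rw [Real.mul_rpow (by norm_num) hd.le]
      gcongr
      calc (3 : ℝ) ^ (2 - q) ≤ 3 ^ (1 : ℝ) :=
            Real.rpow_le_rpow_of_exponent_le (by norm_num) (by linarith)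
        _ = 3 := Real.rpow_one 3
    have h7 : d ^ (2 - q) * L = 1 := by
      rw [hL, ← Real.rpow_add hd]
      simp
    rw [h4] at h3
    calc ‖y₂ - y₁‖ ≤ (p + 1) * (3 * d) ^ (2 - q) * ‖dualMap p w₁ - dualMap p w₂‖ := h3
      _ ≤ (p + 1) * (3 * d ^ (2 - q)) * (C₀ * L * (32 * r)) := by
        have : 0 ≤ p + 1 := by linarith
        gcongr
        linarith
      _ = 96 * (p + 1) * C₀ * r * (d ^ (2 - q) * L) := by ring
      _ = _ := by rw [h7, mul_one]
  · have h3 : ‖ζ‖ * r ≤ C₀ * L * (32 * r) * r := by gcongr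
    have h4 : C₀ * L * (32 * r) * r = 32 * C₀ * (L * r ^ 2) := by ring
    have h5 : ((C + 1) + 32 * C₀) * (L * r ^ 2) ≤ 96 * (p + 1) * C₀ * (L * r ^ 2) := by
      gcongr
      linarith
    rw [abs_le]
    have h6 : 0 ≤ C₀ * (L * r ^ 2) := by positivity
    constructor <;> linarith

end PairEstimate

/-! ### Volume under relations controlled in anisotropic cylinders -/

section Covering

variable {n : ℕ}

/-- The volume of the unit ball. -/
def ballVol (n : ℕ) : ENNReal := volume (Metric.ball (0 : Space n) 1)

theorem ballVol_ne_top : ballVol n ≠ ⊤ := measure_ball_lt_top.ne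

theorem volume_closedBall_space (x : Space n) {r : ℝ} (hr : 0 ≤ r) :
    volume (Metric.closedBall x r) = ENNReal.ofReal (r ^ n) * ballVol n := by
  rw [Measure.addHaar_closedBall _ _ hr, ballVol, finrank_euclideanSpace, Fintype.card_fin]

theorem volume_ball_space (x : Space n) {r : ℝ} (hr : 0 < r) :
    volume (Metric.ball x r) = ENNReal.ofReal (r ^ n) * ballVol n := by
  rw [Measure.addHaar_ball_of_pos _ _ hr, ballVol, finrank_euclideanSpace, Fintype.card_fin]

theorem volume_cyl (x : Space n) {r : ℝ} (hr : 0 ≤ r) (a b : ℝ) :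
    volume (Metric.closedBall x r ×ˢ Icc a b) =
      ENNReal.ofReal (r ^ n) * ballVol n * ENNReal.ofReal (b - a) := by
  rw [Measure.volume_eq_prod, Measure.prod_prod, volume_closedBall_space x hr, Real.volume_Icc]

/-- The volume of a sheared cylinder. -/
theorem volume_shear {f : Space n → ℝ} (hf : Continuous f) (y : Space n) {r δ : ℝ} (hr : 0 ≤ r) :
    volume {z : Space n × ℝ | ‖z.1 - y‖ ≤ r ∧ |z.2 - f z.1| ≤ δ}
      = ENNReal.ofReal (r ^ n) * ballVol n * ENNReal.ofReal (2 * δ) := by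
  have hm : MeasurableSet {z : Space n × ℝ | ‖z.1 - y‖ ≤ r ∧ |z.2 - f z.1| ≤ δ} := by
    have h1 : IsClosed {z : Space n × ℝ | ‖z.1 - y‖ ≤ r} :=
      isClosed_le (by fun_prop) continuous_const
    have h2 : IsClosed {z : Space n × ℝ | |z.2 - f z.1| ≤ δ} :=
      isClosed_le (by fun_prop) continuous_const
    exact (h1.inter h2).measurableSet
  rw [Measure.volume_eq_prod, Measure.prod_apply hm]
  have : ∀ x : Space n, volume (Prod.mk x ⁻¹' {z : Space n × ℝ | ‖z.1 - y‖ ≤ r ∧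
      |z.2 - f z.1| ≤ δ}) = (Metric.closedBall y r).indicator (fun _ => ENNReal.ofReal (2 * δ)) x := by
    intro x
    by_cases hx : ‖x - y‖ ≤ r
    · rw [indicator_of_mem (by rwa [Metric.mem_closedBall, dist_eq_norm])]
      have : Prod.mk x ⁻¹' {z : Space n × ℝ | ‖z.1 - y‖ ≤ r ∧ |z.2 - f z.1| ≤ δ}
          = Icc (f x - δ) (f x + δ) := by
        ext t
        simp only [mem_preimage, mem_ofPred_eq, hx, true_and, abs_le, mem_Icc]
        constructor <;> rintro ⟨h1, h2⟩ <;> constructor <;> linarith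
      rw [this, Real.volume_Icc]
      congr 1
      ring
    · rw [indicator_of_notMem (by rwa [Metric.mem_closedBall, dist_eq_norm])]
      have : Prod.mk x ⁻¹' {z : Space n × ℝ | ‖z.1 - y‖ ≤ r ∧ |z.2 - f z.1| ≤ δ} = ∅ := by
        ext t
        simp [hx]
      rw [this, measure_empty]
  simp_rw [this]
  rw [lintegral_indicator Metric.isClosed_closedBall.measurableSet, setLIntegral_const,
    volume_closedBall_space y hr, mul_comm]

/-- Anisotropic Lipschitz maps, with values sheared in the second variable, do not increase the
volume by more than a fixed factor. -/
theorem volume_le_of_contact {κ L K : ℝ} (hκ : 1 ≤ κ) (hκ2 : κ ≤ 2) (hL : 0 < L) (hK : 1 ≤ K)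
    (A P : Set (Space n × ℝ)) (rel : Space n × ℝ → Space n × ℝ → Prop)
    (hP : ∀ π ∈ P, ∃ z ∈ A, rel z π)
    (hest : ∀ z ∈ A, ∃ r₀ > 0, ∃ (y : Space n) (f : Space n → ℝ), Continuous f ∧
      ∀ r, 0 < r → r ≤ r₀ → ∀ z' ∈ A, ∀ π ∈ P, rel z' π → ‖z'.1 - z.1‖ ≤ r →
        |z'.2 - z.2| ≤ L * r ^ κ → ‖π.1 - y‖ ≤ K * r ∧ |π.2 - f π.1| ≤ K * (L * r ^ κ)) :
    volume P ≤ ENNReal.ofReal ((3 * K) ^ n * (9 * K)) * volume A := by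
  apply ENNReal.le_of_forall_pos_le_add
  intro η hη _
  set Kb : ℝ := (3 * K) ^ n * (9 * K) with hKb
  have hKb0 : 0 < Kb := by positivity
  -- Disjoint cylinders inside an open set of almost the same measure replace a differentiability
  -- argument; `A` need not be measurable.
  obtain ⟨G, hAG, hGo, hG⟩ := A.exists_isOpen_le_add volume
    (ε := ENNReal.ofReal (η / Kb)) (by simpa using by positivity)
  choose! r₀ hr₀ y f hf hest using hest
  have hr : ∀ z ∈ A, ∃ r > 0, 3 * r ≤ r₀ z ∧ r ≤ 1 ∧
      Metric.closedBall z.1 r ×ˢ Icc (z.2 - L * r ^ κ) (z.2 + L * r ^ κ) ⊆ G := by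
    intro z hz
    obtain ⟨ε, hε, hball⟩ := Metric.isOpen_iff.1 hGo z (hAG hz)
    have h1 : Tendsto (fun r : ℝ => L * r ^ κ) (𝓝[>] 0) (𝓝 0) := by
      apply Tendsto.mono_left _ nhdsWithin_le_nhds
      have : Continuous fun r : ℝ => L * r ^ κ :=
        continuous_const.mul (Continuous.rpow_const continuous_id fun _ => Or.inr (by linarith))
      simpa [Real.zero_rpow (by linarith : κ ≠ 0)] using this.tendsto 0
    have h2 : Tendsto (fun r : ℝ => r) (𝓝[>] 0) (𝓝 0) := nhdsWithin_le_nhds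
    obtain ⟨r, ⟨⟨⟨hr1, hr2⟩, hr3⟩, hr4⟩, hr5⟩ := ((((h1.eventually (gt_mem_nhds hε)).and
      (h2.eventually (gt_mem_nhds hε))).and
      (h2.eventually (gt_mem_nhds (by have := hr₀ z hz; positivity : 0 < r₀ z / 3)))).and
      (h2.eventually (gt_mem_nhds one_pos))).and self_mem_nhdsWithin |>.exists
    refine ⟨r, hr5, by linarith, hr4.le, Subset.trans ?_ hball⟩
    rintro ⟨x, t⟩ ⟨hx, ht⟩
    rw [Metric.mem_ball, Prod.dist_eq, max_lt_iff]
    refine ⟨lt_of_le_of_lt hx hr2, ?_⟩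
    rw [Real.dist_eq, abs_lt]
    constructor <;> linarith [ht.1, ht.2]
  choose! ρ hρ0 hρ1 hρ2 hρG using hr
  set B : Space n × ℝ → Set (Space n × ℝ) := fun z =>
    Metric.closedBall z.1 (ρ z) ×ˢ Icc (z.2 - L * ρ z ^ κ) (z.2 + L * ρ z ^ κ) with hB
  have hpow0 : ∀ z ∈ A, 0 < L * ρ z ^ κ := fun z hz =>
    mul_pos hL (Real.rpow_pos_of_pos (hρ0 z hz) _)
  have hself : ∀ z ∈ A, z ∈ B z := fun z hz =>
    ⟨Metric.mem_closedBall_self (hρ0 z hz).le, by linarith [hpow0 z hz],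
      by linarith [hpow0 z hz]⟩
  obtain ⟨u, huA, hdisj, hcov⟩ := Vitali.exists_disjoint_subfamily_covering_enlargement B A ρ 2
    one_lt_two (fun z hz => (hρ0 z hz).le) 1 hρ2 (fun z hz => ⟨z, hself z hz⟩)
  have hcount : u.Countable := by
    apply hdisj.countable_of_nonempty_interior
    intro z hz
    have hzA := huA hz
    refine ⟨z, mem_interior.2 ⟨Metric.ball z.1 (ρ z) ×ˢ Ioo (z.2 - L * ρ z ^ κ) (z.2 + L * ρ z ^ κ),
      prod_mono Metric.ball_subset_closedBall Ioo_subset_Icc_self,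
      Metric.isOpen_ball.prod isOpen_Ioo, Metric.mem_ball_self (hρ0 z hzA), ?_, ?_⟩⟩ <;>
    linarith [hpow0 z hzA]
  set I : Space n × ℝ → Set (Space n × ℝ) := fun z =>
    {π | ‖π.1 - y z‖ ≤ K * (3 * ρ z) ∧ |π.2 - f z π.1| ≤ K * (L * (3 * ρ z) ^ κ)} with hI
  have hPI : P ⊆ ⋃ z ∈ u, I z := by
    intro π hπ
    obtain ⟨z', hz', hrel⟩ := hP π hπ
    obtain ⟨z, hzu, ⟨w, hw', hw⟩, hle⟩ := hcov z' hz'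
    have hzA := huA hzu
    refine mem_iUnion₂.2 ⟨z, hzu, ?_⟩
    refine hest z hzA (3 * ρ z) (by linarith [hρ0 z hzA]) (hρ1 z hzA) z' hz' π hπ hrel ?_ ?_
    · rw [← dist_eq_norm]
      have h1 := hw'.1
      have h2 := hw.1
      rw [Metric.mem_closedBall] at h1 h2
      have := dist_triangle_left z'.1 z.1 w.1
      linarith
    · have h3 : L * ρ z' ^ κ ≤ L * (2 * ρ z) ^ κ := by
        have := (hρ0 z' hz').le
        gcongr
      -- Superadditivity of the power, which needs `κ ≥ 1`, turns the triangle inequality in time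
      -- into a single cylinder of radius `3 * ρ z`.
      have h4 : (2 * ρ z) ^ κ + ρ z ^ κ ≤ (3 * ρ z) ^ κ := by
        have h5 := Real.add_rpow_le_rpow_add (by linarith [hρ0 z hzA] : 0 ≤ 2 * ρ z)
          (hρ0 z hzA).le hκ
        rwa [show 2 * ρ z + ρ z = 3 * ρ z by ring] at h5
      have h5 := mul_le_mul_of_nonneg_left h4 hL.le
      rw [abs_le]
      have h6 := hw'.2
      have h7 := hw.2
      constructor <;> linarith [h6.1, h6.2, h7.1, h7.2]
  have hvol : ∀ z ∈ u, volume (I z) ≤ ENNReal.ofReal Kb * volume (B z) := by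
    intro z hz
    have h0 := hρ0 z (huA hz)
    rw [hI, hB]
    simp only
    rw [volume_shear (hf z (huA hz)) _ (by positivity), volume_cyl _ h0.le]
    have e1 : (3 * ρ z) ^ κ ≤ 9 * ρ z ^ κ := by
      rw [Real.mul_rpow (by norm_num) h0.le]
      gcongr
      calc (3 : ℝ) ^ κ ≤ 3 ^ (2 : ℝ) := Real.rpow_le_rpow_of_exponent_le (by norm_num) hκ2
        _ = 9 := by norm_num
    have h1 : ENNReal.ofReal ((K * (3 * ρ z)) ^ n) * ENNReal.ofReal (2 * (K * (L * (3 * ρ z) ^ κ)))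
        ≤ ENNReal.ofReal Kb * (ENNReal.ofReal (ρ z ^ n) *
          ENNReal.ofReal (z.2 + L * ρ z ^ κ - (z.2 - L * ρ z ^ κ))) := by
      rw [← ENNReal.ofReal_mul (by positivity), ← ENNReal.ofReal_mul (by positivity),
        ← ENNReal.ofReal_mul (by positivity)]
      apply ENNReal.ofReal_le_ofReal
      calc (K * (3 * ρ z)) ^ n * (2 * (K * (L * (3 * ρ z) ^ κ)))
          ≤ (K * (3 * ρ z)) ^ n * (2 * (K * (L * (9 * ρ z ^ κ)))) := by gcongr
        _ = Kb * (ρ z ^ n * (z.2 + L * ρ z ^ κ - (z.2 - L * ρ z ^ κ))) := by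
          rw [hKb, mul_pow, mul_pow, mul_pow]
          ring
    calc _ = ENNReal.ofReal ((K * (3 * ρ z)) ^ n) *
          ENNReal.ofReal (2 * (K * (L * (3 * ρ z) ^ κ))) * ballVol n := by ring
      _ ≤ _ := mul_le_mul_left h1 _
      _ = _ := by ring
  calc volume P ≤ volume (⋃ z ∈ u, I z) := measure_mono hPI
    _ ≤ ∑' z : u, volume (I z) := measure_biUnion_le _ hcount _
    _ ≤ ∑' z : u, ENNReal.ofReal Kb * volume (B z) := ENNReal.tsum_le_tsum fun z => hvol z z.2
    _ = ENNReal.ofReal Kb * ∑' z : u, volume (B z) := ENNReal.tsum_mul_left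
    _ = ENNReal.ofReal Kb * volume (⋃ z ∈ u, B z) := by
      rw [measure_biUnion hcount hdisj]
      intro z _
      exact (Metric.isClosed_closedBall.prod isClosed_Icc).measurableSet
    _ ≤ ENNReal.ofReal Kb * volume G := by
      gcongr
      exact iUnion₂_subset fun z hz => hρG z (huA hz)
    _ ≤ ENNReal.ofReal Kb * (volume A + ENNReal.ofReal (η / Kb)) := by gcongr
    _ = ENNReal.ofReal Kb * volume A + η := by
      rw [mul_add, ← ENNReal.ofReal_mul hKb0.le, mul_div_cancel₀ _ hKb0.ne',
        ENNReal.ofReal_coe_nnreal]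

end Covering

/-! ### Existence of contact points and closedness of contact sets -/

section MeasureEstimate

variable {n : ℕ} {lam Lam p : ℝ}

/-- The set where a lower semicontinuous function lies below a continuous one is closed. -/
theorem isClosed_le_of_lsc {X : Type*} [TopologicalSpace X] {s : Set X} {v φ : X → ℝ}
    (hs : IsClosed s) (hv : LowerSemicontinuousOn v s) (hφ : Continuous φ) :
    IsClosed {z | z ∈ s ∧ v z ≤ φ z} := by
  have h1 : LowerSemicontinuousOn (fun z => v z + (-φ) z) s :=
    hv.add hφ.neg.continuousOn.lowerSemicontinuousOn
  obtain ⟨U, hU, hUe⟩ := (lowerSemicontinuousOn_iff_preimage_Ioi.1 h1) 0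
  have : {z | z ∈ s ∧ v z ≤ φ z} = s ∩ Uᶜ := by
    ext z
    constructor
    · rintro ⟨hz, hle⟩
      refine ⟨hz, fun hzU => ?_⟩
      have : z ∈ s ∩ (fun z => v z + (-φ) z) ⁻¹' Ioi 0 := by
        rw [hUe]; exact ⟨hz, hzU⟩
      have h3 : 0 < v z + -φ z := this.2
      linarith
    · rintro ⟨hz, hzU⟩
      refine ⟨hz, ?_⟩
      by_contra hcon
      push Not at hcon
      have : z ∈ s ∩ U := by
        rw [← hUe]
        refine ⟨hz, ?_⟩
        change 0 < v z + -φ z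
        linarith
      exact hzU this.2
  rw [this]
  exact hs.inter hU.isClosed_compl

theorem continuous_norm_rpow (hp : 2 < p) {X E : Type*} [TopologicalSpace X]
    [NormedAddCommGroup E] {f : X → E} (hf : Continuous f) :
    Continuous fun x => ‖f x‖ ^ dualExp p :=
  Continuous.rpow_const hf.norm fun _ => Or.inr (by linarith [one_lt_dualExp hp])

/-- Every cusp with vertex near the axis and height in a fixed range touches `v` somewhere. -/
theorem exists_contact (hp : 2 < p) (hLam : 0 ≤ Lam) {v : Space n × ℝ → ℝ}
    (hv : IsSuper lam Lam p (unitCyl n) v) (h0 : v (0, 0) ≤ 1 / 4) {y : Space n} {a : ℝ}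
    (hy : ‖y‖ < 1 / 8) (ha : 3 / 8 < a) (ha' : a < 3 / 4) :
    ∃ x t, ‖x‖ < 1 ∧ -1 < t ∧ t ≤ 0 ∧ v (x, t) ≤ 1 ∧ Contact Lam p v (x, t) y ∧
      a = v (x, t) + ‖x - y‖ ^ dualExp p - t := by
  set q := dualExp p with hq
  have hq1 : 1 < q := one_lt_dualExp hp
  have hq2 : q < 2 := dualExp_lt_two hp
  set C := timeConst n Lam p with hC
  have hC1 : 1 ≤ C := one_le_timeConst hp hLam
  -- The cusp rises at unit speed. It starts below `v`, since `φ < 0 ≤ v` for `t < -a`, and has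
  -- reached `v` at the origin by time `0`, because `3/8 - 1/8 = 1/4 ≥ v(0,0)`. The first contact
  -- time is the one sought.
  set φ : Space n × ℝ → ℝ := fun z => a + z.2 - ‖z.1 - y‖ ^ q with hφ
  have hφc : Continuous φ := by
    have := continuous_norm_rpow hp (by fun_prop : Continuous fun z : Space n × ℝ => z.1 - y)
    exact (by fun_prop : Continuous fun z : Space n × ℝ => a + z.2).sub this
  set K : Set (Space n × ℝ) := {z | z ∈ unitCyl n ∧ v z ≤ φ z} with hK
  have hKc : IsCompact K := (isCompact_unitCyl n).of_isClosed_subset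
    (isClosed_le_of_lsc (isCompact_unitCyl n).isClosed hv.lsc hφc) fun z hz => hz.1
  have hyq : ‖(0 : Space n) - y‖ ^ q ≤ 1 / 8 := by
    rw [zero_sub, norm_neg]
    rcases (norm_nonneg y).eq_or_lt with h | h
    · rw [← h, Real.zero_rpow (by linarith)]; norm_num
    · calc ‖y‖ ^ q ≤ ‖y‖ ^ (1 : ℝ) :=
            Real.rpow_le_rpow_of_exponent_ge h (by linarith) hq1.le
        _ ≤ 1 / 8 := by rw [Real.rpow_one]; exact hy.le
  have h0K : ((0 : Space n), (0 : ℝ)) ∈ K := by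
    refine ⟨⟨by simp, by simp⟩, ?_⟩
    simp only [hφ]
    linarith
  obtain ⟨⟨x, t⟩, hz, hmin⟩ := hKc.exists_isMinOn ⟨_, h0K⟩ continuous_snd.continuousOn
  -- Since `‖x - y‖ ≥ 7/8` and `q < 2`, the power is at least `49/64 > 3/4`; contact therefore
  -- happens away from the lateral boundary.
  have hlat : ∀ x : Space n, ‖x‖ = 1 → a < ‖x - y‖ ^ q := by
    intro x hx
    have h1 : 7 / 8 ≤ ‖x - y‖ := by
      have := norm_sub_norm_le x y
      linarith
    have h2 : (7 / 8 : ℝ) ^ (2 : ℝ) ≤ (7 / 8) ^ q :=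
      Real.rpow_le_rpow_of_exponent_ge (by norm_num) (by norm_num) hq2.le
    have h3 : (7 / 8 : ℝ) ^ q ≤ ‖x - y‖ ^ q := Real.rpow_le_rpow (by norm_num) h1 (by linarith)
    have h4 : (7 / 8 : ℝ) ^ (2 : ℝ) = 49 / 64 := by norm_num
    linarith
  have hvz0 := hv.nonneg _ hz.1
  have hvz : v (x, t) ≤ a + t - ‖x - y‖ ^ q := hz.2
  have hnn : 0 ≤ ‖x - y‖ ^ q := by positivity
  have ht0 : t ≤ 0 := hz.1.2.2
  have ht1 : -1 < t := by linarith
  have hx1 : ‖x‖ < 1 := by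
    refine lt_of_le_of_ne (by simpa using hz.1.1) fun h => ?_
    have := hlat x h
    linarith
  have hbefore : ∀ z ∈ unitCyl n, z.2 < t → φ z < v z := by
    intro z hzu hzt
    by_contra hcon
    push Not at hcon
    have := hmin (show z ∈ K from ⟨hzu, hcon⟩)
    simp only [mem_ofPred_eq] at this
    linarith
  -- Up to the contact time nothing is known about later values. Propagating the cusp from times `t₁
  -- < t`, where it lies below `v`, and letting `t₁` tend to `t` supplies the lower bound.
  have hafter : ∀ z ∈ unitCyl n, t ≤ z.2 → a + t - ‖z.1 - y‖ ^ q - C * (z.2 - t) ≤ v z := by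
    intro z hzu hzt
    have h1 : ∀ t₁ ∈ Ioo (-1) t, a + t₁ - ‖z.1 - y‖ ^ q - C * (z.2 - t₁) ≤ v z := by
      intro t₁ ht₁
      have := hv.propagate_cusp hp hLam (y := y) (b := a + t₁) (t₁ := t₁) (t₂ := 0)
        (Set.prod_mono le_rfl (Icc_subset_Icc_left ht₁.1.le)) ?_ ?_ hzu.1
        (t := z.2) ⟨by linarith [ht₁.2], hzu.2.2⟩
      · exact this
      · intro x' hx'
        exact (hbefore (x', t₁) ⟨hx', ht₁.1.le, by linarith [ht₁.2]⟩ ht₁.2).le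
      · intro x' hx'
        have := hlat x' hx'
        linarith [ht₁.2]
    have h2 : Tendsto (fun t₁ : ℝ => a + t₁ - ‖z.1 - y‖ ^ q - C * (z.2 - t₁)) (𝓝[<] t)
        (𝓝 (a + t - ‖z.1 - y‖ ^ q - C * (z.2 - t))) := by
      apply Tendsto.mono_left _ nhdsWithin_le_nhds
      exact Continuous.tendsto (by fun_prop) t
    exact le_of_tendsto h2 (by filter_upwards [Ioo_mem_nhdsLT ht1] with t₁ ht₁ using h1 t₁ ht₁)
  have heq : v (x, t) = a + t - ‖x - y‖ ^ q := by
    have := hafter _ hz.1 le_rfl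
    simp only [sub_self, mul_zero] at this
    linarith
  refine ⟨x, t, hx1, ht1, ht0, by linarith, ?_, by linarith⟩
  intro z hzu
  simp only
  rw [← hq, ← hC]
  rcases lt_or_ge z.2 t with h | h
  · have h1 := hbefore z hzu h
    simp only [hφ] at h1
    -- Before the contact time the cusp was lower by `t - z.2`, which `timeConst * |z.2 - t|`
    -- absorbs because the constant is at least `1`.
    rw [abs_of_neg (by linarith)]
    nlinarith
  · have h1 := hafter z hzu h
    rw [abs_of_nonneg (by linarith)]
    linarith

/-- Points of the cylinder at height at most one that are touched by a cusp whose vertex has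
distance at most `D`. -/
def contactSet (Lam p : ℝ) (v : Space n × ℝ → ℝ) (D : ℝ) : Set (Space n × ℝ) :=
  {z | z ∈ unitCyl n ∧ v z ≤ 1 ∧ ∃ y : Space n, ‖y‖ ≤ 1 / 8 ∧ ‖z.1 - y‖ ≤ D ∧ Contact Lam p v z y}

/-- Vertices converge along a subsequence by compactness. In the contact inequality, `v` at the
moving point occurs only on the smaller side, so lower semicontinuity suffices. -/
theorem isClosed_contactSet (hp : 2 < p) {v : Space n × ℝ → ℝ}
    (hv : LowerSemicontinuousOn v (unitCyl n)) (D : ℝ) : IsClosed (contactSet Lam p v D) := by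
  apply IsSeqClosed.isClosed
  intro zs z hzs hz
  choose h1 h2 y hy hyD hcon using hzs
  have hzu : z ∈ unitCyl n := (isCompact_unitCyl n).isClosed.mem_of_tendsto hz
    (Eventually.of_forall h1)
  have hwithin : Tendsto zs atTop (𝓝[unitCyl n] z) :=
    tendsto_nhdsWithin_of_tendsto_nhds_of_eventually_within _ hz (Eventually.of_forall h1)
  obtain ⟨y₀, hy₀, ψ, hψ, hlim⟩ := (isCompact_closedBall (0 : Space n) (1 / 8)).tendsto_subseq
    (fun k => mem_closedBall_zero_iff.2 (hy k))
  have hzψ : Tendsto (fun k => zs (ψ k)) atTop (𝓝 z) := hz.comp hψ.tendsto_atTop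
  have hsub : Tendsto (fun k => (zs (ψ k)).1 - y (ψ k)) atTop (𝓝 (z.1 - y₀)) :=
    ((continuous_fst.tendsto z).comp hzψ).sub hlim
  refine ⟨hzu, ?_, y₀, mem_closedBall_zero_iff.1 hy₀, ?_, ?_⟩
  · by_contra hlt
    push Not at hlt
    obtain ⟨k, hk⟩ := (hwithin.eventually (hv z hzu 1 hlt)).exists
    exact absurd (h2 k) (not_le.2 hk)
  · exact le_of_tendsto hsub.norm (Eventually.of_forall fun k => hyD (ψ k))
  · intro z' hz'
    rw [← sub_nonneg]
    apply le_of_forall_lt_imp_le_of_dense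
    intro c hc
    have hc' : v z + c < v z + 0 := by linarith
    set c' := v z + c with hcd
    have hlow : ∀ᶠ k in atTop, c' < v (zs (ψ k)) :=
      (hwithin.comp hψ.tendsto_atTop).eventually (hv z hzu c' (by simpa using hc'))
    have hL : Tendsto (fun k => v z' + ‖z'.1 - y (ψ k)‖ ^ dualExp p
        + timeConst n Lam p * |z'.2 - (zs (ψ k)).2| - ‖(zs (ψ k)).1 - y (ψ k)‖ ^ dualExp p) atTop
        (𝓝 (v z' + ‖z'.1 - y₀‖ ^ dualExp p
        + timeConst n Lam p * |z'.2 - z.2| - ‖z.1 - y₀‖ ^ dualExp p)) := by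
      have e0 : 0 ≤ dualExp p := by linarith [one_lt_dualExp hp]
      have e1 : Tendsto (fun k => ‖z'.1 - y (ψ k)‖ ^ dualExp p) atTop
          (𝓝 (‖z'.1 - y₀‖ ^ dualExp p)) :=
        ((tendsto_const_nhds.sub hlim).norm).rpow_const (Or.inr e0)
      have e2 : Tendsto (fun k => ‖(zs (ψ k)).1 - y (ψ k)‖ ^ dualExp p) atTop
          (𝓝 (‖z.1 - y₀‖ ^ dualExp p)) := hsub.norm.rpow_const (Or.inr e0)
      have e3 : Tendsto (fun k => |z'.2 - (zs (ψ k)).2|) atTop (𝓝 |z'.2 - z.2|) :=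
        (tendsto_const_nhds.sub ((continuous_snd.tendsto z).comp hzψ)).abs
      exact ((tendsto_const_nhds.add e1).add (tendsto_const_nhds.mul e3)).sub e2
    have := ge_of_tendsto hL (b := c') (by
      filter_upwards [hlow] with k hk
      have := hcon (ψ k) z' hz'
      linarith)
    linarith

end MeasureEstimate

/-! ### The basic measure estimate -/

section MeasureEstimate

variable {n : ℕ} {lam Lam p : ℝ}

/-- The points of the unit cylinder off its parabolic boundary. -/
def unitInt (n : ℕ) : Set (Space n × ℝ) := Metric.ball 0 1 ×ˢ Ioc (-1) 0

/-- `π` consists of the vertex and the height of a cusp that touches `v` at `z`. -/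
def IsCuspAt (Lam p : ℝ) (v : Space n × ℝ → ℝ) (z π : Space n × ℝ) : Prop :=
  Contact Lam p v z π.1 ∧ ‖π.1‖ ≤ 1 / 8 ∧ π.2 = v z + ‖z.1 - π.1‖ ^ dualExp p - z.2

theorem unique_of_mem_unitInt (hn : 1 ≤ n) (hp : 2 < p) (hlam : 0 < lam) (hLam : lam ≤ Lam)
    {v : Space n × ℝ → ℝ} (hv : IsSuper lam Lam p (unitCyl n) v) {z : Space n × ℝ}
    (hz : z ∈ unitInt n) {y₁ y₂ : Space n} (h1 : Contact Lam p v z y₁)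
    (h2 : Contact Lam p v z y₂) : y₁ = y₂ :=
  Contact.unique hn hp hlam hLam hv (x := z.1) (t := z.2) (by simpa using hz.1) hz.2.1 hz.2.2 h1 h2

theorem unitInt_subset : unitInt n ⊆ unitCyl n :=
  Set.prod_mono Metric.ball_subset_closedBall Ioc_subset_Icc_self

theorem measurableSet_contactSet (hp : 2 < p) {v : Space n × ℝ → ℝ}
    (hv : LowerSemicontinuousOn v (unitCyl n)) (D : ℝ) :
    MeasurableSet (contactSet Lam p v D ∩ unitInt n) :=
  (isClosed_contactSet hp hv D).measurableSet.inter
    (Metric.isOpen_ball.measurableSet.prod measurableSet_Ioc)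

/-- Heights of cusps that touch at their vertex. -/
theorem volume_vertex_le (hn : 1 ≤ n) (hp : 2 < p) (hlam : 0 < lam) (hLam : lam ≤ Lam)
    {v : Space n × ℝ → ℝ} (hv : IsSuper lam Lam p (unitCyl n) v) {P : Set (Space n × ℝ)}
    (hP : ∀ π ∈ P, ∃ z ∈ contactSet Lam p v 0 ∩ unitInt n, IsCuspAt Lam p v z π) :
    volume P ≤ ENNReal.ofReal ((3 * (timeConst n Lam p + 2)) ^ n * (9 * (timeConst n Lam p + 2)))
      * volume (contactSet Lam p v 0 ∩ unitInt n) := by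
  have hC1 : 1 ≤ timeConst n Lam p := one_le_timeConst hp (by linarith)
  have hvert : ∀ z ∈ contactSet Lam p v 0 ∩ unitInt n, Contact Lam p v z z.1 := by
    rintro z ⟨⟨-, -, y, -, hy, hc⟩, -⟩
    rw [norm_le_zero_iff, sub_eq_zero] at hy
    rwa [hy]
  -- At vertices the natural time scale is `r^q`. The vertex is the contact point itself, and
  -- testing two such points against each other makes `v` Hölder along them at exactly this scale.
  refine volume_le_of_contact (one_lt_dualExp hp).le (dualExp_lt_two hp).le one_pos (by linarith)
    _ P _ hP ?_
  intro z hz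
  refine ⟨1, one_pos, z.1, fun _ => v z - z.2, continuous_const, ?_⟩
  intro r hr _ z' hz' π _ hrel hx ht
  have hπ : π.1 = z'.1 := unique_of_mem_unitInt hn hp hlam hLam hv hz'.2 hrel.1 (hvert z' hz')
  have hq : (0 : ℝ) ^ dualExp p = 0 := Real.zero_rpow (by linarith [one_lt_dualExp hp])
  have h1 := hvert z hz z' hz'.1.1
  have h2 := hvert z' hz' z hz.1.1
  have hπ2 := hrel.2.2
  rw [hπ, sub_self, norm_zero, hq] at hπ2
  rw [sub_self, norm_zero, hq] at h1 h2
  rw [norm_sub_rev z.1 z'.1, abs_sub_comm z.2] at h2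
  have h3 : ‖z'.1 - z.1‖ ^ dualExp p ≤ r ^ dualExp p :=
    Real.rpow_le_rpow (norm_nonneg _) hx (by linarith [one_lt_dualExp hp])
  have h4 : timeConst n Lam p * |z'.2 - z.2| ≤ timeConst n Lam p * (1 * r ^ dualExp p) := by gcongr
  refine ⟨?_, ?_⟩
  · rw [hπ]
    refine hx.trans (le_mul_of_one_le_left hr.le (by linarith))
  · rw [hπ2, abs_le]
    have h5 := abs_le.1 ht
    constructor <;> linarith [h5.1, h5.2]

/-- Heights of cusps that touch at a distance between `d` and `2 d` from their vertex. -/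
theorem exists_volume_annulus_le (hn : 1 ≤ n) (hp : 2 < p) (hlam : 0 < lam) (hLam : lam ≤ Lam) :
    ∃ K : ℝ, 0 < K ∧ ∀ v : Space n × ℝ → ℝ, IsSuper lam Lam p (unitCyl n) v → ∀ d : ℝ, 0 < d →
      ∀ P A : Set (Space n × ℝ),
      A = (contactSet Lam p v (2 * d) ∩ unitInt n) \ (contactSet Lam p v d ∩ unitInt n) →
      (∀ π ∈ P, ∃ z ∈ A, IsCuspAt Lam p v z π) → volume P ≤ ENNReal.ofReal K * volume A := by
  obtain ⟨K, hK1, hK⟩ := exists_contact_estimate hn hp hlam hLam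
  refine ⟨(3 * (K + 1)) ^ n * (9 * (K + 1)), by positivity, ?_⟩
  intro v hv d hd P A hA hP
  set L := d ^ (dualExp p - 2) with hL
  have hL0 : 0 < L := Real.rpow_pos_of_pos hd _
  have hint : ∀ z ∈ A, z ∈ unitInt n := fun z hz => by
    rw [hA] at hz
    exact hz.1.2
  have hdist : ∀ z ∈ A, ∀ y, ‖y‖ ≤ 1 / 8 → Contact Lam p v z y →
      d ≤ ‖z.1 - y‖ ∧ ‖z.1 - y‖ ≤ 2 * d := by
    intro z hz y hy hc
    have hzi := hint z hz
    rw [hA] at hz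
    constructor
    · by_contra hlt
      push Not at hlt
      exact hz.2 ⟨⟨hz.1.1.1, hz.1.1.2.1, y, hy, hlt.le, hc⟩, hzi⟩
    · obtain ⟨y', -, hy', hc'⟩ := hz.1.1.2.2
      rwa [unique_of_mem_unitInt hn hp hlam hLam hv hzi hc hc']
  -- At distance of order `d` from the vertex the cusp is uniformly parabolic with time scale
  -- `d^(q-2) r²`. The factor `L` drops out of the volume comparison, so the constant is the same
  -- for all `d`.
  refine volume_le_of_contact (κ := 2) (by norm_num) le_rfl hL0 (by linarith) A P _ hP ?_
  intro z hz
  have hzi := hint z hz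
  obtain ⟨y, hy, hc⟩ : ∃ y, ‖y‖ ≤ 1 / 8 ∧ Contact Lam p v z y := by
    rw [hA] at hz
    obtain ⟨y, hy, -, hc⟩ := hz.1.1.2.2
    exact ⟨y, hy, hc⟩
  have hx1 : ‖z.1‖ < 1 := by simpa using hzi.1
  have ht1 : -1 < z.2 := hzi.2.1
  have hKL : 0 < K * L := by positivity
  -- The bounds on `r` keep the enlarged cylinder inside the unit cylinder and `K * r ≤ d`. The
  -- comparison function is the height of the cusp with vertex `y'` through the graph point over
  -- `z`.
  refine ⟨min 1 (min (d / K) (min ((1 - ‖z.1‖) / K) ((z.2 + 1) / (K * L)))), ?_, y,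
    fun y' => ‖z.1 - y'‖ ^ dualExp p + v z - z.2, ?_, ?_⟩
  · refine lt_min one_pos (lt_min (by positivity) (lt_min ?_ ?_))
    · exact div_pos (by linarith) (by linarith)
    · exact div_pos (by linarith) hKL
  · have := continuous_norm_rpow hp (by fun_prop : Continuous fun y' : Space n => z.1 - y')
    exact (this.add continuous_const).sub continuous_const
  · intro r hr hr0 z' hz' π _ hrel hx ht
    simp only [le_min_iff] at hr0
    obtain ⟨hr1, hr2, hr3, hr4⟩ := hr0
    rw [le_div_iff₀ (by linarith)] at hr2 hr3
    rw [le_div_iff₀ hKL] at hr4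
    rw [Real.rpow_two] at ht ⊢
    have hd1 := hdist z hz y hy hc
    have hd2 := hdist z' hz' π.1 hrel.2.1 hrel.1
    have hKLr : K * (L * r ^ 2) ≤ z.2 + 1 := by
      have : r ^ 2 ≤ r := by nlinarith
      calc K * (L * r ^ 2) = K * L * r ^ 2 := by ring
        _ ≤ K * L * r := by gcongr
        _ ≤ z.2 + 1 := by linarith
    have key := hK v hv d r hd hr (by linarith) z.1 z'.1 y π.1 z.2 z'.2 hc hrel.1
      (unitInt_subset (hint z' hz')) hd1.1 hd1.2 hd2.1 hd2.2 hx ht ?_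
    · refine ⟨key.1.trans (by nlinarith), ?_⟩
      have h5 := abs_le.1 key.2
      have h6 := abs_le.1 ht
      rw [hrel.2.2, abs_le]
      constructor <;> linarith [h5.1, h5.2, h6.1, h6.2]
    · rintro ⟨x', t'⟩ ⟨hx', ht'⟩
      refine ⟨?_, ?_, ?_⟩
      · rw [mem_closedBall_zero_iff]
        simp only [Metric.mem_closedBall, dist_eq_norm] at hx'
        have := norm_le_norm_add_norm_sub' x' z.1
        linarith
      · have := ht'.1
        simp only at this ⊢
        linarith
      · exact ht'.2.trans hzi.2.2

/-- The basic measure estimate: a supersolution that is small at the top centre of the unit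
cylinder is bounded on a set of positive measure. -/
theorem exists_measure_estimate (hn : 1 ≤ n) (hp : 2 < p) (hlam : 0 < lam) (hLam : lam ≤ Lam) :
    ∃ δ : ENNReal, 0 < δ ∧ δ ≠ ⊤ ∧ ∀ v : Space n × ℝ → ℝ, IsSuper lam Lam p (unitCyl n) v →
      v (0, 0) ≤ 1 / 4 → δ ≤ volume {z | z ∈ unitInt n ∧ v z ≤ 1} := by
  obtain ⟨K, hK0, hK⟩ := exists_volume_annulus_le hn hp hlam hLam
  set K₀ : ℝ := (3 * (timeConst n Lam p + 2)) ^ n * (9 * (timeConst n Lam p + 2)) with hK₀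
  have hC1 : 1 ≤ timeConst n Lam p := one_le_timeConst hp (by linarith)
  have hK₀0 : 0 < K₀ := by positivity
  set P : Set (Space n × ℝ) := Metric.ball 0 (1 / 8) ×ˢ Ioo (3 / 8) (3 / 4) with hP
  have hPvol : volume P = ENNReal.ofReal ((1 / 8) ^ n) * ballVol n * ENNReal.ofReal (3 / 8) := by
    rw [hP, Measure.volume_eq_prod, Measure.prod_prod, volume_ball_space _ (by norm_num),
      Real.volume_Ioo]
    norm_num
  have hPpos : 0 < volume P := by
    have hopen : IsOpen P := Metric.isOpen_ball.prod isOpen_Ioo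
    exact hopen.measure_pos _ ⟨(0, 1 / 2), by simp, by norm_num, by norm_num⟩
  have hPfin : volume P ≠ ⊤ := by
    rw [hPvol]
    exact ENNReal.mul_ne_top (ENNReal.mul_ne_top ENNReal.ofReal_ne_top ballVol_ne_top)
      ENNReal.ofReal_ne_top
  refine ⟨volume P / ENNReal.ofReal (K + K₀), ENNReal.div_pos hPpos.ne' ENNReal.ofReal_ne_top,
    ENNReal.div_ne_top hPfin (by simpa using by positivity), ?_⟩
  intro v hv h0
  set A : ℝ → Set (Space n × ℝ) := fun D => contactSet Lam p v D ∩ unitInt n with hA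
  have hAmono : Monotone A := by
    rintro D D' hDD z ⟨⟨h1, h2, y, h3, h4, h5⟩, h6⟩
    exact ⟨⟨h1, h2, y, h3, h4.trans hDD, h5⟩, h6⟩
  have hAmeas : ∀ D, MeasurableSet (A D) := fun D => measurableSet_contactSet hp hv.lsc D
  -- Contact points are sorted by the distance to their vertex, which is zero or lies in a dyadic
  -- shell below `2`, since `1 + 1/8 < 2`. Shells are disjoint and share one constant, so the
  -- volumes of the shells add up to at most that of the sublevel set.
  set d : ℕ → ℝ := fun j => (1 / 2) ^ j with hd
  have hd0 : ∀ j, 0 < d j := fun j => by positivity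
  set B : ℕ → Set (Space n × ℝ) := fun j => A (2 * d j) \ A (d j) with hB
  have hBmeas : ∀ j, MeasurableSet (B j) := fun j => (hAmeas _).diff (hAmeas _)
  have hBdisj : Pairwise (Function.onFun Disjoint B) := by
    have : ∀ i j, i < j → Disjoint (B i) (B j) := by
      intro i j hij
      rw [Set.disjoint_left]
      intro z hzi hzj
      refine hzi.2 (hAmono ?_ hzj.1)
      have h1 : d j ≤ d (i + 1) := pow_le_pow_of_le_one (by norm_num) (by norm_num) hij
      have h2 : d (i + 1) = d i * (1 / 2) := pow_succ _ _
      linarith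
    intro i j hij
    rcases lt_or_gt_of_ne hij with h | h
    · exact this i j h
    · exact (this j i h).symm
  set P₀ : Set (Space n × ℝ) := {π | π ∈ P ∧ ∃ z ∈ A 0, IsCuspAt Lam p v z π} with hP₀
  set Q : ℕ → Set (Space n × ℝ) := fun j => {π | π ∈ P ∧ ∃ z ∈ B j, IsCuspAt Lam p v z π} with hQ
  have hcover : P ⊆ P₀ ∪ ⋃ j, Q j := by
    intro π hπ
    have hπ1 : ‖π.1‖ < 1 / 8 := by simpa using hπ.1
    obtain ⟨x, t, hx, ht, ht0, hv1, hc, ha⟩ := exists_contact hp (by linarith) hv h0 hπ1 hπ.2.1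
      hπ.2.2
    have hzi : (x, t) ∈ unitInt n := ⟨by simpa using hx, ht, ht0⟩
    have hcusp : IsCuspAt Lam p v (x, t) π := ⟨hc, hπ1.le, ha⟩
    have hmem : ∀ D, ‖x - π.1‖ ≤ D → (x, t) ∈ A D := fun D hD =>
      ⟨⟨unitInt_subset hzi, hv1, π.1, hπ1.le, hD, hc⟩, hzi⟩
    have hmem' : ∀ D, (x, t) ∈ A D → ‖x - π.1‖ ≤ D := by
      rintro D ⟨⟨-, -, y, -, hyD, hc'⟩, -⟩
      rwa [unique_of_mem_unitInt hn hp hlam hLam hv hzi hc hc']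
    rcases (norm_nonneg (x - π.1)).eq_or_lt with h | h
    · left
      exact ⟨hπ, (x, t), hmem 0 h.symm.le, hcusp⟩
    · right
      have hlt2 : ‖x - π.1‖ ≤ 2 := by
        have := norm_sub_le x π.1
        linarith
      have hex : ∃ j, d j < ‖x - π.1‖ := by
        obtain ⟨j, hj⟩ := exists_pow_lt_of_lt_one h (by norm_num : (1 / 2 : ℝ) < 1)
        exact ⟨j, hj⟩
      classical
      refine mem_iUnion.2 ⟨Nat.find hex, hπ, (x, t), ⟨hmem _ ?_, fun hcon => ?_⟩, hcusp⟩
      · rcases Nat.eq_zero_or_pos (Nat.find hex) with h1 | h1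
        · rw [h1]
          simpa [hd] using hlt2
        · have h2 := Nat.find_min hex (Nat.sub_lt h1 one_pos)
          push Not at h2
          have h3 : d (Nat.find hex) = d (Nat.find hex - 1) * (1 / 2) := by
            simp only [hd]
            rw [← pow_succ, Nat.sub_add_cancel h1]
          linarith
      · exact absurd (hmem' _ hcon) (not_le.2 (Nat.find_spec hex))
  have hsub0 : A 0 ⊆ {z | z ∈ unitInt n ∧ v z ≤ 1} := fun z hz => ⟨hz.2, hz.1.2.1⟩
  have hsubB : (⋃ j, B j) ⊆ {z | z ∈ unitInt n ∧ v z ≤ 1} :=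
    iUnion_subset fun j z hz => ⟨hz.1.2, hz.1.1.2.1⟩
  set V := volume {z | z ∈ unitInt n ∧ v z ≤ 1} with hV
  have hfin : volume P ≤ ENNReal.ofReal (K + K₀) * V := by
    calc volume P ≤ volume P₀ + volume (⋃ j, Q j) :=
          (measure_mono hcover).trans (measure_union_le _ _)
      _ ≤ ENNReal.ofReal K₀ * V + ∑' j, volume (Q j) := by
        gcongr
        · refine (volume_vertex_le hn hp hlam hLam hv fun π hπ => hπ.2).trans ?_
          exact mul_le_mul_right (measure_mono hsub0) _
        · exact measure_iUnion_le _
      _ ≤ ENNReal.ofReal K₀ * V + ∑' j, ENNReal.ofReal K * volume (B j) := by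
        gcongr with j
        exact hK v hv (d j) (hd0 j) (Q j) (B j) rfl fun π hπ => hπ.2
      _ = ENNReal.ofReal K₀ * V + ENNReal.ofReal K * volume (⋃ j, B j) := by
        rw [ENNReal.tsum_mul_left, measure_iUnion hBdisj hBmeas]
      _ ≤ ENNReal.ofReal K₀ * V + ENNReal.ofReal K * V := by
        gcongr
        exact measure_mono hsubB
      _ = ENNReal.ofReal (K + K₀) * V := by
        rw [ENNReal.ofReal_add hK0.le hK₀0.le]
        ring
  rw [ENNReal.div_le_iff (by simpa using by positivity) ENNReal.ofReal_ne_top, mul_comm]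
  exact hfin

end MeasureEstimate

/-! ### Self-similar barriers and radial test functions -/

section Barrier

/-- Parameters of an expanding self-similar strict subsolution with profile
`(b - σ)² - (b - 4)²`, where `σ` is the square of the self-similar variable. -/
structure BarrierParam (n : ℕ) (lam Lam p : ℝ) where
  α : ℝ
  β : ℝ
  ε : ℝ
  b : ℝ
  α_pos : 0 < α
  β_pos : 0 < β
  β_le : β ≤ 1 / 100
  exponents : (p - 2) * α + p * β = 1
  ε_pos : 0 < ε
  b_gt : 4 < b
  ε_le : ε * b ^ 2 ≤ 1
  strict : ∀ σ, 0 ≤ σ → σ < 4 →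
    -α * ((b - σ) ^ 2 - (b - 4) ^ 2) + 4 * β * σ * (b - σ) <
      (4 * ε * ((b - σ) * √σ)) ^ (p - 2) * (8 * lam * σ - 4 * n * Lam * (b - σ))

-- With `κ = lam / (n * Lam)` and `b = 4 + κ`, two regions balance differently. Near the edge of the
-- support, `σ ≥ 4 - κ`, the radial convexity `8 * lam * σ` beats `4 * n * Lam * (b - σ)` and small
-- `β` keeps the transport term below it. Further inside, the decay term with `α ≥ 1 / (2 * (p -
-- 2))` dominates, once `ε` makes the possibly negative diffusion small and `β` makes the transport
-- small.
set_option maxHeartbeats 400000 in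
theorem exists_barrierParam {n : ℕ} {lam Lam p : ℝ} (hn : 1 ≤ n) (hp : 2 < p) (hlam : 0 < lam)
    (hLam : lam ≤ Lam) : Nonempty (BarrierParam n lam Lam p) := by
  have hLam0 : 0 < Lam := by linarith
  have hn0 : (1 : ℝ) ≤ n := by exact_mod_cast hn
  have hp2 : 0 < p - 2 := by linarith
  set κ := lam / (n * Lam) with hκ
  have hκ0 : 0 < κ := by positivity
  have hκ1 : κ ≤ 1 := by
    rw [hκ, div_le_one (by positivity)]
    nlinarith
  have hκn : n * Lam * κ = lam := by rw [hκ]; field_simp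
  -- the height `ε`
  set c := κ ^ 2 / (40 * (p - 2) * n * Lam) with hc
  have hc0 : 0 < c := by positivity
  set ε := min (1 / 25) (c ^ (1 / (p - 2)) / 40) with hε
  have hε0 : 0 < ε := lt_min (by norm_num) (by positivity)
  have hεc : (40 * ε) ^ (p - 2) * (20 * n * Lam) ≤ κ ^ 2 / (2 * (p - 2)) := by
    have h1 : 40 * ε ≤ c ^ (1 / (p - 2)) := by
      have := min_le_right (1 / 25 : ℝ) (c ^ (1 / (p - 2)) / 40)
      linarith
    have h2 : (40 * ε) ^ (p - 2) ≤ c := by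
      calc (40 * ε) ^ (p - 2) ≤ (c ^ (1 / (p - 2))) ^ (p - 2) :=
            Real.rpow_le_rpow (by positivity) h1 hp2.le
        _ = c := by
          rw [← Real.rpow_mul hc0.le, one_div, inv_mul_cancel₀ hp2.ne', Real.rpow_one]
    calc (40 * ε) ^ (p - 2) * (20 * n * Lam) ≤ c * (20 * n * Lam) := by gcongr
      _ = κ ^ 2 / (2 * (p - 2)) := by rw [hc]; field_simp; norm_num
  set m := (4 * ε * κ) ^ (p - 2) with hm
  have hm0 : 0 < m := by positivity
  set β := min (1 / (2 * p)) (min (1 / 100) (min (m * lam / 4) (κ ^ 2 / (160 * (p - 2))))) with hβ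
  have hβ1 : β ≤ 1 / (2 * p) := min_le_left _ _
  have hβ2 : β ≤ 1 / 100 := (min_le_right _ _).trans (min_le_left _ _)
  have hβ3 : β ≤ m * lam / 4 := (min_le_right _ _).trans ((min_le_right _ _).trans (min_le_left _ _))
  have hβ4 : β ≤ κ ^ 2 / (160 * (p - 2)) :=
    (min_le_right _ _).trans ((min_le_right _ _).trans (min_le_right _ _))
  have hβ0 : 0 < β := lt_min (by positivity) (lt_min (by norm_num)
    (lt_min (by positivity) (by positivity)))
  have hpβ : p * β ≤ 1 / 2 := by
    have := mul_le_mul_of_nonneg_left hβ1 (by linarith : 0 ≤ p)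
    have h2 : p * (1 / (2 * p)) = 1 / 2 := by field_simp
    linarith
  set α := (1 - p * β) / (p - 2) with hα
  have hα1 : 1 / (2 * (p - 2)) ≤ α := by
    rw [hα, div_le_div_iff₀ (by positivity) hp2]
    nlinarith
  have hα0 : 0 < α := lt_of_lt_of_le (by positivity) hα1
  refine ⟨⟨α, β, ε, 4 + κ, hα0, hβ0, hβ2, ?_, hε0, by linarith, ?_, ?_⟩⟩
  · rw [hα]; field_simp; ring
  · have h1 : ε ≤ 1 / 25 := min_le_left _ _
    have h2 : (4 + κ) ^ 2 ≤ 25 := by nlinarith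
    calc ε * (4 + κ) ^ 2 ≤ 1 / 25 * 25 := by gcongr
      _ = 1 := by norm_num
  · intro σ hσ0 hσ4
    set B := 4 + κ - σ with hB
    have hB0 : κ < B := by linarith
    have hBp : 0 < B := by linarith
    rcases le_total (4 - κ) σ with h | h
    · have h1 : B ≤ 2 * κ := by linarith
      have h2 : 16 * lam ≤ 8 * lam * σ - 4 * n * Lam * B := by
        have h3 : 4 * n * Lam * B ≤ 4 * n * Lam * (2 * κ) := by gcongr
        have h4 : 8 * lam * 3 ≤ 8 * lam * σ := by gcongr; linarith
        linarith
      have h3 : m ≤ (4 * ε * (B * √σ)) ^ (p - 2) := by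
        apply Real.rpow_le_rpow (by positivity) _ hp2.le
        have : 1 ≤ √σ := by
          rw [Real.one_le_sqrt]; linarith
        have h4 : B * 1 ≤ B * √σ := by gcongr
        have : κ ≤ B * √σ := by linarith
        gcongr
      have h4 : m * (16 * lam) ≤ (4 * ε * (B * √σ)) ^ (p - 2) * (8 * lam * σ - 4 * n * Lam * B) := by
        gcongr
      have h5 : 0 ≤ α * (B ^ 2 - (4 + κ - 4) ^ 2) := by
        apply mul_nonneg hα0.le
        nlinarith
      have h6 : 4 * β * σ * B ≤ 4 * β * 4 * (2 * κ) := by gcongr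
      have h7 := mul_le_mul_of_nonneg_left hκ1 hβ0.le
      have h8 : 0 < m * lam := by positivity
      linarith
    · have h1 : 2 * κ ≤ B := by linarith
      have hB5 : B ≤ 5 := by linarith
      have h2 : 3 * κ ^ 2 ≤ B ^ 2 - (4 + κ - 4) ^ 2 := by nlinarith
      have h3 : 4 * β * σ * B ≤ 4 * β * 4 * 5 := by gcongr
      have h4 : (4 * ε * (B * √σ)) ^ (p - 2) ≤ (40 * ε) ^ (p - 2) := by
        apply Real.rpow_le_rpow (by positivity) _ hp2.le
        have : √σ ≤ 2 := by
          rw [Real.sqrt_le_iff]; constructor <;> linarith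
        calc 4 * ε * (B * √σ) ≤ 4 * ε * (5 * 2) := by gcongr
          _ = 40 * ε := by ring
      have h5 : -(20 * n * Lam) ≤ 8 * lam * σ - 4 * n * Lam * B := by
        have : 4 * n * Lam * B ≤ 4 * n * Lam * 5 := by gcongr
        have : 0 ≤ 8 * lam * σ := by positivity
        linarith
      have h6 : -(κ ^ 2 / (2 * (p - 2))) ≤
          (4 * ε * (B * √σ)) ^ (p - 2) * (8 * lam * σ - 4 * n * Lam * B) := by
        have h7 : 0 ≤ (4 * ε * (B * √σ)) ^ (p - 2) := by positivity
        have h8 := mul_le_mul_of_nonneg_left h5 h7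
        have h9 : (4 * ε * (B * √σ)) ^ (p - 2) * (20 * n * Lam)
          ≤ (40 * ε) ^ (p - 2) * (20 * n * Lam) := by gcongr
        linarith
      have h7 : 1 / (2 * (p - 2)) * (3 * κ ^ 2) ≤ α * (B ^ 2 - (4 + κ - 4) ^ 2) := by gcongr
      have h8 : 80 * (κ ^ 2 / (160 * (p - 2))) = κ ^ 2 / (2 * (p - 2)) := by
        field_simp; norm_num
      have h9 : 1 / (2 * (p - 2)) * (3 * κ ^ 2) = 3 * (κ ^ 2 / (2 * (p - 2))) := by ring
      have h10 : 0 < κ ^ 2 / (2 * (p - 2)) := by positivity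
      linarith

/-- First-order expansion in time, uniformly in space. -/
theorem time_expansion {n : ℕ} {c : ℝ → ℝ} {c' t : ℝ} (hc : HasDerivAt c c' t)
    {g : Space n → ℝ} (hg : Continuous g) (x : Space n) {δ : ℝ} (hδ : 0 < δ) :
    ∃ η > 0, ∀ (h : Space n) (s : ℝ), ‖h‖ < η → 0 ≤ s → s < η →
      -(c' * g x) * s - δ * s ≤ (c (t - s) - c t) * g (x + h) := by
  set δ₁ := δ / (2 * (|g x| + 1)) with hδ₁
  have hδ₁0 : 0 < δ₁ := by positivity
  set δ₂ := min 1 (δ / (2 * (|c'| + 1))) with hδ₂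
  have hδ₂0 : 0 < δ₂ := by positivity
  have h1 := (hasDerivAt_iff_isLittleO.1 hc).def hδ₁0
  rw [Metric.eventually_nhds_iff] at h1
  obtain ⟨η₁, hη₁, h1⟩ := h1
  obtain ⟨η₂, hη₂, h2⟩ := Metric.continuousAt_iff.1 hg.continuousAt δ₂ hδ₂0
  refine ⟨min η₁ η₂, lt_min hη₁ hη₂, fun h s hh hs0 hs => ?_⟩
  have e1 := h1 (y := t - s) (by
    rw [Real.dist_eq]
    rw [sub_sub_cancel_left, abs_neg, abs_of_nonneg hs0]
    exact lt_of_lt_of_le hs (min_le_left _ _))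
  have e2 := h2 (x := x + h) (by
    rw [dist_eq_norm]
    rw [add_sub_cancel_left]
    exact lt_of_lt_of_le hh (min_le_right _ _))
  rw [Real.dist_eq] at e2
  set ρ := c (t - s) - c t + c' * s with hρ
  have hρs : |ρ| ≤ δ₁ * s := by
    have e3 : c (t - s) - c t - (t - s - t) • c' = ρ := by rw [hρ, smul_eq_mul]; ring
    rwa [e3, sub_sub_cancel_left, norm_neg, Real.norm_eq_abs, Real.norm_eq_abs,
      abs_of_nonneg hs0] at e1
  have hg1 : |g (x + h)| ≤ |g x| + 1 := by
    have h3 : |g (x + h)| ≤ |g x| + |g (x + h) - g x| := by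
      have := abs_add_le (g x) (g (x + h) - g x)
      simpa using this
    have h4 : δ₂ ≤ 1 := min_le_left _ _
    linarith
  have h5 : |ρ * g (x + h)| ≤ δ / 2 * s := by
    rw [abs_mul]
    calc |ρ| * |g (x + h)| ≤ δ₁ * s * (|g x| + 1) := by gcongr
      _ = δ / 2 * s := by rw [hδ₁]; field_simp
  have h6 : |c' * (g (x + h) - g x) * s| ≤ δ / 2 * s := by
    rw [abs_mul, abs_mul, abs_of_nonneg hs0]
    gcongr
    calc |c'| * |g (x + h) - g x| ≤ (|c'| + 1) * (δ / (2 * (|c'| + 1))) := by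
          gcongr
          · linarith
          · exact e2.le.trans (min_le_right _ _)
      _ = δ / 2 := by field_simp
  have h7 := abs_le.1 h5
  have h8 := abs_le.1 h6
  have h9 : (c (t - s) - c t) * g (x + h)
      = ρ * g (x + h) - c' * (g (x + h) - g x) * s - c' * g x * s := by rw [hρ]; ring
  rw [h9]
  linarith [h7.1, h8.2]

variable {n : ℕ} {lam Lam p : ℝ}

/-- The self-similar barrier. -/
def BarrierParam.fn (κ : BarrierParam n lam Lam p) (z : Space n × ℝ) : ℝ :=
  κ.ε * (1 + z.2) ^ (-κ.α) *
    ((κ.b - ‖z.1‖ ^ 2 * (1 + z.2) ^ (-(2 * κ.β))) ^ 2 - (κ.b - 4) ^ 2)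

theorem rpow_neg_hasDerivAt (k μ : ℝ) {t : ℝ} (ht : 0 < 1 + t) :
    HasDerivAt (fun t => k * (1 + t) ^ (-μ)) (-(k * μ * (1 + t) ^ (-μ) / (1 + t))) t := by
  have h1 : HasDerivAt (fun t : ℝ => 1 + t) 1 t := (hasDerivAt_id t).const_add 1
  have h2 := (h1.rpow_const (p := -μ) (Or.inl ht.ne')).const_mul k
  refine h2.congr_deriv ?_
  rw [Real.rpow_sub_one ht.ne']
  ring

/-- A quartic radial polynomial with time-dependent coefficients that touches a supersolution
from below is not a strict subsolution. -/
theorem IsSuper.test_radial {S : Set (Space n × ℝ)} {v : Space n × ℝ → ℝ}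
    (hv : IsSuper lam Lam p S v) {x : Space n} {t : ℝ} (hx : (x, t) ∈ S)
    {c₀ c₁ c₂ : ℝ → ℝ} {d₀ d₁ d₂ : ℝ} (h₀ : HasDerivAt c₀ d₀ t) (h₁ : HasDerivAt c₁ d₁ t)
    (h₂ : HasDerivAt c₂ d₂ t) (hc₂ : 0 ≤ c₂ t) (hA : c₁ t + 2 * c₂ t * ‖x‖ ^ 2 ≤ 0) {η : ℝ}
    (hη : 0 < η)
    (H : ∀ (h : Space n) (s : ℝ), ‖h‖ < η → 0 ≤ s → s < η →
      v (x, t) - (c₀ t + c₁ t * ‖x‖ ^ 2 + c₂ t * ‖x‖ ^ 4)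
        + (c₀ (t - s) + c₁ (t - s) * ‖x + h‖ ^ 2 + c₂ (t - s) * ‖x + h‖ ^ 4) ≤ v (x + h, t - s)) :
    (-(2 * (c₁ t + 2 * c₂ t * ‖x‖ ^ 2)) * ‖x‖) ^ (p - 2) *
      (8 * lam * c₂ t * ‖x‖ ^ 2 + 2 * n * Lam * (c₁ t + 2 * c₂ t * ‖x‖ ^ 2))
      ≤ d₀ + d₁ * ‖x‖ ^ 2 + d₂ * ‖x‖ ^ 4 := by
  -- The gradient of the radial polynomial is `2 a x` and its Hessian `2 a I + 8 c₂ x ⊗ x`, hence `A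
  -- = -a` and `B = 4 c₂`. The cubic remainder goes into the error; the quartic one has a good sign.
  set a := c₁ t + 2 * c₂ t * ‖x‖ ^ 2 with ha
  have key := hv.test_approx hx (τ := d₀ + d₁ * ‖x‖ ^ 2 + d₂ * ‖x‖ ^ 4) (ξ := (2 * a) • x) (e := x)
    (A := -a) (B := 4 * c₂ t) (by linarith) (by linarith) ?_
  · rw [norm_smul, Real.norm_eq_abs, abs_of_nonpos (by linarith)] at key
    refine le_trans (le_of_eq ?_) key
    ring
  · intro δ hδ
    obtain ⟨η₀, hη₀, e₀⟩ := time_expansion h₀ (g := fun _ : Space n => (1 : ℝ)) continuous_const x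
      (by positivity : 0 < δ / 3)
    obtain ⟨η₁, hη₁, e₁⟩ := time_expansion h₁ (g := fun x : Space n => ‖x‖ ^ 2) (by fun_prop) x
      (by positivity : 0 < δ / 3)
    obtain ⟨η₂, hη₂, e₂⟩ := time_expansion h₂ (g := fun x : Space n => ‖x‖ ^ 4) (by fun_prop) x
      (by positivity : 0 < δ / 3)
    set η₃ := δ / (4 * c₂ t * ‖x‖ + 1) with hη₃
    have hη₃0 : 0 < η₃ := by positivity
    refine ⟨min η (min η₀ (min η₁ (min η₂ η₃))), by positivity, fun h s hh hs0 hs => ?_⟩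
    simp only [lt_min_iff] at hh hs
    have f₀ := e₀ h s hh.2.1 hs0 hs.2.1
    have f₁ := e₁ h s hh.2.2.1 hs0 hs.2.2.1
    have f₂ := e₂ h s hh.2.2.2.1 hs0 hs.2.2.2.1
    have f := H h s hh.1 hs0 hs.1
    have hcub : 4 * c₂ t * ‖x‖ * ‖h‖ ≤ δ := by
      have h3 := hh.2.2.2.2.le
      rw [hη₃, le_div_iff₀ (by positivity)] at h3
      have := norm_nonneg h
      linarith
    have hin : |inner ℝ x h| ≤ ‖x‖ * ‖h‖ := abs_real_inner_le_norm x h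
    have hin1 := abs_le.1 hin
    have hnx : ‖x + h‖ ^ 2 = ‖x‖ ^ 2 + (2 * inner ℝ x h + ‖h‖ ^ 2) := by
      rw [norm_add_sq_real]; ring
    set i := inner ℝ x h with hi
    have hn4 : ‖x + h‖ ^ 4 = (‖x‖ ^ 2 + (2 * i + ‖h‖ ^ 2)) ^ 2 := by
      rw [← hnx]; ring
    have hspace : c₁ t * ‖x + h‖ ^ 2 + c₂ t * ‖x + h‖ ^ 4 - c₁ t * ‖x‖ ^ 2 - c₂ t * ‖x‖ ^ 4
        ≥ 2 * a * i + a * ‖h‖ ^ 2 + 4 * c₂ t * i ^ 2 - δ * ‖h‖ ^ 2 := by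
      have e3 : c₁ t * ‖x + h‖ ^ 2 + c₂ t * ‖x + h‖ ^ 4 - c₁ t * ‖x‖ ^ 2 - c₂ t * ‖x‖ ^ 4
          = 2 * a * i + a * ‖h‖ ^ 2 + 4 * c₂ t * i ^ 2
            + (4 * c₂ t * i * ‖h‖ ^ 2 + c₂ t * ‖h‖ ^ 4) := by
        rw [hn4, hnx, ha]; ring
      have e4 : -(δ * ‖h‖ ^ 2) ≤ 4 * c₂ t * i * ‖h‖ ^ 2 := by
        have h5 : -(4 * c₂ t * ‖x‖ * ‖h‖) ≤ 4 * c₂ t * i := by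
          have := mul_le_mul_of_nonneg_left hin1.1 (by positivity : 0 ≤ 4 * c₂ t)
          linarith
        have h6 := mul_le_mul_of_nonneg_right (by linarith : -δ ≤ 4 * c₂ t * i)
          (by positivity : 0 ≤ ‖h‖ ^ 2)
        linarith
      have e5 : 0 ≤ c₂ t * ‖h‖ ^ 4 := by positivity
      rw [e3]
      linarith
    have e6 : inner ℝ ((2 * a) • x) h = 2 * a * i := by
      rw [inner_smul_left]
      simp [hi]
    rw [e6]
    linarith

end Barrier

/-! ### Comparison with the barrier and expansion of positivity -/

section Barrier

variable {n : ℕ} {lam Lam p : ℝ}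

theorem continuous_one_add_rpow {β : ℝ} (hβ : 0 < β) {X : Type*} [TopologicalSpace X] {f : X → ℝ}
    (hf : Continuous f) : Continuous fun z : X => (1 + f z) ^ β :=
  Continuous.rpow_const (by fun_prop) fun _ => Or.inr hβ.le

theorem rpow_neg_two_mul {T : ℝ} (hT : 0 < T) (β : ℝ) : T ^ (-(2 * β)) * (T ^ β) ^ 2 = 1 := by
  rw [← Real.rpow_natCast, ← Real.rpow_mul hT.le, ← Real.rpow_add hT]
  have : -(2 * β) + β * ((2 : ℕ) : ℝ) = 0 := by push_cast; ring
  rw [this, Real.rpow_zero]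

set_option maxHeartbeats 400000 in
/-- The barrier stays below a supersolution that is initially at least one on its support. -/
theorem IsSuper.barrier_le (κ : BarrierParam n lam Lam p) {S : Set (Space n × ℝ)}
    {v : Space n × ℝ → ℝ} (hv : IsSuper lam Lam p S v) {T : ℝ}
    (hS : ∀ x t, 0 ≤ t → t ≤ T → ‖x‖ ≤ 2 * (1 + t) ^ κ.β → (x, t) ∈ S)
    (h0 : ∀ x : Space n, ‖x‖ ≤ 2 → 1 ≤ v (x, 0)) {x : Space n} {t : ℝ} (ht : 0 ≤ t) (htT : t ≤ T)
    (hx : ‖x‖ ≤ 2 * (1 + t) ^ κ.β) : κ.fn (x, t) ≤ v (x, t) := by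
  have hα := κ.α_pos
  have hβ := κ.β_pos
  have hexp := κ.exponents
  have hε := κ.ε_pos
  have hb := κ.b_gt
  have hεb := κ.ε_le
  have hstrict := κ.strict
  by_contra hcon
  push Not at hcon
  rw [BarrierParam.fn] at hcon
  set α := κ.α
  set β := κ.β
  set ε := κ.ε
  set b := κ.b
  set w : Space n × ℝ → ℝ := fun z => ε * (1 + z.2) ^ (-α) *
    ((b - ‖z.1‖ ^ 2 * (1 + z.2) ^ (-(2 * β))) ^ 2 - (b - 4) ^ 2) with hw
  have hcon' : v (x, t) < w (x, t) := hcon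
  set K : Set (Space n × ℝ) := {z | z.2 ∈ Icc 0 T ∧ ‖z.1‖ ≤ 2 * (1 + z.2) ^ β} with hK
  have hcont : Continuous fun z : Space n × ℝ => 2 * (1 + z.2) ^ β :=
    continuous_const.mul (continuous_one_add_rpow hβ continuous_snd)
  have hKcl : IsClosed K := (isClosed_Icc.preimage continuous_snd).inter
    (isClosed_le continuous_fst.norm hcont)
  have hKc : IsCompact K := by
    refine ((isCompact_closedBall (0 : Space n) (2 * (1 + T) ^ β)).prod
      (isCompact_Icc (a := (0 : ℝ)) (b := T))).of_isClosed_subset hKcl ?_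
    rintro z ⟨hz1, hz2⟩
    refine ⟨?_, hz1⟩
    rw [mem_closedBall_zero_iff]
    refine hz2.trans ?_
    have := hz1.1
    gcongr
    exact hz1.2
  have hKS : K ⊆ S := fun z hz => hS z.1 z.2 hz.1.1 hz.1.2 hz.2
  have hwc : ContinuousOn w K := by
    have h1 : ∀ μ : ℝ, ContinuousOn (fun z : Space n × ℝ => (1 + z.2) ^ μ) K := fun μ =>
      ContinuousOn.rpow_const (by fun_prop) fun z hz => Or.inl (by linarith [hz.1.1])
    have h2 := h1 (-α)
    have h3 := h1 (-(2 * β))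
    have h4 : ContinuousOn (fun z : Space n × ℝ => ‖z.1‖ ^ 2) K := by fun_prop
    exact (continuousOn_const.mul h2).mul (((continuousOn_const.sub (h4.mul h3)).pow 2).sub
      continuousOn_const)
  -- A negative minimum avoids the edge `σ = 4`, where the barrier vanishes, and the initial time,
  -- where `ε * b ^ 2 ≤ 1` keeps it below `v`. It is thus tested in a backward neighbourhood inside
  -- `K`.
  obtain ⟨⟨x', t'⟩, hz, hmin⟩ := exists_min_sub hKc ⟨(x, t), ⟨ht, htT⟩, hx⟩ (hv.lsc.mono hKS) hwc
  have hneg : v (x', t') < w (x', t') := by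
    have := hmin (x, t) ⟨⟨ht, htT⟩, hx⟩
    linarith
  have ht'0 : 0 ≤ t' := hz.1.1
  have hx' : ‖x'‖ ≤ 2 * (1 + t') ^ β := hz.2
  set T₁ := 1 + t' with hT₁
  have hT₁0 : 0 < T₁ := by linarith
  set a := T₁ ^ (-α) with ha
  have ha0 : 0 < a := Real.rpow_pos_of_pos hT₁0 _
  set g := T₁ ^ (-(2 * β)) with hg
  have hg0 : 0 < g := Real.rpow_pos_of_pos hT₁0 _
  have hgβ : g * (T₁ ^ β) ^ 2 = 1 := rpow_neg_two_mul hT₁0 β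
  set σ := ‖x'‖ ^ 2 * g with hσ
  have hσ0 : 0 ≤ σ := by positivity
  have hσ4 : σ ≤ 4 := by
    calc σ ≤ (2 * T₁ ^ β) ^ 2 * g := by rw [hσ]; gcongr
      _ = 4 * (g * (T₁ ^ β) ^ 2) := by ring
      _ = 4 := by rw [hgβ, mul_one]
  have hwz : w (x', t') = ε * a * ((b - σ) ^ 2 - (b - 4) ^ 2) := rfl
  have hσlt : σ < 4 := by
    refine lt_of_le_of_ne hσ4 fun h => ?_
    rw [hwz, h] at hneg
    have := hv.nonneg _ (hKS hz)
    linarith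
  have ht'lt : 0 < t' := by
    refine lt_of_le_of_ne ht'0 fun h => ?_
    have h1 : T₁ = 1 := by rw [hT₁, ← h, add_zero]
    have h2 : a = 1 := by rw [ha, h1, Real.one_rpow]
    have h3 : ‖x'‖ ≤ 2 := by rwa [h1, Real.one_rpow, mul_one] at hx'
    have h4 := h0 x' h3
    rw [← h] at hneg hwz
    rw [hwz, h2] at hneg
    have h5 : (b - σ) ^ 2 - (b - 4) ^ 2 ≤ b ^ 2 := by nlinarith
    have h6 : ε * ((b - σ) ^ 2 - (b - 4) ^ 2) ≤ ε * b ^ 2 := by gcongr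
    linarith
  have hxlt : ‖x'‖ < 2 * T₁ ^ β := by
    refine lt_of_le_of_ne hx' fun h => ?_
    have : σ = 4 := by
      calc σ = 4 * (g * (T₁ ^ β) ^ 2) := by rw [hσ, h]; ring
        _ = 4 := by rw [hgβ, mul_one]
    linarith
  -- a backward neighbourhood inside `K`
  have hnhds : ∀ᶠ z : Space n × ℝ in 𝓝 (x', t'), 0 < z.2 ∧ ‖z.1‖ < 2 * (1 + z.2) ^ β :=
    ((continuous_snd.tendsto (x', t')).eventually (lt_mem_nhds ht'lt)).and
      ((continuous_fst.norm.tendsto (x', t')).eventually_lt (hcont.tendsto (x', t')) hxlt)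
  obtain ⟨η, hη, hball⟩ := Metric.eventually_nhds_iff.1 hnhds
  have test := hv.test_radial (hKS hz)
    (rpow_neg_hasDerivAt (ε * (b ^ 2 - (b - 4) ^ 2)) α hT₁0)
    (rpow_neg_hasDerivAt (-(2 * b * ε)) (α + 2 * β) hT₁0)
    (rpow_neg_hasDerivAt ε (α + 4 * β) hT₁0) (by positivity) ?_ hη ?_
  · have e1 : T₁ ^ (-(α + 2 * β)) = a * g := by
      rw [ha, hg, ← Real.rpow_add hT₁0]; congr 1; ring
    have e2 : T₁ ^ (-(α + 4 * β)) = a * g ^ 2 := by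
      rw [ha, hg, ← Real.rpow_natCast, ← Real.rpow_mul hT₁0.le, ← Real.rpow_add hT₁0]
      congr 1; push_cast; ring
    simp only [← hT₁, e1, e2] at test
    rw [← ha] at test
    have e3 : -(2 * (-(2 * b * ε) * (a * g) + 2 * (ε * (a * g ^ 2)) * ‖x'‖ ^ 2)) * ‖x'‖
        = 4 * ε * ((b - σ) * √σ) * T₁ ^ (-(α + β)) := by
      have h1 : √σ = ‖x'‖ * T₁ ^ (-β) := by
        rw [hσ, Real.sqrt_mul (by positivity), Real.sqrt_sq (norm_nonneg _), Real.sqrt_eq_rpow, hg,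
          ← Real.rpow_mul hT₁0.le]
        congr 2
        ring
      have h2 : T₁ ^ (-β) * T₁ ^ (-(α + β)) = a * g := by
        rw [ha, hg, ← Real.rpow_add hT₁0, ← Real.rpow_add hT₁0]; congr 1; ring
      calc _ = 4 * ε * (b - ‖x'‖ ^ 2 * g) * ‖x'‖ * (a * g) := by ring
        _ = _ := by rw [← h2, h1, ← hσ]; ring
    have e4 : 8 * lam * (ε * (a * g ^ 2)) * ‖x'‖ ^ 2 + 2 * n * Lam *
        (-(2 * b * ε) * (a * g) + 2 * (ε * (a * g ^ 2)) * ‖x'‖ ^ 2)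
        = ε * (a * g) * (8 * lam * σ - 4 * n * Lam * (b - σ)) := by rw [hσ]; ring
    have e5 : -(ε * (b ^ 2 - (b - 4) ^ 2) * α * a / T₁)
        + -(-(2 * b * ε) * (α + 2 * β) * (a * g) / T₁) * ‖x'‖ ^ 2
        + -(ε * (α + 4 * β) * (a * g ^ 2) / T₁) * ‖x'‖ ^ 4
        = ε * a / T₁ * (-α * ((b - σ) ^ 2 - (b - 4) ^ 2) + 4 * β * σ * (b - σ)) := by
      rw [hσ]; ring
    have hbσ : 0 < b - σ := by linarith
    -- The relation `(p - 2) α + p β = 1` makes all terms scale alike in time; what remains is the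
    -- stationary inequality `strict`.
    have e6 : (T₁ ^ (-(α + β))) ^ (p - 2) * g = 1 / T₁ := by
      rw [hg, ← Real.rpow_mul hT₁0.le, ← Real.rpow_add hT₁0, one_div, ← Real.rpow_neg_one]
      congr 1
      linarith
    rw [e3, e4, e5, Real.mul_rpow (by positivity) (by positivity)] at test
    have h1 := hstrict σ hσ0 hσlt
    have h2 : 0 < ε * a / T₁ := by positivity
    have h3 := mul_lt_mul_of_pos_left h1 h2
    have e7 : (4 * ε * ((b - σ) * √σ)) ^ (p - 2) * (T₁ ^ (-(α + β))) ^ (p - 2) *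
        (ε * (a * g) * (8 * lam * σ - 4 * n * Lam * (b - σ)))
        = ε * a / T₁ * ((4 * ε * ((b - σ) * √σ)) ^ (p - 2)
          * (8 * lam * σ - 4 * n * Lam * (b - σ))) := by
      calc _ = (4 * ε * ((b - σ) * √σ)) ^ (p - 2) * (ε * a *
          (8 * lam * σ - 4 * n * Lam * (b - σ))) * ((T₁ ^ (-(α + β))) ^ (p - 2) * g) := by ring
        _ = _ := by rw [e6]; ring
    rw [e7] at test
    linarith
  · have e1 : T₁ ^ (-(α + 2 * β)) = a * g := by
      rw [ha, hg, ← Real.rpow_add hT₁0]; congr 1; ring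
    have e2 : T₁ ^ (-(α + 4 * β)) = a * g ^ 2 := by
      rw [ha, hg, ← Real.rpow_natCast, ← Real.rpow_mul hT₁0.le, ← Real.rpow_add hT₁0]
      congr 1; push_cast; ring
    simp only [← hT₁, e1, e2]
    have : -(2 * b * ε) * (a * g) + 2 * (ε * (a * g ^ 2)) * ‖x'‖ ^ 2
        = -(2 * ε * (a * g) * (b - σ)) := by rw [hσ]; ring
    rw [this]
    have hbσ : 0 < b - σ := by linarith
    have : 0 ≤ 2 * ε * (a * g) * (b - σ) := by positivity
    linarith
  · intro h s hh hs0 hs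
    have hin := hball (y := (x' + h, t' - s)) (by
      rw [Prod.dist_eq, max_lt_iff, dist_eq_norm, Real.dist_eq]
      simp only [add_sub_cancel_left, sub_sub_cancel_left, abs_neg, abs_of_nonneg hs0]
      exact ⟨hh, hs⟩)
    have hm := hmin (x' + h, t' - s) ⟨⟨hin.1.le, by linarith [hz.1.2]⟩, hin.2.le⟩
    have hexpand : ∀ (y : Space n) (r : ℝ), 0 < 1 + r → w (y, r) =
        ε * (b ^ 2 - (b - 4) ^ 2) * (1 + r) ^ (-α)
        + -(2 * b * ε) * (1 + r) ^ (-(α + 2 * β)) * ‖y‖ ^ 2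
        + ε * (1 + r) ^ (-(α + 4 * β)) * ‖y‖ ^ 4 := by
      intro y r hr
      have e1 : (1 + r) ^ (-(α + 2 * β)) = (1 + r) ^ (-α) * (1 + r) ^ (-(2 * β)) := by
        rw [← Real.rpow_add hr]; congr 1; ring
      have e2 : (1 + r) ^ (-(α + 4 * β)) = (1 + r) ^ (-α) * ((1 + r) ^ (-(2 * β))) ^ 2 := by
        rw [← Real.rpow_natCast, ← Real.rpow_mul hr.le, ← Real.rpow_add hr]
        congr 1; push_cast; ring
      rw [e1, e2, hw]
      ring
    have hin1 : 0 < 1 + (t' - s) := by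
      have : 0 < t' - s := hin.1
      linarith
    rw [hexpand x' t' hT₁0, hexpand _ _ hin1] at hm
    linarith

/-- The scaled barrier as a lower bound in the inner part of its support. -/
theorem IsSuper.expansion (κ : BarrierParam n lam Lam p) {S : Set (Space n × ℝ)}
    {v : Space n × ℝ → ℝ} (hv : IsSuper lam Lam p S v) {x₁ : Space n} {s T H r k : ℝ} (hH : 0 < H)
    (hr : 0 < r) (hk : k = H ^ (p - 2) / r ^ p)
    (hS : ∀ x t, s ≤ t → t ≤ T → ‖x - x₁‖ ≤ 2 * r * (1 + (t - s) * k) ^ κ.β → (x, t) ∈ S)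
    (h0 : ∀ x : Space n, ‖x - x₁‖ ≤ 2 * r → H ≤ v (x, s)) {x : Space n} {t : ℝ} (ht : s ≤ t)
    (htT : t ≤ T) (hx : ‖x - x₁‖ ≤ 8 / 5 * r * (1 + (t - s) * k) ^ κ.β) :
    H * (2 * κ.ε * (1 + (t - s) * k) ^ (-κ.α)) ≤ v (x, t) := by
  have hk0 : 0 < k := by rw [hk]; positivity
  have hσ : k⁻¹ = (1 / H) ^ (p - 2) * r ^ p := by
    rw [hk, Real.div_rpow zero_le_one hH.le, Real.one_rpow, inv_div]
    ring
  set S' : Set (Space n × ℝ) := {z | (x₁ + r • z.1, s + k⁻¹ * z.2) ∈ S} with hS'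
  have hv' := hv.comp_scale (S' := S') x₁ s (one_div_pos.2 hH) hr hσ fun z hz => hz
  have hnorm : ∀ y : Space n, ‖x₁ + r • y - x₁‖ = r * ‖y‖ := fun y => by
    rw [add_sub_cancel_left, norm_smul, Real.norm_eq_abs, abs_of_pos hr]
  have key := hv'.barrier_le κ (T := (T - s) * k) (x := r⁻¹ • (x - x₁)) (t := (t - s) * k)
    ?_ ?_ ?_ ?_ ?_
  · have e1 : x₁ + r • r⁻¹ • (x - x₁) = x := by
      rw [smul_smul, mul_inv_cancel₀ hr.ne', one_smul, add_sub_cancel]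
    have e2 : s + k⁻¹ * ((t - s) * k) = t := by field_simp; ring
    simp only [e1, e2] at key
    rw [one_div, inv_mul_eq_div, le_div_iff₀ hH] at key
    refine le_trans ?_ key
    rw [mul_comm]
    gcongr
    rw [BarrierParam.fn]
    simp only
    set τ := (t - s) * k with hτ
    have hτ0 : 0 < 1 + τ := by
      have : 0 ≤ (t - s) * k := mul_nonneg (by linarith) hk0.le
      linarith
    set σ := ‖r⁻¹ • (x - x₁)‖ ^ 2 * (1 + τ) ^ (-(2 * κ.β)) with hσ'
    have hσ1 : σ ≤ 64 / 25 := by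
      have h1 : ‖r⁻¹ • (x - x₁)‖ ≤ 8 / 5 * (1 + τ) ^ κ.β := by
        rw [norm_smul, norm_inv, Real.norm_eq_abs, abs_of_pos hr, inv_mul_le_iff₀ hr]
        linarith
      have h2 : (1 + τ) ^ (-(2 * κ.β)) * ((1 + τ) ^ κ.β) ^ 2 = 1 := by
        exact rpow_neg_two_mul hτ0 _
      calc σ ≤ (8 / 5 * (1 + τ) ^ κ.β) ^ 2 * (1 + τ) ^ (-(2 * κ.β)) := by rw [hσ']; gcongr
        _ = 64 / 25 * ((1 + τ) ^ (-(2 * κ.β)) * ((1 + τ) ^ κ.β) ^ 2) := by ring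
        _ = 64 / 25 := by rw [h2, mul_one]
    -- The difference of squares is `(4 - σ) (2 b - 4 - σ) ≥ (4 - σ)²`, at least `(36/25)² > 2` in
    -- the inner part of radius ratio `4/5`.
    have h3 : 2 ≤ (κ.b - σ) ^ 2 - (κ.b - 4) ^ 2 := by
      have := κ.b_gt
      nlinarith
    have h4 : 0 < κ.ε * (1 + τ) ^ (-κ.α) := mul_pos κ.ε_pos (Real.rpow_pos_of_pos hτ0 _)
    nlinarith
  · intro y t' ht0 ht1 hy
    apply hS
    · have : 0 ≤ k⁻¹ * t' := by positivity
      linarith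
    · rw [inv_mul_eq_div]
      have : t' / k ≤ T - s := by rwa [div_le_iff₀ hk0]
      linarith
    · rw [hnorm]
      have e2 : (s + k⁻¹ * t' - s) * k = t' := by field_simp; ring
      simp only [e2]
      calc r * ‖y‖ ≤ r * (2 * (1 + t') ^ κ.β) := by gcongr
        _ = _ := by ring
  · intro y hy
    simp only [mul_zero, add_zero]
    rw [one_div, inv_mul_eq_div, one_le_div hH]
    apply h0
    rw [hnorm]
    nlinarith
  · exact mul_nonneg (by linarith) hk0.le
  · exact mul_le_mul_of_nonneg_right (by linarith) hk0.le
  · rw [norm_smul, norm_inv, Real.norm_eq_abs, abs_of_pos hr, inv_mul_le_iff₀ hr]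
    have h1 : 0 ≤ (1 + (t - s) * k) ^ κ.β := by
      have : 0 ≤ (t - s) * k := mul_nonneg (by linarith) hk0.le
      positivity
    nlinarith

end Barrier

/-! ### Lebesgue measure under affine scaling -/

section Scaling

variable {n : ℕ}

/-- The affine change of variables `(x, t) ↦ (x₀ + ρ x, t₀ + σ t)`. -/
def scaleMap (x₀ : Space n) (t₀ ρ σ : ℝ) (z : Space n × ℝ) : Space n × ℝ :=
  (x₀ + ρ • z.1, t₀ + σ * z.2)

theorem measurable_scaleMap (x₀ : Space n) (t₀ ρ σ : ℝ) : Measurable (scaleMap x₀ t₀ ρ σ) := by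
  unfold scaleMap
  fun_prop

theorem map_scaleMap (x₀ : Space n) (t₀ : ℝ) {ρ σ : ℝ} (hρ : 0 < ρ) (hσ : 0 < σ) :
    Measure.map (scaleMap x₀ t₀ ρ σ) volume
      = ENNReal.ofReal ((ρ ^ n)⁻¹ * σ⁻¹) • (volume : Measure (Space n × ℝ)) := by
  have h1 : Measure.map (fun x : Space n => x₀ + ρ • x) volume
      = ENNReal.ofReal ((ρ ^ n)⁻¹) • volume := by
    have : (fun x : Space n => x₀ + ρ • x) = (fun x => x₀ + x) ∘ fun x => ρ • x := rfl
    rw [this, ← Measure.map_map (by fun_prop) (by fun_prop), Measure.map_addHaar_smul _ hρ.ne',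
      Measure.map_smul, map_add_left_eq_self, finrank_euclideanSpace, Fintype.card_fin,
      abs_of_pos (by positivity)]
  have h2 : Measure.map (fun t : ℝ => t₀ + σ * t) volume = ENNReal.ofReal σ⁻¹ • volume := by
    have : (fun t : ℝ => t₀ + σ * t) = (fun t => t₀ + t) ∘ fun t => σ • t := rfl
    rw [this, ← Measure.map_map (by fun_prop) (by fun_prop), Measure.map_addHaar_smul _ hσ.ne',
      Measure.map_smul, map_add_left_eq_self, Module.finrank_self, pow_one,
      abs_of_pos (by positivity)]
  have h3 : scaleMap x₀ t₀ ρ σ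
      = Prod.map (fun x : Space n => x₀ + ρ • x) (fun t : ℝ => t₀ + σ * t) := rfl
  rw [h3, Measure.volume_eq_prod, ← Measure.map_prod_map _ _ (by fun_prop) (by fun_prop), h1, h2,
    ENNReal.ofReal_mul (by positivity)]
  ext s hs
  rw [Measure.prod_apply hs]
  simp only [Measure.smul_apply, lintegral_smul_measure, smul_eq_mul]
  rw [lintegral_const_mul _ (measurable_measure_prodMk_left hs), Measure.prod_apply hs]
  ring

theorem volume_preimage_scaleMap (x₀ : Space n) (t₀ : ℝ) {ρ σ : ℝ} (hρ : 0 < ρ) (hσ : 0 < σ)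
    {s : Set (Space n × ℝ)} (hs : MeasurableSet s) :
    volume (scaleMap x₀ t₀ ρ σ ⁻¹' s) = ENNReal.ofReal ((ρ ^ n)⁻¹ * σ⁻¹) * volume s := by
  rw [← Measure.map_apply (measurable_scaleMap _ _ _ _) hs, map_scaleMap _ _ hρ hσ]
  simp

end Scaling

/-! ### The growth lemma in intrinsic cylinders -/

section Growth

variable {n : ℕ} {lam Lam p : ℝ}

/-- The length of a cylinder of unit shape at height `H` and radius `r`. -/
def timeScale (p H r : ℝ) : ℝ := (1 / H) ^ (p - 2) * r ^ p

theorem timeScale_pos {H r : ℝ} (hH : 0 < H) (hr : 0 < r) : 0 < timeScale p H r := by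
  unfold timeScale
  positivity

/-- The cylinder around `z` of radius `2 r` that is intrinsic at height `H`. -/
def intrinsicCyl (p h H r : ℝ) (z : Space n × ℝ) : Set (Space n × ℝ) :=
  Metric.ball z.1 (2 * r) ×ˢ Ioo (z.2 - h * timeScale p H r) (z.2 + h * timeScale p H r)

theorem preimage_intrinsicCyl (h : ℝ) {H r : ℝ} (hH : 0 < H) (hr : 0 < r) (z : Space n × ℝ) :
    scaleMap z.1 z.2 r (timeScale p H r) ⁻¹' intrinsicCyl p h H r z
      = Metric.ball 0 2 ×ˢ Ioo (-h) h := by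
  have hσ := timeScale_pos (p := p) hH hr
  ext w
  simp only [intrinsicCyl, scaleMap, mem_preimage, mem_prod, Metric.mem_ball, dist_eq_norm,
    add_sub_cancel_left, norm_smul, Real.norm_eq_abs, abs_of_pos hr, mem_Ioo, sub_zero]
  rw [mul_comm 2 r, mul_lt_mul_iff_right₀ hr]
  refine and_congr_right fun _ => and_congr ?_ ?_
  · rw [sub_eq_add_neg, add_lt_add_iff_left, ← neg_mul, mul_comm, mul_lt_mul_iff_right₀ hσ]
  · rw [add_lt_add_iff_left, mul_comm, mul_lt_mul_iff_left₀ hσ]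

/-- The contrapositive of the measure estimate in unit cylinders with top centre `(y, -h + 1)`. For
`‖y‖ ≤ 1` they all fit into the ball of radius `2` at the beginning of the time interval. -/
theorem measure_shift {δ : ENNReal}
    (hδ : ∀ v : Space n × ℝ → ℝ, IsSuper lam Lam p (unitCyl n) v →
      v (0, 0) ≤ 1 / 4 → δ ≤ volume {z | z ∈ unitInt n ∧ v z ≤ 1})
    {h : ℝ} (hh : 1 < h) {v : Space n × ℝ → ℝ}
    (hv : IsSuper lam Lam p (Metric.closedBall 0 2 ×ˢ Icc (-h) (-h + 1)) v)
    (hsmall : volume {z | z ∈ Metric.ball (0 : Space n) 2 ×ˢ Ioo (-h) h ∧ v z ≤ 1} < δ)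
    {y : Space n} (hy : ‖y‖ ≤ 1) : 1 / 4 < v (y, -h + 1) := by
  by_contra hcon
  push Not at hcon
  have hv' := hv.comp_scale (S' := unitCyl n) y (-h + 1) one_pos one_pos (σ := 1) (by simp) ?_
  · have h1 := hδ _ hv' (by simpa using hcon)
    refine absurd (h1.trans ?_) (not_le.2 hsmall)
    have hinv : (volume : Measure (Space n × ℝ)).IsAddLeftInvariant :=
      Measure.prod.instIsAddLeftInvariant (μ := volume) (ν := volume)
    rw [← measure_preimage_add volume ((y, -h + 1) : Space n × ℝ)
      {z | z ∈ Metric.ball (0 : Space n) 2 ×ˢ Ioo (-h) h ∧ v z ≤ 1}]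
    apply measure_mono
    rintro z ⟨hz, hvz⟩
    simp only [one_smul, one_mul] at hvz
    refine ⟨⟨?_, ?_, ?_⟩, hvz⟩
    · have h2 : ‖z.1‖ < 1 := by simpa using hz.1
      rw [mem_ball_zero_iff]
      have := norm_add_le y z.1
      change ‖y + z.1‖ < 2
      linarith
    · have := hz.2.1
      change -h < -h + 1 + z.2
      linarith
    · have := hz.2.2
      change -h + 1 + z.2 < h
      linarith
  · rintro z ⟨hz1, hz2⟩
    rw [one_smul, one_mul]
    refine ⟨?_, ?_, ?_⟩
    · rw [mem_closedBall_zero_iff] at hz1 ⊢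
      have := norm_add_le y z.1
      linarith
    · have := hz2.1
      simp only
      linarith
    · have := hz2.2
      simp only
      linarith

/-- Growth lemma: if a supersolution exceeds `H` on most of an intrinsic cylinder, then it is
comparable to `H` on a smaller ball, and later on a larger ball for a long time. -/
theorem exists_growth (hn : 1 ≤ n) (hp : 2 < p) (hlam : 0 < lam) (hLam : lam ≤ Lam)
    (κ : BarrierParam n lam Lam p) :
    ∃ h δ : ℝ, 1 < h ∧ 0 < δ ∧ ∀ m : ℝ, 0 < m → ∃ M R : ℝ, 1 < M ∧ 2 ≤ R ∧
      ∀ (S : Set (Space n × ℝ)) (v : Space n × ℝ → ℝ), IsSuper lam Lam p S v →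
      ∀ (z : Space n × ℝ) (H r : ℝ), 0 < H → 0 < r →
        Metric.closedBall z.1 (R * r) ×ˢ Icc (z.2 - h * timeScale p H r)
          (z.2 + (2 * m + 1) * (2 ^ p * (h * timeScale p H r))) ⊆ S →
        ∀ A : Set (Space n × ℝ), MeasurableSet A → (∀ w ∈ A, H < v w) →
        volume (intrinsicCyl p h H r z \ A) ≤ ENNReal.ofReal δ * volume (intrinsicCyl p h H r z) →
        (∀ x, ‖x - z.1‖ ≤ r → H / 4 ≤ v (x, z.2 - (h - 1) * timeScale p H r)) ∧
        ∀ x t, ‖x - z.1‖ < 4 * r → z.2 + 2 ^ p * (h * timeScale p H r) < t →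
          t < z.2 + (2 * m + 1) * (2 ^ p * (h * timeScale p H r)) → H / M < v (x, t) := by
  obtain ⟨δ₀, hδ₀, hδ₀t, hmeas⟩ := exists_measure_estimate (n := n) hn hp hlam hLam
  have hβ := κ.β_pos
  have hα := κ.α_pos
  have hε := κ.ε_pos
  set k₀ : ℝ := (1 / 4) ^ (p - 2) / (1 / 2) ^ p with hk₀
  have hk₀0 : 0 < k₀ := by positivity
  -- After time `h` a barrier of height `1/4` and radius `1/2`, whose clock runs at rate `k₀`, has
  -- expanded by the factor `5`. Its inner part then has radius `8/5 * 1/2 * 5 = 4`.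
  set h : ℝ := 5 ^ (1 / κ.β) / k₀ + 2 with hh
  have hh1 : 2 < h := by
    have : 0 < (5 : ℝ) ^ (1 / κ.β) / k₀ := by positivity
    linarith
  have hspread : ∀ τ, h ≤ τ → 5 ≤ (1 + τ * k₀) ^ κ.β := by
    intro τ hτ
    have h1 : (5 : ℝ) ^ (1 / κ.β) ≤ 1 + τ * k₀ := by
      have h2 : (5 : ℝ) ^ (1 / κ.β) / k₀ ≤ τ := by linarith
      rw [div_le_iff₀ hk₀0] at h2
      linarith
    calc (5 : ℝ) = ((5 : ℝ) ^ (1 / κ.β)) ^ κ.β := by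
          rw [← Real.rpow_mul (by norm_num), one_div, inv_mul_cancel₀ hβ.ne', Real.rpow_one]
      _ ≤ (1 + τ * k₀) ^ κ.β := Real.rpow_le_rpow (by positivity) h1 hβ.le
  set Q₁ : Set (Space n × ℝ) := Metric.ball 0 2 ×ˢ Ioo (-h) h with hQ₁
  have hQ₁o : IsOpen Q₁ := Metric.isOpen_ball.prod isOpen_Ioo
  have hQ₁pos : 0 < volume Q₁ := hQ₁o.measure_pos _ ⟨(0, 0), by simp, by
    simp only [mem_Ioo]; constructor <;> linarith⟩
  have hQ₁fin : volume Q₁ ≠ ⊤ := by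
    rw [hQ₁, Measure.volume_eq_prod, Measure.prod_prod]
    exact ENNReal.mul_ne_top measure_ball_lt_top.ne measure_Ioo_lt_top.ne
  have hVpos : 0 < (volume Q₁).toReal := ENNReal.toReal_pos hQ₁pos.ne' hQ₁fin
  have hδpos : 0 < δ₀.toReal := ENNReal.toReal_pos hδ₀.ne' hδ₀t
  set δ : ℝ := δ₀.toReal / (2 * (volume Q₁).toReal) with hδ
  have hδ0 : 0 < δ := by positivity
  have hδQ : ENNReal.ofReal δ * volume Q₁ < δ₀ := by
    rw [← ENNReal.ofReal_toReal hQ₁fin, ← ENNReal.ofReal_mul hδ0.le,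
      ENNReal.ofReal_lt_iff_lt_toReal (by positivity) hδ₀t, hδ]
    have : δ₀.toReal / (2 * (volume Q₁).toReal) * (volume Q₁).toReal = δ₀.toReal / 2 := by
      field_simp
    linarith
  refine ⟨h, δ, by linarith, hδ0, fun m hm => ?_⟩
  have h2p : (1 : ℝ) ≤ 2 ^ p := Real.one_le_rpow (by norm_num) (by linarith)
  set Tm : ℝ := (2 * m + 1) * (2 ^ p * h) with hTm
  have hTmh : h ≤ Tm := by
    have : 1 * h ≤ 2 ^ p * h := by gcongr
    have h3 : 1 * (2 ^ p * h) ≤ Tm := by rw [hTm]; gcongr; linarith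
    linarith
  -- The age of the barrier at the end of the whole time span. It fixes the room `X ^ β` the barrier
  -- needs and, through `X ^ (-α)`, the height `μ` that survives; only these depend on `m`.
  set X : ℝ := 1 + (Tm + h) * k₀ with hX
  have hX1 : 1 ≤ X := by
    have : 0 ≤ (Tm + h) * k₀ := by have : 0 ≤ Tm + h := by linarith
                                   positivity
    linarith
  set μ : ℝ := κ.ε / 2 * X ^ (-κ.α) with hμ
  have hμ0 : 0 < μ := by positivity
  have hμ1 : μ < 1 := by
    have h1 : X ^ (-κ.α) ≤ 1 := Real.rpow_le_one_of_one_le_of_nonpos hX1 (by linarith)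
    have h2 : κ.ε ≤ 1 / 16 := by
      have h3 := κ.ε_le
      have h4 := κ.b_gt
      have h5 : κ.ε * 16 ≤ κ.ε * κ.b ^ 2 := by gcongr; nlinarith
      linarith
    calc μ ≤ κ.ε / 2 * 1 := by rw [hμ]; gcongr
      _ < 1 := by linarith
  refine ⟨2 / μ, X ^ κ.β, ?_, ?_, ?_⟩
  · rw [lt_div_iff₀ hμ0]; linarith
  · have := hspread (Tm + h) (by linarith)
    linarith
  intro S v hv z H r hH hr hS A hAm hAH hdens
  set σ := timeScale p H r with hσ
  have hσ0 : 0 < σ := timeScale_pos hH hr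
  set S' : Set (Space n × ℝ) := {w | (z.1 + r • w.1, z.2 + σ * w.2) ∈ S} with hS'
  have hv' := hv.comp_scale (S' := S') z.1 z.2 (one_div_pos.2 hH) hr hσ fun w hw => hw
  set V : Space n × ℝ → ℝ := fun w => 1 / H * v (z.1 + r • w.1, z.2 + σ * w.2) with hV
  have hbox : ∀ w : Space n × ℝ, ‖w.1‖ ≤ X ^ κ.β → -h ≤ w.2 → w.2 ≤ Tm → w ∈ S' := by
    intro w hw1 hw2 hw3
    apply hS
    refine ⟨?_, ?_, ?_⟩
    · rw [Metric.mem_closedBall, dist_eq_norm]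
      simp only [add_sub_cancel_left, norm_smul, Real.norm_eq_abs, abs_of_pos hr]
      rw [mul_comm]
      gcongr
    · simp only
      have := mul_le_mul_of_nonneg_right hw2 hσ0.le
      linarith
    · simp only
      have := mul_le_mul_of_nonneg_right hw3 hσ0.le
      rw [hTm] at this
      linarith
  have hsmall : volume {w | w ∈ Metric.ball (0 : Space n) 2 ×ˢ Ioo (-h) h ∧ V w ≤ 1} < δ₀ := by
    refine lt_of_le_of_lt ?_ hδQ
    have hsub : {w | w ∈ Metric.ball (0 : Space n) 2 ×ˢ Ioo (-h) h ∧ V w ≤ 1}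
        ⊆ scaleMap z.1 z.2 r σ ⁻¹' (intrinsicCyl p h H r z \ A) := by
      rintro w ⟨hw, hVw⟩
      rw [← preimage_intrinsicCyl (p := p) h hH hr z] at hw
      refine ⟨hw, fun hwA => ?_⟩
      have h1 := hAH _ hwA
      simp only [hV, one_div, inv_mul_le_iff₀ hH, mul_one] at hVw
      exact absurd hVw (not_le.2 h1)
    have hQm : MeasurableSet (intrinsicCyl p h H r z) :=
      (Metric.isOpen_ball.prod isOpen_Ioo).measurableSet
    refine (measure_mono hsub).trans ?_
    rw [volume_preimage_scaleMap _ _ hr hσ0 (hQm.diff hAm)]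
    have h2 : volume Q₁ = ENNReal.ofReal ((r ^ n)⁻¹ * σ⁻¹) * volume (intrinsicCyl p h H r z) := by
      rw [← volume_preimage_scaleMap z.1 z.2 hr hσ0 hQm, preimage_intrinsicCyl h hH hr]
    rw [h2]
    calc _ ≤ ENNReal.ofReal ((r ^ n)⁻¹ * σ⁻¹) *
          (ENNReal.ofReal δ * volume (intrinsicCyl p h H r z)) := by gcongr
      _ = _ := by ring
  have hXβ : 5 ≤ X ^ κ.β := hspread (Tm + h) (by linarith)
  have hquarter : ∀ y : Space n, ‖y‖ ≤ 1 → 1 / 4 < V (y, -h + 1) := by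
    intro y hy
    refine measure_shift hmeas (by linarith) (hv'.mono ?_) hsmall hy
    rintro w ⟨hw1, hw2⟩
    refine hbox w ?_ hw2.1 (by linarith [hw2.2])
    rw [mem_closedBall_zero_iff] at hw1
    linarith
  refine ⟨?_, ?_⟩
  · intro x hx
    have h1 := hquarter (r⁻¹ • (x - z.1)) (by
      rw [norm_smul, norm_inv, Real.norm_eq_abs, abs_of_pos hr, inv_mul_le_iff₀ hr]
      linarith)
    simp only [hV] at h1
    rw [smul_smul, mul_inv_cancel₀ hr.ne', one_smul, add_sub_cancel,
      show z.2 + σ * (-h + 1) = z.2 - (h - 1) * σ by ring, one_div H, inv_mul_eq_div,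
      lt_div_iff₀ hH] at h1
    linarith
  · intro x t hx ht1 ht2
    set τ := (t - z.2) / σ with hτ
    have hτ1 : 2 ^ p * h < τ := by
      rw [hτ, lt_div_iff₀ hσ0]; linarith
    have hτ2 : τ < Tm := by
      rw [hτ, div_lt_iff₀ hσ0, hTm]; linarith
    have hτh : h ≤ τ := by
      have : 1 * h ≤ 2 ^ p * h := by gcongr
      linarith
    set y := r⁻¹ • (x - z.1) with hy
    have hy4 : ‖y‖ ≤ 4 := by
      rw [hy, norm_smul, norm_inv, Real.norm_eq_abs, abs_of_pos hr, inv_mul_le_iff₀ hr]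
      linarith
    -- The measure estimate gives `1/4` on the unit ball, which is twice the radius `1/2` required
    -- of the initial barrier.
    have key := hv'.expansion κ (x₁ := 0) (s := -h + 1) (T := Tm) (H := 1 / 4) (r := 1 / 2)
      (k := k₀) (x := y) (t := τ) (by norm_num) (by norm_num) hk₀ ?_ ?_ (by linarith) hτ2.le ?_
    · have e1 : z.1 + r • y = x := by
        rw [hy, smul_smul, mul_inv_cancel₀ hr.ne', one_smul, add_sub_cancel]
      have e2 : z.2 + σ * τ = t := by rw [hτ]; field_simp; ring
      simp only [hV, e1, e2] at key
      have h1 : X ^ (-κ.α) ≤ (1 + (τ - (-h + 1)) * k₀) ^ (-κ.α) := by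
        apply Real.rpow_le_rpow_of_nonpos
        · have : 0 ≤ (τ - (-h + 1)) * k₀ := mul_nonneg (by linarith) hk₀0.le
          linarith
        · have : (τ - (-h + 1)) * k₀ ≤ (Tm + h) * k₀ := by gcongr; linarith
          linarith
        · linarith
      have h2 : μ ≤ 1 / 4 * (2 * κ.ε * (1 + (τ - (-h + 1)) * k₀) ^ (-κ.α)) := by
        rw [hμ]
        have := mul_le_mul_of_nonneg_left h1 hε.le
        linarith
      have h3 : μ ≤ 1 / H * v (x, t) := h2.trans key
      rw [one_div, inv_mul_eq_div, le_div_iff₀ hH] at h3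
      rw [div_div_eq_mul_div, div_lt_iff₀ (by norm_num)]
      have : 0 < μ * H := by positivity
      linarith
    · intro y' t' ht'1 ht'2 hy'
      refine hbox (y', t') ?_ (by simp only; linarith) ht'2
      rw [sub_zero] at hy'
      have h1 : (1 + (t' - (-h + 1)) * k₀) ^ κ.β ≤ X ^ κ.β := by
        apply Real.rpow_le_rpow _ _ hβ.le
        · have : 0 ≤ (t' - (-h + 1)) * k₀ := mul_nonneg (by linarith) hk₀0.le
          linarith
        · have : (t' - (-h + 1)) * k₀ ≤ (Tm + h) * k₀ := by gcongr; linarith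
          linarith
      linarith
    · intro y' hy'
      rw [sub_zero] at hy'
      exact (hquarter y' (by linarith)).le
    · have := hspread (τ - (-h + 1)) (by linarith)
      rw [sub_zero]
      linarith

end Growth

/-! ### Large values on a ball propagate to the origin -/

section CoreBound

variable {n : ℕ} {lam Lam p : ℝ}

/-- The domain on which the normalized supersolution lives. -/
def bigCyl (n : ℕ) : Set (Space n × ℝ) := Metric.ball 0 3 ×ˢ Ioc (-9) 0

/-- A supersolution that is large on a ball of comparable intrinsic size at an earlier time cannot
be small at the origin. -/
theorem exists_core_bound (hp : 2 < p) (κ : BarrierParam n lam Lam p) :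
    ∃ a c γ : ℝ, 0 < a ∧ 0 < c ∧ 0 < γ ∧ ∀ v : Space n × ℝ → ℝ, IsSuper lam Lam p (bigCyl n) v →
      ∀ (x₁ : Space n) (s H : ℝ), ‖x₁‖ ≤ 5 / 4 → -3 ≤ s → s ≤ -1 / 2 → 1 ≤ H →
        (∀ x, ‖x - x₁‖ ≤ a * H ^ (-γ) → H ≤ v (x, s)) → c ≤ v (0, 0) := by
  have hβ := κ.β_pos
  have hα := κ.α_pos
  have hε := κ.ε_pos
  have hβ1 := κ.β_le
  have hexp := κ.exponents
  -- With `γ = β / α` the barrier started at height `H` and radius `a₁ * H^(-γ)` satisfies `2 * r *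
  -- k^β = 13/8` and `H * k^(-α) = a₁^(p α)`, both independent of `H`: later on it no longer
  -- remembers how concentrated it was.
  set a₁ : ℝ := (13 / 16) ^ (1 / ((p - 2) * κ.α)) with ha₁
  have hpα : 0 < (p - 2) * κ.α := mul_pos (by linarith) hα
  have ha0 : 0 < a₁ := by positivity
  have ha1 : a₁ ≤ 1 := Real.rpow_le_one (by norm_num) (by norm_num) (by positivity)
  have ha2 : a₁ ^ (1 - p * κ.β) = 13 / 16 := by
    rw [ha₁, ← Real.rpow_mul (by norm_num), show 1 - p * κ.β = (p - 2) * κ.α by linarith,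
      one_div, inv_mul_cancel₀ hpα.ne', Real.rpow_one]
  refine ⟨2 * a₁, 2 * κ.ε * 4 ^ (-κ.α) * a₁ ^ (p * κ.α), κ.β / κ.α, by positivity, by positivity,
    by positivity, ?_⟩
  intro v hv x₁ s H hx₁ hs1 hs2 hH h0
  have hH0 : 0 < H := by linarith
  set r : ℝ := a₁ * H ^ (-(κ.β / κ.α)) with hr
  have hr0 : 0 < r := by positivity
  set k : ℝ := H ^ (p - 2) / r ^ p with hk
  have hk0 : 0 < k := by positivity
  have hkH : k = H ^ (1 / κ.α) * a₁ ^ (-p) := by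
    rw [hk, hr, Real.mul_rpow ha0.le (by positivity), ← Real.rpow_mul hH0.le, Real.rpow_neg ha0.le,
      show -(κ.β / κ.α) * p = -(κ.β / κ.α * p) by ring, Real.rpow_neg hH0.le,
      show 1 / κ.α = (p - 2) + κ.β / κ.α * p by field_simp; linarith, Real.rpow_add hH0]
    field_simp
  have hk1 : 1 ≤ k := by
    rw [hkH]
    have h1 : 1 ≤ H ^ (1 / κ.α) := Real.one_le_rpow hH (by positivity)
    have h2 : 1 ≤ a₁ ^ (-p) := Real.one_le_rpow_of_pos_of_le_one_of_nonpos ha0 ha1 (by linarith)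
    nlinarith
  have hkβ : 2 * r * k ^ κ.β = 13 / 8 := by
    rw [hkH, hr, Real.mul_rpow (by positivity) (by positivity), ← Real.rpow_mul hH0.le,
      ← Real.rpow_mul ha0.le, show 1 / κ.α * κ.β = κ.β / κ.α by ring, Real.rpow_neg hH0.le]
    have h1 : a₁ * a₁ ^ (-p * κ.β) = 13 / 16 := by
      rw [← ha2, sub_eq_add_neg, Real.rpow_add ha0, Real.rpow_one, neg_mul]
    have h2 : 0 < H ^ (κ.β / κ.α) := by positivity
    calc 2 * (a₁ * (H ^ (κ.β / κ.α))⁻¹) * (H ^ (κ.β / κ.α) * a₁ ^ (-p * κ.β))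
        = 2 * (a₁ * a₁ ^ (-p * κ.β)) * ((H ^ (κ.β / κ.α))⁻¹ * H ^ (κ.β / κ.α)) := by ring
      _ = 13 / 8 := by rw [h1, inv_mul_cancel₀ h2.ne']; norm_num
  have hkα : H * k ^ (-κ.α) = a₁ ^ (p * κ.α) := by
    rw [hkH, Real.mul_rpow (by positivity) (by positivity), ← Real.rpow_mul hH0.le,
      ← Real.rpow_mul ha0.le, show 1 / κ.α * -κ.α = -1 by field_simp,
      show -p * -κ.α = p * κ.α by ring, Real.rpow_neg_one, ← mul_assoc, mul_inv_cancel₀ hH0.ne',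
      one_mul]
  have hpow : ∀ τ, 0 ≤ τ → τ ≤ 3 → ∃ ϑ, τ ≤ ϑ ∧ 0 < ϑ ∧ ϑ ≤ 4 ∧ 1 + τ * k = ϑ * k := by
    intro τ hτ0 hτ
    have h1 : 0 < 1 / k := by positivity
    have h2 : 1 / k ≤ 1 := by rw [div_le_one hk0]; exact hk1
    refine ⟨τ + 1 / k, by linarith, by linarith, by linarith, ?_⟩
    field_simp
    ring
  -- `β ≤ 1/100` makes the support almost constant over the relevant times. It stays in the ball of
  -- radius `3`, as `13/8 * 103/100 + 5/4 < 3`, and its inner part reaches the origin, as `4/5 *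
  -- 13/8 * 100/101 ≥ 5/4`.
  have h4β : ∀ ϑ : ℝ, 0 < ϑ → ϑ ≤ 4 → ϑ ^ κ.β ≤ 103 / 100 := by
    intro ϑ h1 h2
    have h3 : ϑ ^ κ.β ≤ 4 ^ κ.β := Real.rpow_le_rpow h1.le h2 hβ.le
    have h4 := rpow_one_add_le_one_add_mul_self (s := 3) (by norm_num) hβ.le (by linarith)
    norm_num at h4
    linarith
  have key := hv.expansion κ (x₁ := x₁) (s := s) (T := 0) (x := 0) (t := 0) hH0 hr0 hk ?_ ?_
    (by linarith) le_rfl ?_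
  · obtain ⟨ϑ, h1, h2, h3, h4⟩ := hpow (0 - s) (by linarith) (by linarith)
    refine le_trans ?_ key
    rw [h4, Real.mul_rpow h2.le hk0.le]
    have h5 : (4 : ℝ) ^ (-κ.α) ≤ ϑ ^ (-κ.α) := Real.rpow_le_rpow_of_nonpos h2 h3 (by linarith)
    calc _ ≤ 2 * κ.ε * ϑ ^ (-κ.α) * a₁ ^ (p * κ.α) := by gcongr
      _ = _ := by rw [← hkα]; ring
  · intro x t ht1 ht2 hx
    obtain ⟨ϑ, h1, h2, h3, h4⟩ := hpow (t - s) (by linarith) (by linarith)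
    rw [h4, Real.mul_rpow h2.le hk0.le] at hx
    have h5 : 2 * r * (ϑ ^ κ.β * k ^ κ.β) ≤ 13 / 8 * (103 / 100) := by
      rw [← hkβ]
      have := mul_le_mul_of_nonneg_left (h4β ϑ h2 h3) (by positivity : 0 ≤ 2 * r * k ^ κ.β)
      linarith
    refine ⟨?_, by linarith, ht2⟩
    rw [mem_ball_zero_iff]
    have := norm_add_le (x - x₁) x₁
    rw [sub_add_cancel] at this
    linarith
  · intro x hx
    exact h0 x (by rw [hr] at hx; linarith)
  · obtain ⟨ϑ, h1, h2, h3, h4⟩ := hpow (0 - s) (by linarith) (by linarith)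
    rw [h4, Real.mul_rpow h2.le hk0.le, zero_sub, norm_neg]
    have h5 : (100 : ℝ) / 101 ≤ ϑ ^ κ.β := by
      have h6 : (1 / 2 : ℝ) ^ κ.β ≤ ϑ ^ κ.β :=
        Real.rpow_le_rpow (by norm_num) (by linarith) hβ.le
      have h7 := rpow_one_add_le_one_add_mul_self (s := 1) (by norm_num) hβ.le (by linarith)
      norm_num at h7
      have h8 : (1 / 2 : ℝ) ^ κ.β * 2 ^ κ.β = 1 := by
        rw [← Real.mul_rpow (by norm_num) (by norm_num)]; norm_num
      have h9 : (0 : ℝ) < (1 / 2) ^ κ.β := by positivity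
      nlinarith
    have h6 := mul_le_mul_of_nonneg_left h5 (by positivity : 0 ≤ 2 * r * k ^ κ.β)
    rw [hkβ] at h6
    have h7 : 8 / 5 * r * (ϑ ^ κ.β * k ^ κ.β) = 4 / 5 * (2 * r * k ^ κ.β * ϑ ^ κ.β) := by ring
    rw [h7, hkβ]
    linarith

end CoreBound

/-! ### The shadow estimate -/

section Shadow

/-- The one dimensional shadow estimate: intervals that lie to the left of long intervals contained
in an open set can enlarge its measure only a little. -/
theorem volume_iUnion_shadow_le {ι : Type*} {O : Set ℝ} (hO : IsOpen O) {a b : ℝ}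
    (hab : O ⊆ Icc a b) {m : ℝ} (hm : 0 < m) (c ℓ : ι → ℝ) (hℓ : ∀ i, 0 < ℓ i)
    (hsub : ∀ i, Ioo (c i) (c i + m * ℓ i) ⊆ O) :
    volume (⋃ i, Ioo (c i - ℓ i) (c i)) ≤ ENNReal.ofReal (1 + 1 / m) * volume O := by
  set 𝒞 : Set (Set ℝ) := (fun x => connectedComponentIn O x) '' O with h𝒞
  have hopen : ∀ C ∈ 𝒞, IsOpen C := by
    rintro _ ⟨x, _, rfl⟩
    exact hO.connectedComponentIn
  have hne : ∀ C ∈ 𝒞, C.Nonempty := by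
    rintro _ ⟨x, hx, rfl⟩
    exact ⟨x, mem_connectedComponentIn hx⟩
  have hCO : ∀ C ∈ 𝒞, C ⊆ O := by
    rintro _ ⟨x, hx, rfl⟩
    exact connectedComponentIn_subset O x
  have hdisj : 𝒞.PairwiseDisjoint id := by
    rintro _ ⟨x, hx, rfl⟩ _ ⟨y, hy, rfl⟩ hxy
    refine disjoint_left.2 fun z hzx hzy => hxy ?_
    simp only [id] at hzx hzy ⊢
    rw [connectedComponentIn_eq hzx, connectedComponentIn_eq hzy]
  have hcount : 𝒞.Countable := hdisj.countable_of_isOpen (fun C hC => hopen C hC) hne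
  have hIoo : ∀ C ∈ 𝒞, Ioo (sInf C) (sSup C) ⊆ C := by
    rintro _ ⟨x, hx, rfl⟩
    exact (isConnected_connectedComponentIn_iff.2 hx).Ioo_csInf_csSup_subset
      (bddBelow_Icc.mono ((connectedComponentIn_subset O x).trans hab))
      (bddAbove_Icc.mono ((connectedComponentIn_subset O x).trans hab))
  -- The long interval lies in one component `C` of `O`, whose length is at least `m * ℓ i`. The
  -- short interval to its left is in `C`, except for a part within `|C| / m` of the left end of
  -- `C`. These extensions cost at most `|O| / m` in total.
  have hcover : (⋃ i, Ioo (c i - ℓ i) (c i)) ⊆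
      O ∪ ⋃ C ∈ 𝒞, Icc (sInf C - (sSup C - sInf C) / m) (sInf C) := by
    intro x hx
    obtain ⟨i, hi1, hi2⟩ := mem_iUnion.1 hx
    have hmℓ : 0 < m * ℓ i := mul_pos hm (hℓ i)
    set y := c i + m * ℓ i / 2 with hy
    have hyJ : y ∈ Ioo (c i) (c i + m * ℓ i) := ⟨by linarith, by linarith⟩
    set C := connectedComponentIn O y with hC
    have hC𝒞 : C ∈ 𝒞 := ⟨y, hsub i hyJ, rfl⟩
    have hJC : Ioo (c i) (c i + m * ℓ i) ⊆ C :=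
      isPreconnected_Ioo.subset_connectedComponentIn hyJ (hsub i)
    have hbb : BddBelow C := bddBelow_Icc.mono ((hCO C hC𝒞).trans hab)
    have hba : BddAbove C := bddAbove_Icc.mono ((hCO C hC𝒞).trans hab)
    have h1 : sInf C ≤ c i := by
      have := csInf_le_csInf hbb ⟨y, hyJ⟩ hJC
      rwa [csInf_Ioo (by linarith)] at this
    have h2 : c i + m * ℓ i ≤ sSup C := by
      have := csSup_le_csSup hba ⟨y, hyJ⟩ hJC
      rwa [csSup_Ioo (by linarith)] at this
    by_cases hxa : x ≤ sInf C
    · right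
      refine mem_iUnion₂.2 ⟨C, hC𝒞, ?_, hxa⟩
      have h3 : ℓ i ≤ (sSup C - sInf C) / m := by
        rw [le_div_iff₀ hm]
        linarith
      linarith
    · left
      push Not at hxa
      exact hCO C hC𝒞 (hIoo C hC𝒞 ⟨hxa, by linarith⟩)
  have hvolC : ∀ C ∈ 𝒞, volume (Icc (sInf C - (sSup C - sInf C) / m) (sInf C))
      ≤ ENNReal.ofReal (1 / m) * volume C := by
    intro C hC
    rw [Real.volume_Icc]
    calc _ = ENNReal.ofReal (1 / m) * volume (Ioo (sInf C) (sSup C)) := by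
          rw [Real.volume_Ioo, ← ENNReal.ofReal_mul (by positivity)]
          congr 1
          ring
      _ ≤ _ := by gcongr; exact hIoo C hC
  calc _ ≤ volume (O ∪ ⋃ C ∈ 𝒞, Icc (sInf C - (sSup C - sInf C) / m) (sInf C)) :=
        measure_mono hcover
    _ ≤ volume O + volume (⋃ C ∈ 𝒞, Icc (sInf C - (sSup C - sInf C) / m) (sInf C)) :=
        measure_union_le _ _
    _ ≤ volume O + ∑' C : 𝒞, volume (Icc (sInf C.1 - (sSup C.1 - sInf C.1) / m) (sInf C.1)) := by
        gcongr
        exact measure_biUnion_le _ hcount _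
    _ ≤ volume O + ∑' C : 𝒞, ENNReal.ofReal (1 / m) * volume C.1 := by
        gcongr with C
        exact hvolC C C.2
    _ = volume O + ENNReal.ofReal (1 / m) * volume (⋃ C ∈ 𝒞, C) := by
        rw [ENNReal.tsum_mul_left, measure_biUnion (f := fun C => C) hcount hdisj
          fun C hC => (hopen C hC).measurableSet]
    _ ≤ volume O + ENNReal.ofReal (1 / m) * volume O := by
        gcongr
        exact iUnion₂_subset hCO
    _ = ENNReal.ofReal (1 + 1 / m) * volume O := by
        rw [ENNReal.ofReal_add zero_le_one (by positivity), ENNReal.ofReal_one, add_mul, one_mul]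

variable {n : ℕ}

/-- The shadow estimate for cylinders. -/
theorem volume_iUnion_cyl_shadow_le {A A' : Set (Space n × ℝ)} (hA' : IsOpen A') {a b : ℝ}
    (hab : A' ⊆ univ ×ˢ Icc a b) {m : ℝ} (hm : 0 < m) (ρ τ : Space n × ℝ → ℝ)
    (hτ : ∀ z ∈ A, 0 < τ z)
    (hsub : ∀ z ∈ A, Metric.ball z.1 (ρ z) ×ˢ Ioo (z.2 + τ z) (z.2 + (2 * m + 1) * τ z) ⊆ A') :
    volume (⋃ z ∈ A, Metric.ball z.1 (ρ z) ×ˢ Ioo (z.2 - τ z) (z.2 + τ z))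
      ≤ ENNReal.ofReal (1 + 1 / m) * volume A' := by
  have hE : IsOpen (⋃ z ∈ A, Metric.ball z.1 (ρ z) ×ˢ Ioo (z.2 - τ z) (z.2 + τ z)) :=
    isOpen_biUnion fun z _ => Metric.isOpen_ball.prod isOpen_Ioo
  rw [Measure.volume_eq_prod, Measure.prod_apply hE.measurableSet,
    Measure.prod_apply hA'.measurableSet,
    ← lintegral_const_mul _ (measurable_measure_prodMk_left hA'.measurableSet)]
  refine lintegral_mono fun y => ?_
  have h1 := volume_iUnion_shadow_le (ι := {z // z ∈ A ∧ y ∈ Metric.ball z.1 (ρ z)})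
    (O := Prod.mk y ⁻¹' A') (hA'.preimage (by fun_prop)) (a := a) (b := b)
    (fun t ht => (hab ht).2) hm (fun z => z.1.2 + τ z.1) (fun z => 2 * τ z.1)
    (fun z => by linarith [hτ z.1 z.2.1]) (fun z t ht => hsub z.1 z.2.1 ⟨z.2.2, by
      rw [show z.1.2 + (2 * m + 1) * τ z.1 = z.1.2 + τ z.1 + m * (2 * τ z.1) by ring]
      exact ht⟩)
  refine le_trans (measure_mono ?_) h1
  intro t ht
  obtain ⟨z, hz, hy, ht⟩ := mem_iUnion₂.1 ht
  refine mem_iUnion.2 ⟨⟨z, hz, hy⟩, ?_⟩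
  rw [show z.2 - τ z = z.2 + τ z - 2 * τ z by ring] at ht
  exact ht

end Shadow

/-! ### Density of a union of cylinders -/

section Density

variable {n : ℕ} {p : ℝ}

theorem volume_intrinsicCyl {h H r : ℝ} (hr : 0 < r) (z : Space n × ℝ) :
    volume (intrinsicCyl p h H r z) =
      ENNReal.ofReal ((2 * r) ^ n * (2 * (h * timeScale p H r))) * ballVol n := by
  rw [intrinsicCyl, Measure.volume_eq_prod, Measure.prod_prod, volume_ball_space _ (by positivity),
    Real.volume_Ioo, ENNReal.ofReal_mul (by positivity)]
  rw [show z.2 + h * timeScale p H r - (z.2 - h * timeScale p H r) = 2 * (h * timeScale p H r) by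
    ring]
  ring

/-- If each cylinder of a family contains a definite portion outside `A`, so does their union. -/
theorem volume_iUnion_le_diff (hp : 2 < p) {h H δ r₁ : ℝ} (hh : 0 < h) (hH : 0 < H)
    (hδ : 0 < δ) {A : Set (Space n × ℝ)} (hA : MeasurableSet A) (r : Space n × ℝ → ℝ)
    (hr : ∀ z ∈ A, 0 < r z) (hr₁ : ∀ z ∈ A, r z ≤ r₁)
    (hdens : ∀ z ∈ A, ENNReal.ofReal δ * volume (intrinsicCyl p h H (r z) z)
      ≤ volume (intrinsicCyl p h H (r z) z \ A)) :
    ENNReal.ofReal (δ / (5 ^ n * (1 + 2 * 2 ^ p))) * volume (⋃ z ∈ A, intrinsicCyl p h H (r z) z)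
      ≤ volume ((⋃ z ∈ A, intrinsicCyl p h H (r z) z) \ A) := by
  set B : Space n × ℝ → Set (Space n × ℝ) := fun z => intrinsicCyl p h H (r z) z with hB
  have hτ : ∀ z ∈ A, 0 < h * timeScale p H (r z) := fun z hz =>
    mul_pos hh (timeScale_pos hH (hr z hz))
  have hopen : ∀ z, IsOpen (B z) := fun z => Metric.isOpen_ball.prod isOpen_Ioo
  have hself : ∀ z ∈ A, z ∈ B z := fun z hz =>
    ⟨Metric.mem_ball_self (by linarith [hr z hz]), by linarith [hτ z hz], by linarith [hτ z hz]⟩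
  obtain ⟨u, huA, hdisj, hcov⟩ := Vitali.exists_disjoint_subfamily_covering_enlargement B A r 2
    one_lt_two (fun z hz => (hr z hz).le) r₁ hr₁ (fun z hz => ⟨z, hself z hz⟩)
  have hcount : u.Countable :=
    hdisj.countable_of_isOpen (fun z _ => hopen z) fun z hz => ⟨z, hself z (huA hz)⟩
  set K : ℝ := 5 ^ n * (1 + 2 * 2 ^ p) with hK
  have hK0 : 0 < K := by positivity
  -- A Vitali neighbour has at most twice the radius, hence at most `2^p` times the length. The
  -- enlargement is `1 + 2 * 2 = 5` in space and `1 + 2 * 2^p` in time.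
  set I : Space n × ℝ → Set (Space n × ℝ) := fun z =>
    Metric.ball z.1 (5 * (2 * r z)) ×ˢ
      Ioo (z.2 - (1 + 2 * 2 ^ p) * (h * timeScale p H (r z)))
        (z.2 + (1 + 2 * 2 ^ p) * (h * timeScale p H (r z))) with hI
  have hEI : (⋃ z ∈ A, B z) ⊆ ⋃ z ∈ u, I z := by
    intro w' hw'
    obtain ⟨z', hz', hw'⟩ := mem_iUnion₂.1 hw'
    obtain ⟨z, hzu, ⟨w, hwz', hwz⟩, hle⟩ := hcov z' hz'
    refine mem_iUnion₂.2 ⟨z, hzu, ?_, ?_⟩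
    · have h1 := hw'.1
      have h2 := hwz'.1
      have h3 := hwz.1
      rw [Metric.mem_ball] at h1 h2 h3 ⊢
      have h4 := dist_triangle w'.1 z'.1 w.1
      have h5 := dist_triangle w'.1 w.1 z.1
      rw [dist_comm z'.1] at h4
      linarith
    · have h6 : timeScale p H (r z') ≤ 2 ^ p * timeScale p H (r z) := by
        have h7 : r z' ^ p ≤ 2 ^ p * r z ^ p := by
          rw [← Real.mul_rpow (by norm_num) (hr z (huA hzu)).le]
          exact Real.rpow_le_rpow (hr z' hz').le hle (by linarith)
        unfold timeScale
        calc _ ≤ (1 / H) ^ (p - 2) * (2 ^ p * r z ^ p) := by gcongr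
          _ = _ := by ring
      have h7 := mul_le_mul_of_nonneg_left h6 hh.le
      have h8 := hw'.2
      have h9 := hwz'.2
      have h10 := hwz.2
      constructor <;> linarith [h8.1, h8.2, h9.1, h9.2, h10.1, h10.2]
  have hvol : ∀ z ∈ u, volume (I z) = ENNReal.ofReal K * volume (B z) := by
    intro z hz
    have h0 := hr z (huA hz)
    have h1 := hτ z (huA hz)
    rw [hB]
    simp only
    rw [volume_intrinsicCyl h0, hI]
    simp only
    rw [Measure.volume_eq_prod, Measure.prod_prod, volume_ball_space _ (by positivity),
      Real.volume_Ioo, ← mul_assoc (ENNReal.ofReal K), ← ENNReal.ofReal_mul hK0.le, mul_right_comm,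
      ← ENNReal.ofReal_mul (by positivity)]
    congr 2
    rw [mul_pow 5, hK]
    ring
  calc _ ≤ ENNReal.ofReal (δ / K) * ∑' z : u, ENNReal.ofReal K * volume (B z) := by
        gcongr
        refine (measure_mono hEI).trans ((measure_biUnion_le _ hcount _).trans ?_)
        exact ENNReal.tsum_le_tsum fun z => (hvol z z.2).le
    _ = ∑' z : u, ENNReal.ofReal δ * volume (B z) := by
        rw [ENNReal.tsum_mul_left, ← mul_assoc, ← ENNReal.ofReal_mul (by positivity),
          div_mul_cancel₀ _ hK0.ne', ENNReal.tsum_mul_left]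
    _ ≤ ∑' z : u, volume (B z \ A) := ENNReal.tsum_le_tsum fun z => hdens z (huA z.2)
    _ = volume (⋃ z ∈ u, B z \ A) := by
        rw [measure_biUnion hcount (fun z hz z' hz' hne =>
          (hdisj hz hz' hne).mono sdiff_subset sdiff_subset)
          fun z _ => (hopen z).measurableSet.diff hA]
    _ ≤ _ := by
        apply measure_mono
        rintro w hw
        obtain ⟨z, hz, hw⟩ := mem_iUnion₂.1 hw
        exact ⟨mem_iUnion₂.2 ⟨z, huA hz, hw.1⟩, hw.2⟩

end Density

/-! ### Geometric decay of superlevel sets -/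

section Decay

variable {n : ℕ} {lam Lam p : ℝ}

theorem timeScale_le {H r : ℝ} (hp : 2 < p) (hH : 1 ≤ H) (hr : 0 < r) (hr1 : r ≤ 1) :
    timeScale p H r ≤ r := by
  have h1 : (1 / H) ^ (p - 2) ≤ 1 := by
    apply Real.rpow_le_one (by positivity) _ (by linarith)
    rw [div_le_one (by linarith)]
    exact hH
  have h2 : r ^ p ≤ r ^ (1 : ℝ) := Real.rpow_le_rpow_of_exponent_ge hr hr1 (by linarith)
  rw [Real.rpow_one] at h2
  calc timeScale p H r ≤ 1 * r := by unfold timeScale; gcongr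
    _ = r := one_mul r

theorem timeScale_two_mul (H : ℝ) {r : ℝ} (hr : 0 < r) :
    timeScale p H (2 * r) = 2 ^ p * timeScale p H r := by
  unfold timeScale
  rw [Real.mul_rpow (by norm_num) hr.le]
  ring

/-- The cylinder of radius `1 + ℓ` that contains the unit cylinder between the times `-2`, `-1`. -/
def midCyl (n : ℕ) (ℓ : ℝ) : Set (Space n × ℝ) :=
  Metric.ball 0 (1 + ℓ) ×ˢ Ioo (-2 - ℓ) (-1 + ℓ)

theorem isOpen_midCyl (ℓ : ℝ) : IsOpen (midCyl n ℓ) := Metric.isOpen_ball.prod isOpen_Ioo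

theorem midCyl_subset_bigCyl {ℓ : ℝ} (hℓ : ℓ ≤ 1 / 4) : midCyl n ℓ ⊆ bigCyl n := by
  rintro z ⟨h1, h2, h3⟩
  refine ⟨?_, by linarith, by linarith⟩
  rw [mem_ball_zero_iff] at h1 ⊢
  linarith

/-- The superlevel sets of `v` in `midCyl`. -/
def superLevel (v : Space n × ℝ → ℝ) (ℓ H : ℝ) : Set (Space n × ℝ) :=
  {z | z ∈ midCyl n ℓ ∧ H < v z}

theorem IsSuper.isOpen_superLevel {v : Space n × ℝ → ℝ} (hv : IsSuper lam Lam p (bigCyl n) v)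
    {ℓ : ℝ} (hℓ : ℓ ≤ 1 / 4) (H : ℝ) : IsOpen (superLevel v ℓ H) := by
  obtain ⟨V, hV, hVe⟩ := lowerSemicontinuousOn_iff_preimage_Ioi.1 hv.lsc H
  have : superLevel v ℓ H = midCyl n ℓ ∩ V := by
    ext z
    constructor
    · rintro ⟨h1, h2⟩
      exact ⟨h1, (hVe.subset ⟨midCyl_subset_bigCyl hℓ h1, h2⟩).2⟩
    · rintro ⟨h1, h2⟩
      exact ⟨h1, (hVe.symm.subset ⟨midCyl_subset_bigCyl hℓ h1, h2⟩).2⟩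
  rw [this]
  exact (isOpen_midCyl ℓ).inter hV

/-- Doubling a radius with a bounded property until the property fails. -/
theorem exists_last_double {P : ℝ → Prop} {r₀ r₁ : ℝ} (hr₀ : 0 < r₀) (hr₁ : r₀ ≤ r₁) (h₀ : P r₀)
    (hb : ∀ r, 0 < r → r ≤ r₁ → P r → 2 * r ≤ r₁) :
    ∃ r, 0 < r ∧ 2 * r ≤ r₁ ∧ P r ∧ ¬ P (2 * r) := by
  by_contra hcon
  push Not at hcon
  have hall : ∀ j : ℕ, 2 ^ j * r₀ ≤ r₁ ∧ P (2 ^ j * r₀) := by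
    intro j
    induction j with
    | zero => simpa using ⟨hr₁, h₀⟩
    | succ j ih =>
      have h1 : 0 < 2 ^ j * r₀ := by positivity
      have h2 := hb _ h1 ih.1 ih.2
      rw [pow_succ, mul_comm (2 ^ j : ℝ) 2, mul_assoc]
      exact ⟨h2, hcon _ h1 h2 ih.2⟩
  obtain ⟨j, hj⟩ := pow_unbounded_of_one_lt (r₁ / r₀) one_lt_two
  rw [div_lt_iff₀ hr₀] at hj
  exact absurd (hall j).1 (not_le.2 hj)

set_option maxHeartbeats 1000000 in
/-- The measure of the superlevel sets decays geometrically when the value at the origin is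
small. -/
theorem exists_superLevel_decay (hn : 1 ≤ n) (hp : 2 < p) (hlam : 0 < lam) (hLam : lam ≤ Lam) :
    ∃ M H₀ c μ ϑ : ℝ, 1 < M ∧ 0 < H₀ ∧ 0 < c ∧ 0 < μ ∧ μ < 1 ∧ 0 < ϑ ∧ ϑ < 1 ∧
      ∀ v : Space n × ℝ → ℝ, IsSuper lam Lam p (bigCyl n) v → v (0, 0) < c → ∀ k : ℕ,
        volume (superLevel v (ϑ ^ (k + 1) / 4) (H₀ * M ^ (k + 1)))
          ≤ ENNReal.ofReal μ * volume (superLevel v (ϑ ^ k / 4) (H₀ * M ^ k)) := by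
  obtain ⟨κ⟩ := exists_barrierParam (n := n) hn hp hlam hLam
  obtain ⟨h, δ₀, hh, hδ₀, hgrow⟩ := exists_growth hn hp hlam hLam κ
  obtain ⟨a, c, γ, ha, hc, hγ, hcore⟩ := exists_core_bound hp κ
  set δ : ℝ := min δ₀ (1 / 2) with hδ
  have hδ0 : 0 < δ := lt_min hδ₀ (by norm_num)
  set K : ℝ := 5 ^ n * (1 + 2 * 2 ^ p) with hK
  have hK1 : 1 ≤ K := by
    have h1 : (1 : ℝ) ≤ 5 ^ n := one_le_pow₀ (by norm_num)
    have h2 : (0 : ℝ) < 2 ^ p := by positivity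
    nlinarith
  set δ' : ℝ := δ / K with hδ'
  have hδ'0 : 0 < δ' := by positivity
  have hδ'1 : δ' ≤ 1 / 2 := by
    rw [hδ', div_le_iff₀ (by linarith)]
    have := min_le_right δ₀ (1 / 2)
    linarith
  -- Duration `m = 1 / δ'` makes the shadow estimate lose only `1 + δ'`, less than the factor `1 -
  -- δ'` gained from density; the product is `1 - δ' ^ 2 < 1`.
  obtain ⟨M, R, hM, hR, hg⟩ := hgrow (1 / δ') (by positivity)
  -- Radii allowed by the core bound at height `M^k` shrink like `ϑ^k`, so the enlargement of the
  -- domain per step is summable.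
  set ϑ : ℝ := M ^ (-γ) with hϑ
  have hM0 : 0 < M := by linarith
  have hϑ0 : 0 < ϑ := by positivity
  have hϑ1 : ϑ < 1 := Real.rpow_lt_one_of_one_lt_of_neg hM (by linarith)
  set L : ℝ := (2 * (1 / δ') + 1) * (2 ^ p * h) with hL
  have h2p : (1 : ℝ) ≤ 2 ^ p := Real.one_le_rpow (by norm_num) (by linarith)
  have hLh : h ≤ L := by
    have h1 : 1 * h ≤ 2 ^ p * h := by gcongr
    have h2 : 1 * (2 ^ p * h) ≤ L := by
      rw [hL]; gcongr; have : 0 < 1 / δ' := by positivity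
      linarith
    linarith
  have hL1 : 1 < L := by linarith
  set r₁ : ℝ := min (1 / R) (1 / (4 * L)) with hr₁
  have hr₁0 : 0 < r₁ := by
    have : 0 < R := by linarith
    exact lt_min (by positivity) (by positivity)
  have hr₁R : R * r₁ ≤ 1 := by
    have := min_le_left (1 / R) (1 / (4 * L))
    rw [← hr₁, le_div_iff₀ (by linarith)] at this
    linarith
  have hr₁L : L * r₁ ≤ 1 / 4 := by
    have := min_le_right (1 / R) (1 / (4 * L))
    rw [← hr₁, le_div_iff₀ (by linarith)] at this
    linarith
  have hr₁1 : r₁ ≤ 1 := by nlinarith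
  set η : ℝ := min (r₁ / 2) ((1 - ϑ) / (4 * (4 + L))) with hη
  have hη0 : 0 < η := lt_min (by linarith) (by
    have : 0 < 1 - ϑ := by linarith
    positivity)
  -- The initial height is raised until the core radius at the first step is below `η`, small enough
  -- for all cylinders to stay within the margins.
  obtain ⟨G, hG1, hGη⟩ : ∃ G : ℝ, 1 ≤ G ∧ a * G ^ (-γ) ≤ η := by
    have h1 : Tendsto (fun G : ℝ => a * G ^ (-γ)) atTop (𝓝 0) := by
      simpa using (tendsto_rpow_neg_atTop hγ).const_mul a
    obtain ⟨G, h2, h3⟩ := ((h1.eventually (gt_mem_nhds hη0)).and (eventually_ge_atTop 1)).exists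
    exact ⟨G, h3, h2.le⟩
  refine ⟨M, 4 * G, c, 1 - δ' ^ 2, ϑ, hM, by linarith, hc, by nlinarith, by
    have := pow_pos hδ'0 2
    linarith, hϑ0, hϑ1, ?_⟩
  intro v hv hv0 k
  have hϑk : ϑ ^ (k + 1) ≤ 1 := pow_le_one₀ hϑ0.le hϑ1.le
  have hϑk' : ϑ ^ k ≤ 1 := pow_le_one₀ hϑ0.le hϑ1.le
  have hϑk0 : 0 < ϑ ^ (k + 1) := by positivity
  have hMk : 1 ≤ M ^ (k + 1) := one_le_pow₀ hM.le
  set H : ℝ := 4 * G * M ^ (k + 1) with hH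
  have hH4 : 1 ≤ H / 4 := by
    rw [hH]
    nlinarith
  have hH1 : 1 ≤ H := by linarith
  have hH0 : 0 < H := by linarith
  have hHM : H / M = 4 * G * M ^ k := by
    rw [hH, pow_succ]
    field_simp
  have hHγ : a * (H / 4) ^ (-γ) ≤ η * ϑ ^ (k + 1) := by
    have e1 : H / 4 = G * M ^ (k + 1) := by rw [hH]; ring
    have e2 : (M ^ (k + 1)) ^ (-γ) = ϑ ^ (k + 1) := by
      rw [hϑ, ← Real.rpow_natCast, ← Real.rpow_natCast, ← Real.rpow_mul hM0.le,
        ← Real.rpow_mul hM0.le, mul_comm]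
    rw [e1, Real.mul_rpow (by linarith) (by positivity), e2, ← mul_assoc]
    gcongr
  set A := superLevel v (ϑ ^ (k + 1) / 4) H with hA
  set A' := superLevel v (ϑ ^ k / 4) (4 * G * M ^ k) with hA'
  have hAo : IsOpen A := hv.isOpen_superLevel (by linarith) _
  have hA'o : IsOpen A' := hv.isOpen_superLevel (by linarith) _
  have hdrop : ϑ ^ (k + 1) * (1 - ϑ) ≤ ϑ ^ k - ϑ ^ (k + 1) := by
    have h1 : ϑ ^ (k + 1) ≤ ϑ ^ k := pow_le_pow_of_le_one hϑ0.le hϑ1.le (Nat.le_succ k)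
    have h2 : ϑ ^ k - ϑ ^ (k + 1) = ϑ ^ k * (1 - ϑ) := by ring
    rw [h2]
    exact mul_le_mul_of_nonneg_right h1 (by linarith)
  have hηL : (4 + L) * (η * ϑ ^ (k + 1)) ≤ (ϑ ^ k - ϑ ^ (k + 1)) / 4 := by
    have h1 := min_le_right (r₁ / 2) ((1 - ϑ) / (4 * (4 + L)))
    rw [← hη, le_div_iff₀ (by linarith)] at h1
    have h2 := mul_le_mul_of_nonneg_right h1 hϑk0.le
    linarith
  have hηr : η * ϑ ^ (k + 1) ≤ r₁ / 2 := by
    have h1 := min_le_left (r₁ / 2) ((1 - ϑ) / (4 * (4 + L)))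
    calc η * ϑ ^ (k + 1) ≤ η * 1 := by gcongr
      _ ≤ r₁ / 2 := by rw [mul_one]; exact h1
  have hts : ∀ r, 0 < r → r ≤ r₁ → L * timeScale p H r ≤ L * r := fun r h1 h2 => by
    have := timeScale_le hp hH1 h1 (h2.trans hr₁1)
    gcongr
  -- High density on radius `r` puts `H / 4` on a ball of radius `r`. If `r` were not below the core
  -- radius bound, the origin would have value at least `c`, contrary to assumption.
  have hgood : ∀ z ∈ A, ∀ r, 0 < r → r ≤ r₁ →
      volume (intrinsicCyl p h H r z \ A) ≤ ENNReal.ofReal δ * volume (intrinsicCyl p h H r z) →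
      r < η * ϑ ^ (k + 1) ∧ ∀ x t, ‖x - z.1‖ < 4 * r → z.2 + 2 ^ p * (h * timeScale p H r) < t →
        t < z.2 + (2 * (1 / δ') + 1) * (2 ^ p * (h * timeScale p H r)) → H / M < v (x, t) := by
    rintro z ⟨⟨hz1, hz2, hz3⟩, hz4⟩ r hr hrr₁ hdens
    rw [mem_ball_zero_iff] at hz1
    have hσ0 : 0 < timeScale p H r := timeScale_pos hH0 hr
    have hLr : L * r ≤ 1 / 4 := le_trans (by gcongr) hr₁L
    have hLt := hts r hr hrr₁
    have hht : h * timeScale p H r ≤ L * timeScale p H r := by gcongr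
    have hRr : R * r ≤ 1 := le_trans (by gcongr) hr₁R
    have hδδ : ENNReal.ofReal δ ≤ ENNReal.ofReal δ₀ := ENNReal.ofReal_le_ofReal (min_le_left _ _)
    have hbox : Metric.closedBall z.1 (R * r) ×ˢ Icc (z.2 - h * timeScale p H r)
        (z.2 + (2 * (1 / δ') + 1) * (2 ^ p * (h * timeScale p H r))) ⊆ bigCyl n := by
      rintro w ⟨hw1, hw2, hw3⟩
      have e1 : (2 * (1 / δ') + 1) * (2 ^ p * (h * timeScale p H r)) = L * timeScale p H r := by
        rw [hL]; ring
      rw [e1] at hw3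
      refine ⟨?_, by linarith, by linarith⟩
      rw [Metric.mem_closedBall, dist_eq_norm] at hw1
      rw [mem_ball_zero_iff]
      have := norm_add_le (w.1 - z.1) z.1
      rw [sub_add_cancel] at this
      linarith
    obtain ⟨hg1, hg2⟩ := hg (bigCyl n) v hv z H r hH0 hr hbox A hAo.measurableSet (fun w hw => hw.2)
      (hdens.trans (by gcongr))
    refine ⟨?_, hg2⟩
    by_contra hcon
    push Not at hcon
    have hht' : 0 < (h - 1) * timeScale p H r := mul_pos (by linarith) hσ0
    refine absurd (hcore v hv z.1 (z.2 - (h - 1) * timeScale p H r) (H / 4) (by linarith)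
        (by linarith) (by linarith) hH4 fun x hx => hg1 x (by linarith)) (not_le.2 hv0)
  have hstart : ∀ z ∈ A, ∃ r₀, 0 < r₀ ∧ r₀ ≤ r₁ ∧ volume (intrinsicCyl p h H r₀ z \ A)
      ≤ ENNReal.ofReal δ * volume (intrinsicCyl p h H r₀ z) := by
    intro z hz
    obtain ⟨e, he, hball⟩ := Metric.isOpen_iff.1 hAo z hz
    set r₀ : ℝ := min r₁ (e / (2 + L)) with hr₀
    have hr₀0 : 0 < r₀ := lt_min hr₁0 (by positivity)
    have hr₀1 : r₀ ≤ r₁ := min_le_left _ _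
    have hr₀e : (2 + L) * r₀ ≤ e := by
      have := min_le_right r₁ (e / (2 + L))
      rw [← hr₀, le_div_iff₀ (by linarith)] at this
      linarith
    refine ⟨r₀, hr₀0, hr₀1, ?_⟩
    have hsub : intrinsicCyl p h H r₀ z ⊆ A := by
      refine Subset.trans ?_ hball
      rintro w ⟨hw1, hw2, hw3⟩
      have h1 := hts r₀ hr₀0 hr₀1
      have h2 : h * timeScale p H r₀ ≤ L * timeScale p H r₀ := by
        have := timeScale_pos (p := p) hH0 hr₀0
        gcongr
      have h3 : 0 < L * r₀ := by positivity
      rw [Metric.mem_ball] at hw1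
      rw [Metric.mem_ball, Prod.dist_eq, max_lt_iff]
      refine ⟨by linarith, ?_⟩
      rw [Real.dist_eq, abs_lt]
      constructor <;> linarith
    rw [sdiff_eq_bot_iff.2 hsub]
    simp
  -- Stopping radius: density is high at `r`, giving growth into the future, and fails at `2 * r`,
  -- giving a definite part of the cylinder outside `A`.
  have hradius : ∀ z ∈ A, ∃ r, 0 < r ∧ 2 * r ≤ r₁ ∧
      volume (intrinsicCyl p h H r z \ A) ≤ ENNReal.ofReal δ * volume (intrinsicCyl p h H r z) ∧
      ¬ volume (intrinsicCyl p h H (2 * r) z \ A)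
        ≤ ENNReal.ofReal δ * volume (intrinsicCyl p h H (2 * r) z) := by
    intro z hz
    obtain ⟨r₀, h1, h2, h3⟩ := hstart z hz
    refine exists_last_double (P := fun r => volume (intrinsicCyl p h H r z \ A)
      ≤ ENNReal.ofReal δ * volume (intrinsicCyl p h H r z)) h1 h2 h3 fun r hr hr' hP => ?_
    have := (hgood z hz r hr hr' hP).1
    linarith
  choose! r hr0 hr2 hrd hrn using hradius
  set E : Set (Space n × ℝ) := ⋃ z ∈ A, intrinsicCyl p h H (2 * r z) z with hE
  have hdense : ENNReal.ofReal δ' * volume E ≤ volume (E \ A) :=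
    volume_iUnion_le_diff hp (by linarith) hH0 hδ0 hAo.measurableSet (fun z => 2 * r z)
      (fun z hz => by linarith [hr0 z hz]) hr2 fun z hz => (not_le.1 (hrn z hz)).le
  -- The stopped cylinder has radius parameter `2 * r`, hence ball radius `4 * r` and half length
  -- `2^p * h * timeScale p H r`. The growth lemma at `r` was stated for exactly this ball and the
  -- times following it.
  have hshadow : volume E ≤ ENNReal.ofReal (1 + 1 / (1 / δ')) * volume A' := by
    refine volume_iUnion_cyl_shadow_le (A := A) hA'o (a := -3) (b := 0) ?_ (by positivity)
      (fun z => 2 * (2 * r z)) (fun z => h * timeScale p H (2 * r z)) ?_ ?_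
    · rintro z ⟨⟨-, h1, h2⟩, -⟩
      exact ⟨mem_univ _, by linarith, by linarith⟩
    · intro z hz
      have := hr0 z hz
      exact mul_pos (by linarith) (timeScale_pos hH0 (by linarith))
    · rintro z hz w ⟨hw1, hw2, hw3⟩
      have hrz := hr0 z hz
      obtain ⟨h1, h2⟩ := hgood z hz (r z) hrz (by linarith [hr2 z hz]) (hrd z hz)
      have e1 : h * timeScale p H (2 * r z) = 2 ^ p * (h * timeScale p H (r z)) := by
        rw [timeScale_two_mul H hrz]; ring
      simp only [e1] at hw2 hw3
      rw [Metric.mem_ball, dist_eq_norm] at hw1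
      have h3 := h2 w.1 w.2 (by linarith) hw2 hw3
      rw [hHM] at h3
      refine ⟨⟨?_, ?_, ?_⟩, h3⟩
      all_goals
        have hσ0 : 0 < timeScale p H (r z) := timeScale_pos hH0 hrz
        have e2 : (2 * (1 / δ') + 1) * (2 ^ p * (h * timeScale p H (r z)))
          = L * timeScale p H (r z) := by rw [hL]; ring
        rw [e2] at hw3
        have h4 := hts (r z) hrz (by linarith [hr2 z hz])
        have h5 : (4 + L) * r z ≤ (4 + L) * (η * ϑ ^ (k + 1)) := by gcongr
        have h6 : 0 < L * r z := by positivity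
        have h7 : 0 < 2 ^ p * (h * timeScale p H (r z)) := by positivity
        obtain ⟨⟨hz1, hz2, hz3⟩, -⟩ := hz
      · rw [mem_ball_zero_iff] at hz1 ⊢
        have := norm_add_le (w.1 - z.1) z.1
        rw [sub_add_cancel] at this
        linarith
      · linarith
      · linarith
  have hA'fin : volume A' ≠ ⊤ := by
    refine ne_top_of_le_ne_top ?_ (measure_mono (fun z hz => hz.1 : A' ⊆ midCyl n (ϑ ^ k / 4)))
    rw [midCyl, Measure.volume_eq_prod, Measure.prod_prod]
    exact ENNReal.mul_ne_top measure_ball_lt_top.ne measure_Ioo_lt_top.ne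
  have hEfin : volume E ≠ ⊤ :=
    ne_top_of_le_ne_top (ENNReal.mul_ne_top ENNReal.ofReal_ne_top hA'fin) hshadow
  have hAE : A ⊆ E := fun z hz => by
    have h1 : 0 < 2 * r z := by linarith [hr0 z hz]
    have h2 : 0 < h * timeScale p H (2 * r z) := mul_pos (by linarith) (timeScale_pos hH0 h1)
    exact mem_iUnion₂.2 ⟨z, hz, Metric.mem_ball_self (by linarith), by linarith, by linarith⟩
  have hsplit : volume A + ENNReal.ofReal δ' * volume E ≤ volume E := by
    calc _ ≤ volume (E ∩ A) + volume (E \ A) := by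
          rw [inter_eq_self_of_subset_right hAE]
          gcongr
      _ = volume E := measure_inter_add_sdiff E hAo.measurableSet
  have hAfin : volume A ≠ ⊤ := ne_top_of_le_ne_top hEfin (measure_mono hAE)
  rw [← ENNReal.ofReal_toReal hAfin, ← ENNReal.ofReal_toReal hA'fin,
    ← ENNReal.ofReal_mul (by nlinarith)]
  apply ENNReal.ofReal_le_ofReal
  rw [← ENNReal.ofReal_toReal hAfin, ← ENNReal.ofReal_toReal hEfin,
    ← ENNReal.ofReal_mul hδ'0.le, ← ENNReal.ofReal_add (by positivity) (by positivity),
    ENNReal.ofReal_le_ofReal_iff (by positivity)] at hsplit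
  rw [← ENNReal.ofReal_toReal hA'fin, ← ENNReal.ofReal_toReal hEfin,
    ← ENNReal.ofReal_mul (by positivity), ENNReal.ofReal_le_ofReal_iff (by positivity),
    one_div_one_div] at hshadow
  have := mul_le_mul_of_nonneg_left hshadow (by linarith : 0 ≤ 1 - δ')
  linarith

end Decay

/-! ### From decay to integrability of a small power -/

section Integral

variable {n : ℕ} {lam Lam p : ℝ}

/-- The unit cylinder between the times `-2` and `-1`. -/
def targetCyl (n : ℕ) : Set (Space n × ℝ) := Metric.ball 0 1 ×ˢ Ioc (-2) (-1)

theorem measurableSet_targetCyl : MeasurableSet (targetCyl n) :=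
  measurableSet_ball.prod measurableSet_Ioc

theorem volume_targetCyl_ne_top : volume (targetCyl n) ≠ ⊤ := by
  rw [targetCyl, Measure.volume_eq_prod, Measure.prod_prod]
  exact ENNReal.mul_ne_top measure_ball_lt_top.ne measure_Ioc_lt_top.ne

theorem volume_targetCyl_pos : 0 < volume (targetCyl n) := by
  rw [targetCyl, Measure.volume_eq_prod, Measure.prod_prod, Real.volume_Ioc]
  exact ENNReal.mul_pos (Metric.measure_ball_pos _ _ one_pos).ne' (by norm_num)

theorem targetCyl_subset_midCyl {ℓ : ℝ} (hℓ : 0 < ℓ) : targetCyl n ⊆ midCyl n ℓ := by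
  rintro z ⟨h1, h2, h3⟩
  refine ⟨Metric.ball_subset_ball (by linarith) h1, by linarith, by linarith⟩

/-- A power of a nonnegative number is dominated by its layers along a geometric sequence. -/
theorem ofReal_rpow_le_tsum {M H₀ ε y : ℝ} (hM : 1 < M) (hH₀ : 0 < H₀) (hε : 0 < ε) (hy : 0 ≤ y) :
    ENNReal.ofReal (y ^ ε) ≤ ENNReal.ofReal (H₀ ^ ε) +
      ∑' k : ℕ, (Ioi (H₀ * M ^ k)).indicator
        (fun _ => ENNReal.ofReal ((H₀ * M ^ (k + 1)) ^ ε)) y := by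
  by_cases h0 : y ≤ H₀
  · refine le_trans (ENNReal.ofReal_le_ofReal ?_) le_self_add
    exact Real.rpow_le_rpow hy h0 hε.le
  push Not at h0
  obtain ⟨k, hk1, hk2⟩ : ∃ k : ℕ, H₀ * M ^ k < y ∧ y ≤ H₀ * M ^ (k + 1) := by
    obtain ⟨j, hj⟩ := pow_unbounded_of_one_lt (y / H₀) hM
    have hex : ∃ j : ℕ, y ≤ H₀ * M ^ j := ⟨j, by
      rw [div_lt_iff₀ hH₀] at hj
      linarith⟩
    classical
    have h1 := Nat.find_spec hex
    rcases hj0 : Nat.find hex with _ | k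
    · rw [hj0] at h1
      simp at h1
      linarith
    · refine ⟨k, ?_, hj0 ▸ h1⟩
      have := Nat.find_min hex (m := k) (by omega)
      exact not_le.1 this
  refine le_trans ?_ le_add_self
  refine le_trans ?_ (ENNReal.le_tsum k)
  rw [indicator_of_mem (mem_Ioi.2 hk1)]
  exact ENNReal.ofReal_le_ofReal (Real.rpow_le_rpow hy hk2 hε.le)

/-- The weak Harnack estimate for a normalized supersolution. -/
theorem exists_lintegral_le (hn : 1 ≤ n) (hp : 2 < p) (hlam : 0 < lam) (hLam : lam ≤ Lam) :
    ∃ (ε c : ℝ) (C : ENNReal), 0 < ε ∧ 0 < c ∧ C ≠ ⊤ ∧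
      ∀ v : Space n × ℝ → ℝ, IsSuper lam Lam p (bigCyl n) v → v (0, 0) = c →
        ∫⁻ z in targetCyl n, ENNReal.ofReal (v z ^ ε) ≤ C := by
  obtain ⟨M, H₀, c, μ, ϑ, hM, hH₀, hc, hμ0, hμ1, hϑ0, hϑ1, hdecay⟩ :=
    exists_superLevel_decay (n := n) hn hp hlam hLam
  have hM0 : 0 < M := by linarith
  -- The layer of height `M^k` contributes about `(M^ε * μ)^k`, so this is the condition for the
  -- series to converge.
  obtain ⟨ε, hε1, hε0⟩ : ∃ ε : ℝ, M ^ ε * μ < 1 ∧ 0 < ε := by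
    have h1 : Tendsto (fun ε : ℝ => M ^ ε * μ) (𝓝[>] 0) (𝓝 μ) := by
      apply Tendsto.mono_left _ nhdsWithin_le_nhds
      have h2 : Continuous fun ε : ℝ => M ^ ε * μ :=
        (Real.continuous_const_rpow hM0.ne').mul continuous_const
      simpa using h2.tendsto 0
    exact ((h1.eventually (gt_mem_nhds hμ1)).and self_mem_nhdsWithin).exists
  set V₀ : ENNReal := volume (midCyl n (1 / 4)) with hV₀
  have hV₀t : V₀ ≠ ⊤ := by
    rw [hV₀, midCyl, Measure.volume_eq_prod, Measure.prod_prod]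
    exact ENNReal.mul_ne_top measure_ball_lt_top.ne measure_Ioo_lt_top.ne
  -- The decay needs a value strictly below `c`; normalizing to `c / 2` provides it.
  refine ⟨ε, c / 2, ENNReal.ofReal (H₀ ^ ε) * volume (targetCyl n) +
    ∑' k : ℕ, ENNReal.ofReal ((H₀ * M) ^ ε) * V₀ * ENNReal.ofReal (M ^ ε * μ) ^ k, hε0,
    by linarith, ?_, ?_⟩
  · refine ENNReal.add_ne_top.2
      ⟨ENNReal.mul_ne_top ENNReal.ofReal_ne_top volume_targetCyl_ne_top, ?_⟩
    rw [ENNReal.tsum_mul_left, ENNReal.tsum_geometric]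
    refine ENNReal.mul_ne_top (ENNReal.mul_ne_top ENNReal.ofReal_ne_top hV₀t) ?_
    rw [ENNReal.inv_ne_top]
    exact (tsub_pos_of_lt (by rw [ENNReal.ofReal_lt_one]; exact hε1)).ne'
  intro v hv hv0
  have hlevel : ∀ k : ℕ, volume (superLevel v (ϑ ^ k / 4) (H₀ * M ^ k))
      ≤ ENNReal.ofReal (μ ^ k) * V₀ := by
    intro k
    induction k with
    | zero =>
      simp only [pow_zero, ENNReal.ofReal_one, one_mul]
      exact measure_mono fun z hz => hz.1
    | succ k ih =>
      refine (hdecay v hv (by linarith) k).trans ?_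
      rw [pow_succ, mul_comm (μ ^ k), ENNReal.ofReal_mul hμ0.le, mul_assoc]
      gcongr
  have hϑ4 : ∀ k : ℕ, ϑ ^ k / 4 ≤ 1 / 4 := fun k => by
    have := pow_le_one₀ (n := k) hϑ0.le hϑ1.le
    linarith
  have hϑ4' : ∀ k : ℕ, 0 < ϑ ^ k / 4 := fun k => by positivity
  have hmeas : ∀ k : ℕ, MeasurableSet (superLevel v (ϑ ^ k / 4) (H₀ * M ^ k)) := fun k =>
    (hv.isOpen_superLevel (hϑ4 k) _).measurableSet
  calc ∫⁻ z in targetCyl n, ENNReal.ofReal (v z ^ ε)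
      ≤ ∫⁻ z in targetCyl n, (ENNReal.ofReal (H₀ ^ ε) +
        ∑' k : ℕ, (superLevel v (ϑ ^ k / 4) (H₀ * M ^ k)).indicator
          (fun _ => ENNReal.ofReal ((H₀ * M ^ (k + 1)) ^ ε)) z) := by
        refine setLIntegral_mono' measurableSet_targetCyl fun z hz => ?_
        have hz' : z ∈ bigCyl n :=
          midCyl_subset_bigCyl le_rfl (targetCyl_subset_midCyl (by norm_num) hz)
        refine (ofReal_rpow_le_tsum hM hH₀ hε0 (hv.nonneg z hz')).trans ?_
        gcongr with k
        by_cases hk : H₀ * M ^ k < v z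
        · have hzk : z ∈ superLevel v (ϑ ^ k / 4) (H₀ * M ^ k) :=
            ⟨targetCyl_subset_midCyl (hϑ4' k) hz, hk⟩
          rw [indicator_of_mem (mem_Ioi.2 hk), indicator_of_mem hzk]
        · rw [indicator_of_notMem (show v z ∉ Ioi (H₀ * M ^ k) from hk)]
          exact zero_le
    _ = ENNReal.ofReal (H₀ ^ ε) * volume (targetCyl n) +
        ∑' k : ℕ, ∫⁻ z in targetCyl n, (superLevel v (ϑ ^ k / 4) (H₀ * M ^ k)).indicator
          (fun _ => ENNReal.ofReal ((H₀ * M ^ (k + 1)) ^ ε)) z := by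
        rw [lintegral_add_left measurable_const, setLIntegral_const, lintegral_tsum]
        exact fun k => (measurable_const.indicator (hmeas k)).aemeasurable
    _ ≤ _ := by
        gcongr with k
        calc _ ≤ ∫⁻ z, (superLevel v (ϑ ^ k / 4) (H₀ * M ^ k)).indicator
              (fun _ => ENNReal.ofReal ((H₀ * M ^ (k + 1)) ^ ε)) z := setLIntegral_le_lintegral _ _
          _ = ENNReal.ofReal ((H₀ * M ^ (k + 1)) ^ ε) *
              volume (superLevel v (ϑ ^ k / 4) (H₀ * M ^ k)) := lintegral_indicator_const (hmeas k) _
          _ ≤ ENNReal.ofReal ((H₀ * M ^ (k + 1)) ^ ε) * (ENNReal.ofReal (μ ^ k) * V₀) := by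
              gcongr
              exact hlevel k
          _ = _ := by
              have e1 : (H₀ * M ^ (k + 1)) ^ ε = (H₀ * M) ^ ε * (M ^ ε) ^ k := by
                rw [pow_succ', ← mul_assoc, Real.mul_rpow (by positivity) (by positivity),
                  ← Real.rpow_natCast, ← Real.rpow_natCast, ← Real.rpow_mul hM0.le,
                  ← Real.rpow_mul hM0.le, mul_comm ε]
              rw [e1, ENNReal.ofReal_mul (by positivity), ← ENNReal.ofReal_pow (by positivity),
                mul_pow, ENNReal.ofReal_mul (p := (M ^ ε) ^ k) (by positivity)]
              ring

theorem setLIntegral_preimage_scaleMap (x₀ : Space n) (t₀ : ℝ) {ρ σ : ℝ} (hρ : 0 < ρ) (hσ : 0 < σ)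
    {Q : Set (Space n × ℝ)} (hQ : MeasurableSet Q) {f : Space n × ℝ → ENNReal}
    (hf : AEMeasurable f (volume.restrict Q)) :
    ∫⁻ z in scaleMap x₀ t₀ ρ σ ⁻¹' Q, f (scaleMap x₀ t₀ ρ σ z)
      = ENNReal.ofReal ((ρ ^ n)⁻¹ * σ⁻¹) * ∫⁻ z in Q, f z := by
  have h1 : Measure.map (scaleMap x₀ t₀ ρ σ) (volume.restrict (scaleMap x₀ t₀ ρ σ ⁻¹' Q))
      = ENNReal.ofReal ((ρ ^ n)⁻¹ * σ⁻¹) • (volume : Measure (Space n × ℝ)).restrict Q := by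
    rw [← Measure.restrict_map (measurable_scaleMap _ _ _ _) hQ, map_scaleMap _ _ hρ hσ,
      Measure.restrict_smul]
  rw [← lintegral_map' (by rw [h1]; exact hf.smul_measure _)
    (measurable_scaleMap _ _ _ _).aemeasurable, h1, lintegral_smul_measure, smul_eq_mul]

theorem aemeasurable_of_lowerSemicontinuousOn {S Q : Set (Space n × ℝ)} {u : Space n × ℝ → ℝ}
    (hu : LowerSemicontinuousOn u S) (hQ : MeasurableSet Q) (hQS : Q ⊆ S) :
    AEMeasurable u (volume.restrict Q) := by
  refine aemeasurable_restrict_of_measurable_subtype hQ ?_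
  exact (lowerSemicontinuous_restrict_iff.2 (hu.mono hQS)).measurable

end Integral

end WeakHarnack

end

/-! ### Return to the original variables -/

open WeakHarnack

theorem theorem1p1 (n : ℕ) (hn : 1 ≤ n) (lam Lam p : ℝ) (hlam : 0 < lam) (hLam : lam ≤ Lam)
    (hp : 2 < p) :
    ∃ ε c C : ℝ, 0 < ε ∧ 0 < c ∧ 1 < C ∧
      ∀ (U : Set (Space n)) (T : ℝ)
        (F : Matrix (Fin n) (Fin n) ℝ → Space n → Space n → ℝ → ℝ)
        (u : Space n × ℝ → ℝ),
        IsOpen U →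
        IsDegenerateElliptic lam Lam p F (cylDomain U 0 T) →
        IsViscositySupersolution F U 0 T u →
        (∀ z ∈ cylDomain U 0 T, 0 ≤ u z) →
        ∀ (x₀ : Space n) (t₀ ρ θ : ℝ),
          (x₀, t₀) ∈ cylDomain U 0 T →
          0 < u (x₀, t₀) →
          0 < ρ →
          θ = (c / u (x₀, t₀)) ^ (p - 2) →
          cylMinus p (x₀, t₀) (3 * ρ) θ ⊆ cylDomain U 0 T →
          IntegrableOn (fun z => u z ^ ε) (cylMinus p (x₀, t₀ - θ * ρ ^ p) ρ θ) volume ∧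
          (⨍ z in cylMinus p (x₀, t₀ - θ * ρ ^ p) ρ θ, u z ^ ε ∂volume) ^ (1 / ε)
            ≤ C * u (x₀, t₀) := by
  obtain ⟨ε, c, C, hε, hc, hC, hmain⟩ := exists_lintegral_le (n := n) hn hp hlam hLam
  set q₁ : ℝ := (volume (targetCyl n)).toReal with hq₁
  have hq₁0 : 0 < q₁ := ENNReal.toReal_pos volume_targetCyl_pos.ne' volume_targetCyl_ne_top
  refine ⟨ε, c, max 2 ((C.toReal / q₁) ^ (1 / ε) / c), hε, hc,
    lt_of_lt_of_le one_lt_two (le_max_left _ _), ?_⟩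
  intro U T F u hU hF hu hpos x₀ t₀ ρ θ hz₀ hu₀ hρ hθ hcyl
  -- Multiplying by `k` makes the value at the origin equal to `c`, and `θ * ρ ^ p = k ^ (p - 2) * ρ
  -- ^ p` is the time factor demanded by the intrinsic scaling.
  set k : ℝ := c / u (x₀, t₀) with hk
  have hk0 : 0 < k := div_pos hc hu₀
  have hθ0 : 0 < θ := by rw [hθ]; positivity
  set σ : ℝ := θ * ρ ^ p with hσ
  have hσ0 : 0 < σ := by positivity
  -- Since `3 ^ p ≥ 9`, the given cylinder of radius `3 * ρ` contains the image of `bigCyl`, whose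
  -- length in time is `9`.
  have h3p : 9 * σ ≤ θ * (3 * ρ) ^ p := by
    rw [Real.mul_rpow (by norm_num) hρ.le]
    have h1 : (3 : ℝ) ^ (2 : ℝ) ≤ 3 ^ p := Real.rpow_le_rpow_of_exponent_le (by norm_num) hp.le
    have h2 : (9 : ℝ) ≤ 3 ^ p := by norm_num at h1; exact h1
    calc 9 * σ ≤ 3 ^ p * σ := by gcongr
      _ = _ := by rw [hσ]; ring
  set Q : Set (Space n × ℝ) := cylMinus p (x₀, t₀ - σ) ρ θ with hQ
  have hQm : MeasurableSet Q := measurableSet_ball.prod measurableSet_Ioc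
  have hQU : Q ⊆ cylDomain U 0 T := by
    rintro z ⟨h1, h2, h3⟩
    simp only [← hσ] at h1 h2 h3
    refine hcyl ⟨Metric.ball_subset_ball (by linarith) h1, ?_, ?_⟩ <;> simp only <;> linarith
  have hpre : scaleMap x₀ t₀ ρ σ ⁻¹' Q = targetCyl n := by
    ext z
    simp only [hQ, cylMinus, ← hσ, scaleMap, targetCyl, mem_preimage, mem_prod, Metric.mem_ball,
      dist_eq_norm, add_sub_cancel_left, norm_smul, Real.norm_eq_abs, abs_of_pos hρ, mem_Ioc,
      sub_zero]
    refine and_congr ?_ (and_congr ?_ ?_)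
    · exact mul_lt_iff_lt_one_right hρ
    · rw [show t₀ - σ - σ = t₀ + σ * (-2) by ring, add_lt_add_iff_left, mul_lt_mul_iff_right₀ hσ0]
    · rw [show t₀ - σ = t₀ + σ * (-1) by ring, add_le_add_iff_left, mul_le_mul_iff_right₀ hσ0]
  have hsup := (hu.isSuper hF hpos).comp_scale (S' := bigCyl n) x₀ t₀ hk0 hρ
    (σ := σ) (by rw [hσ, hθ]) (by
      rintro z ⟨h1, h2, h3⟩
      refine hcyl ⟨?_, ?_, ?_⟩
      · rw [mem_ball_zero_iff] at h1
        simp only [Metric.mem_ball, dist_eq_norm, add_sub_cancel_left, norm_smul,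
          Real.norm_eq_abs, abs_of_pos hρ]
        rw [mul_comm]
        gcongr
      · have := mul_lt_mul_of_pos_left h2 hσ0
        simp only
        linarith
      · have := mul_nonpos_of_nonneg_of_nonpos hσ0.le h3
        simp only
        linarith)
  have hbound := hmain _ hsup (by
    simp only [smul_zero, add_zero, mul_zero, hk]
    exact div_mul_cancel₀ _ hu₀.ne')
  have hum : AEMeasurable (fun z => u z ^ ε) (volume.restrict Q) :=
    (aemeasurable_of_lowerSemicontinuousOn hu.1 hQm hQU).pow_const ε
  set w : ℝ := (ρ ^ n)⁻¹ * σ⁻¹ with hw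
  have hw0 : 0 < w := by positivity
  have hI : ENNReal.ofReal w * ∫⁻ z in Q, ENNReal.ofReal (u z ^ ε)
      ≤ ENNReal.ofReal ((k ^ ε)⁻¹) * C := by
    rw [← setLIntegral_preimage_scaleMap x₀ t₀ hρ hσ0 hQm hum.ennreal_ofReal, hpre]
    refine le_trans (le_of_eq ?_) (mul_le_mul_right hbound _)
    rw [← lintegral_const_mul' _ _ ENNReal.ofReal_ne_top]
    refine setLIntegral_congr_fun measurableSet_targetCyl fun z hz => ?_
    rw [← hpre] at hz
    have hz' := hpos _ (hQU hz)
    simp only [scaleMap] at hz' ⊢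
    rw [← ENNReal.ofReal_mul (by positivity), Real.mul_rpow hk0.le hz',
      inv_mul_cancel_left₀ (by positivity)]
  have hItop : ∫⁻ z in Q, ENNReal.ofReal (u z ^ ε) ≠ ⊤ := by
    intro htop
    rw [htop, ENNReal.mul_top (by simpa using hw0)] at hI
    exact ENNReal.mul_ne_top ENNReal.ofReal_ne_top hC (top_le_iff.1 hI)
  have hnn : 0 ≤ᵐ[volume.restrict Q] fun z => u z ^ ε := by
    filter_upwards [ae_restrict_mem hQm] with z hz
    exact Real.rpow_nonneg (hpos z (hQU hz)) ε
  refine ⟨⟨hum.aestronglyMeasurable, ?_⟩, ?_⟩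
  · rw [hasFiniteIntegral_iff_ofReal hnn]
    exact hItop.lt_top
  set I : ℝ := ∫ z in Q, u z ^ ε with hIdef
  have hIeq : I = (∫⁻ z in Q, ENNReal.ofReal (u z ^ ε)).toReal :=
    integral_eq_lintegral_of_nonneg_ae hnn hum.aestronglyMeasurable
  have hIle : w * I ≤ (k ^ ε)⁻¹ * C.toReal := by
    have h1 := ENNReal.toReal_mono (ENNReal.mul_ne_top ENNReal.ofReal_ne_top hC) hI
    rwa [ENNReal.toReal_mul, ENNReal.toReal_mul, ENNReal.toReal_ofReal hw0.le,
      ENNReal.toReal_ofReal (by positivity), ← hIeq] at h1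
  have hqQ : q₁ = w * volume.real Q := by
    rw [hq₁, ← hpre, volume_preimage_scaleMap x₀ t₀ hρ hσ0 hQm, ENNReal.toReal_mul,
      ENNReal.toReal_ofReal hw0.le]
    rfl
  have hqpos : 0 < volume.real Q := by
    by_contra hcon
    push Not at hcon
    have := mul_nonpos_of_nonneg_of_nonpos hw0.le hcon
    linarith
  have hI0 : 0 ≤ I := by rw [hIeq]; positivity
  have havg : (⨍ z in Q, u z ^ ε ∂volume) ≤ (k ^ ε)⁻¹ * (C.toReal / q₁) := by
    rw [setAverage_eq, smul_eq_mul, ← hIdef, inv_mul_eq_div, ← mul_div_assoc,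
      div_le_div_iff₀ hqpos hq₁0, hqQ]
    calc I * (w * volume.real Q) = w * I * volume.real Q := by ring
      _ ≤ _ := by gcongr
  have havg0 : 0 ≤ ⨍ z in Q, u z ^ ε ∂volume := by
    rw [setAverage_eq, smul_eq_mul, ← hIdef]
    positivity
  calc _ ≤ ((k ^ ε)⁻¹ * (C.toReal / q₁)) ^ (1 / ε) :=
        Real.rpow_le_rpow havg0 havg (by positivity)
    _ = (C.toReal / q₁) ^ (1 / ε) / c * u (x₀, t₀) := by
        rw [Real.mul_rpow (by positivity) (by positivity), ← Real.rpow_neg hk0.le,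
          ← Real.rpow_mul hk0.le, show -ε * (1 / ε) = -1 by field_simp, Real.rpow_neg_one, hk,
          inv_div]
        ring
    _ ≤ _ := by
        gcongr
        exact le_max_right _ _
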